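/- Let $S^{n+1}$ be the unit sphere in $\mathbb{R}^{n+2}$. A smooth non-constant function $f:S^{n+1}\to\mathbb{R}$ is called isoparametric if $|\nabla f|^2=b(f)$ for some smooth function $b:\mathbb{R}\to\mathbb{R}$ and $\Delta f=a(f)$ for some function $a:\mathbb{R}\to\mathbb{R}$; a non-empty regular level set $M^n=f^{-1}(c)$ of such a function is called a (closed) isoparametric hypersurface of $S^{n+1}$. Let $M^n\subset S^{n+1}$ be an isoparametric hypersurface and let $\xi$ be a smooth field of unit normals to $M$ in $S^{n+1}$. Let $\theta\in\mathbb{R}$ with $\sin\theta\neq 0$ be such that $\cot\theta$ is a principal curvature of $M$ with respect to $\xi$, i.e. at every point $x\in M$ it is an eigenvalue of the shape operator $X\mapsto -D_X\xi$ on $T_xM$. Put $$\varphi_\theta(x)=\cos\theta\, x+\sin\theta\,\xi(x)\qquad (x\in M).$$ Then the focal submanifold $\varphi_\theta(M)$ is a compact smooth embedded submanifold (not necessarily connected) of $\mathbb{R}^{n+2}$, contained in $S^{n+1}$, and the focal map $\varphi_\theta: M\to\varphi_\theta(M)$ is a harmonic map for the induced Riemannian metrics. That is, $\varphi_\theta$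 is smooth and is a critical point of the energy $E(\psi)=\frac12\int_M|d\psi|^2\,dV_M$: for every smooth family of maps $\psi_t:M\to\varphi_\theta(M)$, $|t|<\delta$, with $\psi_0=\varphi_\theta$, the function $t\mapsto E(\psi_t)$ is differentiable at $0$ and $\frac{d}{dt}\big|_{t=0}E(\psi_t)=0$. -/

import Mathlib

open Set MeasureTheory Metric Module
open scoped ContDiff Manifold InnerProductSpace

noncomputable section

section Submanifolds

variable {E : Type*} [NormedAddCommGroup E] [InnerProductSpace ℝ E] [FiniteDimensional ℝ E]

/-- Near its point `y`, the set `N` is a smooth embedded `k`-dimensional submanifold of `E`: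
it is the zero set of a smooth submersion defined on a neighbourhood of `y`. -/
def IsSubmanifoldNear (k : ℕ) (N : Set E) (y : E) : Prop :=
  ∃ r : ℕ, finrank ℝ E = k + r ∧
    ∃ (U : Set E) (g : E → EuclideanSpace ℝ (Fin r)), IsOpen U ∧ y ∈ U ∧
      ContDiffOn ℝ ∞ g U ∧ (∀ z ∈ U, Function.Surjective (fderiv ℝ g z)) ∧
      N ∩ U = {z ∈ U | g z = 0}

/-- The tangent space at `x` of the submanifold `M` of `E`, as a linear subspace of `E`. For a
smooth embedded submanifold the tangent cone is already a linear subspace. -/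
def tangentSubspace (M : Set E) (x : E) : Submodule ℝ E :=
  Submodule.span ℝ (tangentConeAt ℝ M x)

/-- `|df|²(x) = ∑ i, |df (e i)|²` for an orthonormal basis `e` of the tangent space of `M` at `x`.
Only the restriction of `fderivWithin ℝ f M x` to the tangent space enters, and this restriction is
the differential of `f` along `M`. -/
def normSqDifferential (M : Set E) (f : E → E) (x : E) : ℝ :=
  ∑ i, ‖fderivWithin ℝ f M x
    ((stdOrthonormalBasis ℝ (tangentSubspace M x) i : tangentSubspace M x) : E)‖ ^ 2

/-- The energy `E(f) = ½ ∫_M |df|² dV` of a map `f` on an `n`-dimensional submanifold `M` of `E`.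
The Riemannian volume of `M` is the `n`-dimensional Hausdorff measure, normalized so as to agree
with Lebesgue measure on `n`-dimensional Euclidean space. -/
def energy [MeasurableSpace E] [BorelSpace E] (n : ℕ) (M : Set E) (f : E → E) : ℝ :=
  (1 / 2) * ∫ x in M, normSqDifferential M f x ∂(μHE[n])

/-- `F` is a smooth variation, with parameter in `(-δ, δ)`, of the map `φ : M → N` through maps
`M → N`. (On an embedded submanifold, `ContDiffOn` is smoothness in the sense of manifolds.) -/
structure IsSmoothVariation (M N : Set E) (φ : E → E) (δ : ℝ) (F : ℝ → E → E) : Prop where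
  smooth : ContDiffOn ℝ ∞ (fun p : ℝ × E => F p.1 p.2) (Ioo (-δ) δ ×ˢ M)
  mapsTo : ∀ t ∈ Ioo (-δ) δ, MapsTo (F t) M N
  initial : EqOn (F 0) φ M

/-- `φ : M → N` is a harmonic map between closed Riemannian manifolds, where `M` is `n`-dimensional
and both `M` and `N` are compact embedded submanifolds of the Euclidean space `E` with the induced
metrics: `φ` is a smooth map from `M` to `N` which is a critical point of the energy. The manifold
`N` need not be connected, and its components may have different dimensions. -/
structure IsHarmonicMap [MeasurableSpace E] [BorelSpace E]
    (n : ℕ) (M N : Set E) (φ : E → E) : Prop where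
  isCompact_source : IsCompact M
  isSubmanifold_source : ∀ x ∈ M, IsSubmanifoldNear n M x
  isCompact_target : IsCompact N
  isSubmanifold_target : ∀ y ∈ N, ∃ k : ℕ, IsSubmanifoldNear k N y
  smooth : ContDiffOn ℝ ∞ φ M
  mapsTo : MapsTo φ M N
  critical : ∀ (δ : ℝ) (F : ℝ → E → E), 0 < δ → IsSmoothVariation M N φ δ F →
    HasDerivAt (fun t => energy n M (F t)) 0 0

end Submanifolds

section Isoparametric

variable {n : ℕ}

/-- The extension `x ↦ f (x / |x|)` of a function `f` on the unit sphere to `ℝ^(n+2)`, constant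
along rays (with value `0` at the origin). -/
def radialExtension (f : sphere (0 : EuclideanSpace ℝ (Fin (n + 2))) 1 → ℝ)
    (x : EuclideanSpace ℝ (Fin (n + 2))) : ℝ :=
  open Classical in
  if hx : x = 0 then 0
  else f ⟨‖x‖⁻¹ • x, by
    rw [mem_sphere_zero_iff_norm, norm_smul, norm_inv, norm_norm,
      inv_mul_cancel₀ (norm_ne_zero_iff.mpr hx)]⟩

/-- The gradient on the unit sphere: at points of the sphere, it is the Euclidean gradient of the
extension that is constant along rays. -/
def sphereGradient (f : sphere (0 : EuclideanSpace ℝ (Fin (n + 2))) 1 → ℝ)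
    (x : sphere (0 : EuclideanSpace ℝ (Fin (n + 2))) 1) : EuclideanSpace ℝ (Fin (n + 2)) :=
  gradient (radialExtension f) x

/-- The Laplace-Beltrami operator of the unit sphere: at points of the sphere, it is the Euclidean
Laplacian of the extension that is constant along rays. -/
def sphereLaplacian (f : sphere (0 : EuclideanSpace ℝ (Fin (n + 2))) 1 → ℝ)
    (x : sphere (0 : EuclideanSpace ℝ (Fin (n + 2))) 1) : ℝ :=
  Laplacian.laplacian (radialExtension f) (x : EuclideanSpace ℝ (Fin (n + 2)))

/-- Isoparametric functions on the unit sphere of dimension `n + 1`. -/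
structure IsIsoparametricFunction
    (f : sphere (0 : EuclideanSpace ℝ (Fin (n + 2))) 1 → ℝ) : Prop where
  smooth : ContMDiff (𝓡 (n + 1)) 𝓘(ℝ, ℝ) ∞ f
  nonconstant : ∃ p q, f p ≠ f q
  gradient_eq : ∃ b : ℝ → ℝ, ContDiff ℝ ∞ b ∧ ∀ x, ‖sphereGradient f x‖ ^ 2 = b (f x)
  laplacian_eq : ∃ a : ℝ → ℝ, ∀ x, sphereLaplacian f x = a (f x)

/-- Isoparametric hypersurfaces of the unit sphere of dimension `n + 1`: the (nonempty) regular
level sets of isoparametric functions. They are closed subsets of the sphere, hence compact. -/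
def IsIsoparametricHypersurface (M : Set (EuclideanSpace ℝ (Fin (n + 2)))) : Prop :=
  ∃ (f : sphere (0 : EuclideanSpace ℝ (Fin (n + 2))) 1 → ℝ) (c : ℝ),
    IsIsoparametricFunction f ∧ c ∈ range f ∧ (∀ x, f x = c → sphereGradient f x ≠ 0) ∧
    M = Subtype.val '' (f ⁻¹' {c})

/-- `ξ` is a smooth field of unit normals along `M`, tangent to the unit sphere. -/
structure IsUnitNormalField (M : Set (EuclideanSpace ℝ (Fin (n + 2))))
    (ξ : EuclideanSpace ℝ (Fin (n + 2)) → EuclideanSpace ℝ (Fin (n + 2))) : Prop where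
  smooth : ContDiffOn ℝ ∞ ξ M
  norm_eq_one : ∀ x ∈ M, ‖ξ x‖ = 1
  tangent_sphere : ∀ x ∈ M, ⟪ξ x, x⟫_ℝ = 0
  normal : ∀ x ∈ M, ∀ X ∈ tangentSubspace M x, ⟪ξ x, X⟫_ℝ = 0

/-- `κ` is a principal curvature at `x` of the hypersurface `M` of the unit sphere with respect to
the unit normal field `ξ`, i.e. an eigenvalue of the shape operator `X ↦ -D_X ξ` of the tangent
space of `M` at `x`. (As `D_X ξ` is orthogonal to `ξ x` and to `x`, it is tangent to `M`.) -/
def IsPrincipalCurvature (M : Set (EuclideanSpace ℝ (Fin (n + 2))))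
    (ξ : EuclideanSpace ℝ (Fin (n + 2)) → EuclideanSpace ℝ (Fin (n + 2)))
    (x : EuclideanSpace ℝ (Fin (n + 2))) (κ : ℝ) : Prop :=
  ∃ X ∈ tangentSubspace M x, X ≠ 0 ∧ -(fderivWithin ℝ ξ M x X) = κ • X

/-- `cot θ` is a principal curvature of `M` with respect to `ξ`. -/
def IsFocalAngle (M : Set (EuclideanSpace ℝ (Fin (n + 2))))
    (ξ : EuclideanSpace ℝ (Fin (n + 2)) → EuclideanSpace ℝ (Fin (n + 2))) (θ : ℝ) : Prop :=
  Real.sin θ ≠ 0 ∧ ∀ x ∈ M, IsPrincipalCurvature M ξ x (Real.cot θ)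

/-- The map `x ↦ cos θ x + sin θ ξ(x)`. -/
def focalMap (ξ : EuclideanSpace ℝ (Fin (n + 2)) → EuclideanSpace ℝ (Fin (n + 2))) (θ : ℝ)
    (x : EuclideanSpace ℝ (Fin (n + 2))) : EuclideanSpace ℝ (Fin (n + 2)) :=
  Real.cos θ • x + Real.sin θ • ξ x

/-- The focal submanifold of `M` at the angle `θ`, for a focal angle `θ`. -/
def focalSubmanifold (M : Set (EuclideanSpace ℝ (Fin (n + 2))))
    (ξ : EuclideanSpace ℝ (Fin (n + 2)) → EuclideanSpace ℝ (Fin (n + 2))) (θ : ℝ) :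
    Set (EuclideanSpace ℝ (Fin (n + 2))) :=
  focalMap ξ θ '' M

end Isoparametric

end

open Set MeasureTheory Metric Module
open scoped ContDiff Manifold InnerProductSpace Topology NNReal ENNReal

noncomputable section

/-! Extend the isoparametric function to `F`, constant along rays, so that all calculus takes place
in Euclidean space. By homogeneity the relation for the gradient becomes |∇F|²|x|² = b(F) away from
the origin. Differentiating it once shows that ∇F is, up to a radial term, an eigenvector of the
Hessian (`hess_gradient`); differentiating it twice gives H² = (b'/2)H at critical points
(`hess_hess_of_gradient_eq_zero`).

It follows that a great circle leaving in the gradient direction stays tangent to the gradient, even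
across critical points (`isGradientDirection_greatCircle`). The component of ∇F orthogonal to the
circle satisfies a linear differential inequality, regular at ordinary points and singular at
critical points, where `eq_zero_of_mul_deriv_le` applies. Along such a circle u = F solves u'' =
b'(u)/2, so u depends only on its initial data (`comp_greatCircle_unique`). Flowing back along these
circles gives a smooth retraction onto M. If a focal point were not critical, the focal map would
have a smooth local left inverse and could not kill a principal vector (`gradient_focal_eq_zero`).
Conversely, near a focal point every critical point on the sphere is focal (`eventually_mem_focal`),
and the critical set is a submanifold there because H is a nonzero multiple of a projection
(`isSubmanifoldNear_critical`).

For harmonicity, let φ be the focal map and V the variation field, so that the first variation of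
the energy is ∫⟨dφ, dV⟩ (`hasDerivAt_energy`). The vectors x and ξ(x) span the same plane as the
focal point and the velocity of the circle there, and V(x) is orthogonal to that plane; thus V is
also tangent to M (`variationField_mem_tangentSubspace`). Hence W = dφ(V) is a tangent field on M,
and its divergence is ⟨dφ, dV⟩ plus a multiple of the tangential trace of D_V Hess F. This trace
vanishes: the full trace is the derivative of the Laplacian, constant on M, and the two normal
entries vanish by the identities for the gradient (`trace_third_eq_zero`). The divergence theorem
finishes the proof. For it half of the area formula suffices: small displacements along W map M
injectively into M, so the integral of their Jacobian is maximal at time zero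
(`integral_trace_eq_zero`). -/

theorem eventually_ne_zero {E : Type*} [NormedAddCommGroup E] {x : E} (hx : x ≠ 0) :
    ∀ᶠ z in 𝓝 x, z ≠ 0 :=
  isOpen_ne.mem_nhds hx

/-! ### Differentiation along lines. -/

section Lines

variable {E : Type*} [NormedAddCommGroup E] [NormedSpace ℝ E]

theorem two_le_minSmoothness_infty : minSmoothness ℝ 2 ≤ (∞ : WithTop ℕ∞) := by
  rw [minSmoothness_of_isRCLikeNormedField]
  exact ENat.LEInfty.out

theorem hasDerivAt_line {G : Type*} [NormedAddCommGroup G] [NormedSpace ℝ G] {f : E → G}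
    {f' : E →L[ℝ] G} {x : E} (h : HasFDerivAt f f' x) (v : E) :
    HasDerivAt (fun t : ℝ => f (x + t • v)) (f' v) 0 := by
  have h1 : HasDerivAt (fun t : ℝ => x + t • v) v 0 := by
    simpa using ((hasDerivAt_id (0 : ℝ)).smul_const v).const_add x
  exact HasFDerivAt.comp_hasDerivAt (0 : ℝ) (by simpa using h) h1

theorem eventually_line {p : E → Prop} {x : E} (h : ∀ᶠ z in 𝓝 x, p z) (v : E) :
    ∀ᶠ t : ℝ in 𝓝 0, p (x + t • v) := by
  have : Filter.Tendsto (fun t : ℝ => x + t • v) (𝓝 0) (𝓝 x) := by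
    have : Continuous (fun t : ℝ => x + t • v) := by fun_prop
    simpa using this.tendsto 0
  exact this.eventually h

end Lines

/-! ### Hessian identities for transnormal functions extended constantly along rays. -/

section ConicalTransnormal

variable {E : Type*} [NormedAddCommGroup E] [InnerProductSpace ℝ E] [CompleteSpace E]

/-- A function on `E`, smooth away from the origin and constant along rays, whose restriction to
the unit sphere is transnormal: the squared norm of its gradient is a smooth function of it. -/
structure IsConicalTransnormal (F : E → ℝ) (b : ℝ → ℝ) : Prop where
  contDiffAt : ∀ x, x ≠ 0 → ContDiffAt ℝ ∞ F x
  map_smul : ∀ x, x ≠ 0 → ∀ r : ℝ, 0 < r → F (r • x) = F x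
  contDiff : ContDiff ℝ ∞ b
  norm_gradient : ∀ x, ‖x‖ = 1 → ‖gradient F x‖ ^ 2 = b (F x)

/-- The Hessian of a function, as a field of endomorphisms. -/
def hess (F : E → ℝ) (x : E) : E →L[ℝ] E := fderiv ℝ (gradient F) x

theorem ContDiffAt.gradient_infty {F : E → ℝ} {x : E} (h : ContDiffAt ℝ ∞ F x) :
    ContDiffAt ℝ ∞ (gradient F) x :=
  (InnerProductSpace.toDual ℝ E).symm.contDiff.contDiffAt.comp x
    (h.fderiv_right (m := ∞) (by simp))

theorem ContDiffAt.hess_infty {F : E → ℝ} {x : E} (h : ContDiffAt ℝ ∞ F x) :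
    ContDiffAt ℝ ∞ (hess F) x :=
  h.gradient_infty.fderiv_right (m := ∞) (by simp)

theorem ContDiffAt.hasFDerivAt_gradient {F : E → ℝ} {x : E} (h : ContDiffAt ℝ ∞ F x) :
    HasFDerivAt (gradient F) (hess F x) x :=
  (h.gradient_infty.differentiableAt (by simp)).hasFDerivAt

theorem inner_hess_eq {F : E → ℝ} {x : E} (h : ContDiffAt ℝ ∞ F x) (u v : E) :
    ⟪hess F x u, v⟫_ℝ = fderiv ℝ (fderiv ℝ F) x u v := by
  have h1 : HasFDerivAt (fderiv ℝ F) (fderiv ℝ (fderiv ℝ F) x) x :=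
    ((h.fderiv_right (m := ∞) (by simp)).differentiableAt (by simp)).hasFDerivAt
  have h2 : HasFDerivAt (gradient F)
      (((InnerProductSpace.toDual ℝ E).symm.toContinuousLinearEquiv.toContinuousLinearMap).comp
        (fderiv ℝ (fderiv ℝ F) x)) x :=
    (((InnerProductSpace.toDual ℝ E).symm.toContinuousLinearEquiv.toContinuousLinearMap).hasFDerivAt).comp
      x h1
  rw [hess, h2.fderiv]
  exact InnerProductSpace.toDual_symm_apply

theorem hess_symm {F : E → ℝ} {x : E} (h : ContDiffAt ℝ ∞ F x) (u v : E) :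
    ⟪hess F x u, v⟫_ℝ = ⟪u, hess F x v⟫_ℝ := by
  rw [inner_hess_eq h, real_inner_comm, inner_hess_eq h]
  exact (h.isSymmSndFDerivAt two_le_minSmoothness_infty).eq u v

/-- The Hessian is symmetric at all nearby points, and this relation may be differentiated in the
direction `u`. -/
theorem fderiv_hess_symm {F : E → ℝ} {x : E} (h : ∀ᶠ z in 𝓝 x, ContDiffAt ℝ ∞ F z) (u v w : E) :
    ⟪fderiv ℝ (hess F) x u v, w⟫_ℝ = ⟪v, fderiv ℝ (hess F) x u w⟫_ℝ := by
  have hH := (h.self_of_nhds.hess_infty.differentiableAt (by simp)).hasFDerivAt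
  have h1 := ((hasDerivAt_line hH u).clm_apply (hasDerivAt_const (0 : ℝ) v)).inner ℝ
    (hasDerivAt_const (0 : ℝ) w)
  have h2 := (hasDerivAt_const (0 : ℝ) v).inner ℝ
    ((hasDerivAt_line hH u).clm_apply (hasDerivAt_const (0 : ℝ) w))
  have := (h1.congr_of_eventuallyEq ((eventually_line h u).mono
    fun t ht => (hess_symm ht v w).symm)).unique h2
  simpa using this

theorem fderiv_hess_swap {F : E → ℝ} {x : E} (h : ContDiffAt ℝ ∞ F x) (u v : E) :
    fderiv ℝ (hess F) x u v = fderiv ℝ (hess F) x v u :=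
  (h.gradient_infty.isSymmSndFDerivAt two_le_minSmoothness_infty).eq u v

namespace IsConicalTransnormal

variable {F : E → ℝ} {b : ℝ → ℝ} (hF : IsConicalTransnormal F b)
include hF

theorem eventually_contDiffAt {x : E} (hx : x ≠ 0) : ∀ᶠ z in 𝓝 x, ContDiffAt ℝ ∞ F z :=
  (eventually_ne_zero hx).mono hF.contDiffAt

theorem inner_gradient_self {x : E} (hx : x ≠ 0) : ⟪gradient F x, x⟫_ℝ = 0 := by
  have h1 := hasDerivAt_line ((hF.contDiffAt x hx).differentiableAt (by simp)).hasFDerivAt x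
  have h2 : (fun t : ℝ => F (x + t • x)) =ᶠ[𝓝 0] fun _ => F x := by
    filter_upwards [Ioi_mem_nhds (show (-1 : ℝ) < 0 by norm_num)] with t ht
    have : x + t • x = (1 + t) • x := by module
    rw [this, hF.map_smul x hx _ (by simp at ht; linarith)]
  rw [inner_gradient_left]
  exact h1.unique ((hasDerivAt_const (0 : ℝ) (F x)).congr_of_eventuallyEq h2)

theorem inner_hess_add {x : E} (hx : x ≠ 0) (v : E) :
    ⟪hess F x v, x⟫_ℝ + ⟪gradient F x, v⟫_ℝ = 0 := by
  have hid : HasDerivAt (fun t : ℝ => x + t • v) v 0 := by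
    simpa using ((hasDerivAt_id (0 : ℝ)).smul_const v).const_add x
  have h1 := (hasDerivAt_line (hF.contDiffAt x hx).hasFDerivAt_gradient v).inner ℝ hid
  have h2 : (fun t : ℝ => ⟪gradient F (x + t • v), x + t • v⟫_ℝ) =ᶠ[𝓝 0] fun _ => 0 :=
    (eventually_line (eventually_ne_zero hx) v).mono fun t ht => hF.inner_gradient_self ht
  have := h1.unique ((hasDerivAt_const (0 : ℝ) (0 : ℝ)).congr_of_eventuallyEq h2)
  simp only [zero_smul, add_zero] at this
  linarith

theorem hess_self {x : E} (hx : x ≠ 0) : hess F x x = - gradient F x := by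
  refine ext_inner_right ℝ fun v => ?_
  rw [hess_symm (hF.contDiffAt x hx), real_inner_comm, inner_neg_left]
  linarith [hF.inner_hess_add hx v]

theorem gradient_smul {x : E} (hx : x ≠ 0) {r : ℝ} (hr : 0 < r) :
    r • gradient F (r • x) = gradient F x := by
  refine ext_inner_right ℝ fun v => ?_
  rw [inner_smul_left, inner_gradient_left, inner_gradient_left]
  have hrx : r • x ≠ 0 := smul_ne_zero hr.ne' hx
  have h1 := hasDerivAt_line ((hF.contDiffAt _ hrx).differentiableAt (by simp)).hasFDerivAt (r • v)
  have h2 := hasDerivAt_line ((hF.contDiffAt x hx).differentiableAt (by simp)).hasFDerivAt v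
  have h3 : (fun t : ℝ => F (r • x + t • r • v)) =ᶠ[𝓝 0] fun t => F (x + t • v) :=
    (eventually_line (eventually_ne_zero hx) v).mono fun t ht => by
      dsimp only
      rw [← hF.map_smul _ ht r hr]
      congr 1; module
  have := h1.unique (h2.congr_of_eventuallyEq h3)
  simpa using this

/-- The gradient is homogeneous of degree -1, so the factor |x|² restores degree 0. The relation on
the sphere thereby becomes one on an open set, which can be differentiated in every direction. -/
theorem inner_gradient_gradient {x : E} (hx : x ≠ 0) :
    ⟪gradient F x, gradient F x⟫_ℝ * ⟪x, x⟫_ℝ = b (F x) := by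
  have hn : 0 < ‖x‖ := norm_pos_iff.2 hx
  have h1 := hF.norm_gradient (‖x‖⁻¹ • x) (by
    rw [norm_smul, norm_inv, norm_norm, inv_mul_cancel₀ hn.ne'])
  rw [hF.map_smul x hx _ (inv_pos.2 hn)] at h1
  rw [← h1, ← hF.gradient_smul hx (inv_pos.2 hn), real_inner_self_eq_norm_sq,
    real_inner_self_eq_norm_sq, norm_smul, norm_inv, norm_norm]
  field_simp

theorem hasDerivAt_line_comp {g : ℝ → ℝ} (hg : ContDiff ℝ ∞ g) {x : E} (hx : x ≠ 0) (v : E) :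
    HasDerivAt (fun t : ℝ => g (F (x + t • v))) (deriv g (F x) * ⟪gradient F x, v⟫_ℝ) 0 := by
  have h1 := hasDerivAt_line ((hF.contDiffAt x hx).differentiableAt (by simp)).hasFDerivAt v
  have h2 : HasDerivAt g (deriv g (F x)) (F (x + (0 : ℝ) • v)) := by
    simpa using (hg.differentiable (by simp) (F x)).hasDerivAt
  rw [inner_gradient_left]
  exact h2.comp (0 : ℝ) h1

theorem inner_hess_gradient_eq {x : E} (hx : x ≠ 0) (v : E) :
    2 * ⟪hess F x v, gradient F x⟫_ℝ * ⟪x, x⟫_ℝ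
      + 2 * ⟪gradient F x, gradient F x⟫_ℝ * ⟪x, v⟫_ℝ = deriv b (F x) * ⟪gradient F x, v⟫_ℝ := by
  have hid : HasDerivAt (fun t : ℝ => x + t • v) v 0 := by
    simpa using ((hasDerivAt_id (0 : ℝ)).smul_const v).const_add x
  have hg := hasDerivAt_line (hF.contDiffAt x hx).hasFDerivAt_gradient v
  have h1 := (hg.inner ℝ hg).mul (hid.inner ℝ hid)
  have h2 : _ =ᶠ[𝓝 0] fun t : ℝ => b (F (x + t • v)) :=
    (eventually_line (eventually_ne_zero hx) v).mono fun t ht => hF.inner_gradient_gradient ht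
  have := (h1.congr_of_eventuallyEq h2.symm).unique (hF.hasDerivAt_line_comp hF.contDiff hx v)
  simp only [zero_smul, add_zero] at this
  rw [← this, real_inner_comm (gradient F x), real_inner_comm v x]
  ring

theorem hess_gradient {x : E} (hx : ‖x‖ = 1) :
    hess F x (gradient F x) = (deriv b (F x) / 2) • gradient F x - b (F x) • x := by
  have hx0 : x ≠ 0 := norm_ne_zero_iff.1 (by simp [hx])
  refine ext_inner_right ℝ fun v => ?_
  have h1 := hF.inner_hess_gradient_eq hx0 v
  rw [hess_symm (hF.contDiffAt x hx0), real_inner_comm, inner_sub_left, inner_smul_left,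
    inner_smul_left]
  rw [real_inner_self_eq_norm_sq, real_inner_self_eq_norm_sq, hF.norm_gradient x hx, hx] at h1
  simp only [conj_trivial]
  linarith

/-- The second derivative of |∇F|²|x|² = b(F), evaluated on the unit sphere; it is the only source
of information on third derivatives in the gradient direction. -/
theorem second_variation_eq {x : E} (hx : ‖x‖ = 1) (u v : E) :
    2 * (⟪fderiv ℝ (hess F) x u v, gradient F x⟫_ℝ + ⟪hess F x v, hess F x u⟫_ℝ)
      + 4 * ⟪hess F x v, gradient F x⟫_ℝ * ⟪x, u⟫_ℝ
      + 4 * ⟪hess F x u, gradient F x⟫_ℝ * ⟪x, v⟫_ℝ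
      + 2 * b (F x) * ⟪u, v⟫_ℝ = deriv (deriv b) (F x) * ⟪gradient F x, u⟫_ℝ * ⟪gradient F x, v⟫_ℝ
      + deriv b (F x) * ⟪hess F x u, v⟫_ℝ := by
  have hx0 : x ≠ 0 := norm_ne_zero_iff.1 (by simp [hx])
  have hid : HasDerivAt (fun t : ℝ => x + t • u) u 0 := by
    simpa using ((hasDerivAt_id (0 : ℝ)).smul_const u).const_add x
  have hg := hasDerivAt_line (hF.contDiffAt x hx0).hasFDerivAt_gradient u
  have hH := (hasDerivAt_line
    ((hF.contDiffAt x hx0).hess_infty.differentiableAt (by simp)).hasFDerivAt u).clm_apply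
    (hasDerivAt_const (0 : ℝ) v)
  have hv := hasDerivAt_const (0 : ℝ) v
  have hb : ContDiff ℝ ∞ (deriv b) := by
    have := hF.contDiff.iterate_deriv 1
    simpa using this
  have h1 := (((hH.inner ℝ hg).const_mul 2).mul (hid.inner ℝ hid)).add
    (((hg.inner ℝ hg).const_mul 2).mul (hid.inner ℝ hv))
  have h3 := (hF.hasDerivAt_line_comp hb hx0 u).mul (hg.inner ℝ hv)
  have h2 : _ =ᶠ[𝓝 0] fun t : ℝ => deriv b (F (x + t • u)) * ⟪gradient F (x + t • u), v⟫_ℝ :=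
    (eventually_line (eventually_ne_zero hx0) u).mono fun t ht => hF.inner_hess_gradient_eq ht v
  have := (h1.congr_of_eventuallyEq h2.symm).unique h3
  have hxx : ⟪x, x⟫_ℝ = 1 := by rw [real_inner_self_eq_norm_sq, hx]; norm_num
  have hgg : ⟪gradient F x, gradient F x⟫_ℝ = b (F x) := by
    rw [real_inner_self_eq_norm_sq, hF.norm_gradient x hx]
  simp only [zero_smul, add_zero, map_zero, inner_zero_right, zero_add, hxx, hgg] at this
  rw [real_inner_comm x u] at *
  rw [real_inner_comm (hess F x u) (gradient F x)] at this
  linarith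

/-- At a critical point both b and the third-derivative term drop out of `second_variation_eq`. When
b' ≠ 0, the Hessian is therefore b'/2 times an orthogonal projection. -/
theorem hess_hess_of_gradient_eq_zero {x : E} (hx : ‖x‖ = 1) (h0 : gradient F x = 0) (v : E) :
    hess F x (hess F x v) = (deriv b (F x) / 2) • hess F x v := by
  have hx0 : x ≠ 0 := norm_ne_zero_iff.1 (by simp [hx])
  refine ext_inner_right ℝ fun u => ?_
  have h1 := hF.second_variation_eq hx u v
  have hb : b (F x) = 0 := by rw [← hF.norm_gradient x hx, h0]; simp
  simp only [h0, hb, inner_zero_left, inner_zero_right] at h1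
  rw [hess_symm (hF.contDiffAt x hx0), inner_smul_left, hess_symm (hF.contDiffAt x hx0) v u]
  rw [hess_symm (hF.contDiffAt x hx0) u v, real_inner_comm, real_inner_comm (hess F x v) u,
    hess_symm (hF.contDiffAt x hx0) v u] at h1
  simp only [conj_trivial]
  linarith [real_inner_comm (hess F x u) (hess F x v)]

/-- In `second_variation_eq` with second vector ∇F, every other term vanishes: the Hessian preserves
the plane of x and ∇F, to which `v` is orthogonal. Together with `third_self_self` this removes the
normal part of the trace in `trace_third_eq_zero`. -/
theorem third_gradient_gradient {x : E} (hx : ‖x‖ = 1) {v : E} (hv : ⟪v, x⟫_ℝ = 0)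
    (hv' : ⟪v, gradient F x⟫_ℝ = 0) :
    ⟪fderiv ℝ (hess F) x v (gradient F x), gradient F x⟫_ℝ = 0 := by
  have hx0 : x ≠ 0 := norm_ne_zero_iff.1 (by simp [hx])
  have h1 := hF.second_variation_eq hx v (gradient F x)
  have h2 : ⟪hess F x v, gradient F x⟫_ℝ = 0 := by
    rw [hess_symm (hF.contDiffAt x hx0), hF.hess_gradient hx, inner_sub_right, inner_smul_right,
      inner_smul_right, hv, hv']; simp
  have h3 : ⟪hess F x v, x⟫_ℝ = 0 := by
    rw [hess_symm (hF.contDiffAt x hx0), hF.hess_self hx0, inner_neg_right, hv']; simp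
  have h4 : ⟪hess F x (gradient F x), hess F x v⟫_ℝ = 0 := by
    rw [hF.hess_gradient hx, inner_sub_left, inner_smul_left, inner_smul_left, real_inner_comm, h2,
      real_inner_comm, h3]; simp
  rw [h4, h2, hv', real_inner_comm v, real_inner_comm v, hv, hv'] at h1
  linarith

theorem third_self_self {x : E} (hx : x ≠ 0) {v : E} (hv' : ⟪v, gradient F x⟫_ℝ = 0) :
    ⟪fderiv ℝ (hess F) x v x, x⟫_ℝ = 0 := by
  have hid : HasDerivAt (fun t : ℝ => x + t • v) v 0 := by
    simpa using ((hasDerivAt_id (0 : ℝ)).smul_const v).const_add x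
  have hg := hasDerivAt_line (hF.contDiffAt x hx).hasFDerivAt_gradient v
  have hH := (hasDerivAt_line
    ((hF.contDiffAt x hx).hess_infty.differentiableAt (by simp)).hasFDerivAt v).clm_apply hid
  have h2 : _ =ᶠ[𝓝 0] fun t : ℝ => - gradient F (x + t • v) :=
    (eventually_line (eventually_ne_zero hx) v).mono fun t ht => hF.hess_self ht
  have := (hH.congr_of_eventuallyEq h2.symm).unique hg.neg
  simp only [zero_smul, add_zero] at this
  have h3 : ⟪hess F x v, x⟫_ℝ = 0 := by
    rw [hess_symm (hF.contDiffAt x hx), hF.hess_self hx, inner_neg_right, hv']; simp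
  have h4 := congrArg (fun z => ⟪z, x⟫_ℝ) this
  simp only [inner_add_left, inner_neg_left, h3] at h4
  linarith

end IsConicalTransnormal

end ConicalTransnormal

/-! ### Differential inequalities and uniqueness in one variable. -/

section Scalar

/-- A nonnegative function with `s h' ≤ 3 h` and `h = O(s⁴)` vanishes. -/
theorem eq_zero_of_mul_deriv_le {h h' : ℝ → ℝ} {ε C : ℝ}
    (hd : ∀ s ∈ Ioo 0 ε, HasDerivAt h (h' s) s) (h0 : ∀ s ∈ Ioo 0 ε, 0 ≤ h s)
    (hle : ∀ s ∈ Ioo 0 ε, s * h' s ≤ 3 * h s) (hC : ∀ s ∈ Ioo 0 ε, h s ≤ C * s ^ 4) :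
    ∀ s ∈ Ioo 0 ε, h s = 0 := by
  have hq : ∀ s ∈ Ioo 0 ε, HasDerivAt (fun s => h s / s ^ 3)
      ((h' s * s ^ 3 - h s * (3 * s ^ 2)) / (s ^ 3) ^ 2) s := fun s hs => by
    have := (hd s hs).div (hasDerivAt_pow 3 s) (pow_ne_zero 3 hs.1.ne')
    exact this.congr_deriv (by simp)
  -- The exponent 3 is the one in the differential inequality and is smaller than the order of
  -- vanishing 4. So the quotient decreases and yet tends to a limit at most 0 at the origin.
  have hanti : AntitoneOn (fun s => h s / s ^ 3) (Ioo 0 ε) := by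
    refine antitoneOn_of_deriv_nonpos (convex_Ioo 0 ε)
      (fun s hs => (hq s hs).continuousAt.continuousWithinAt)
      (fun s hs => ((hq s (interior_subset hs)).differentiableAt).differentiableWithinAt)
      fun s hs => ?_
    have hs := interior_subset hs
    rw [(hq s hs).deriv]
    refine div_nonpos_of_nonpos_of_nonneg ?_ (by positivity)
    have : h' s * s ^ 3 - h s * (3 * s ^ 2) = s ^ 2 * (s * h' s - 3 * h s) := by ring
    rw [this]
    exact mul_nonpos_of_nonneg_of_nonpos (by positivity) (by linarith [hle s hs])
  intro s hs
  refine le_antisymm ?_ (h0 s hs)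
  have hlim : Filter.Tendsto (fun r : ℝ => C * r) (𝓝[>] 0) (𝓝 0) := by
    have : Continuous fun r : ℝ => C * r := by fun_prop
    simpa using (this.tendsto 0).mono_left nhdsWithin_le_nhds
  have : h s / s ^ 3 ≤ 0 := by
    refine ge_of_tendsto hlim ?_
    filter_upwards [Ioo_mem_nhdsGT hs.1] with r hr
    have hr' : r ∈ Ioo 0 ε := ⟨hr.1, hr.2.trans hs.2⟩
    refine (hanti hr' hs hr.2.le).trans ?_
    have hr0 := hr.1
    rw [div_le_iff₀ (by positivity)]
    calc h r ≤ C * r ^ 4 := hC r hr'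
      _ = C * r * r ^ 3 := by ring
  have hs0 := hs.1
  rw [div_le_iff₀ (by positivity)] at this
  linarith

theorem exists_norm_le_mul_sq {G : Type*} [NormedAddCommGroup G] [NormedSpace ℝ G] {e : ℝ → G}
    (he : ContDiff ℝ ∞ e) (h0 : e 0 = 0) (h1 : deriv e 0 = 0) :
    ∃ C, ∀ᶠ s : ℝ in 𝓝[>] 0, ‖e s‖ ≤ C * s ^ 2 := by
  have hd : ContDiff ℝ ∞ (deriv e) := by simpa using he.iterate_deriv 1
  have h2 := (hd.differentiable (by simp) 0).isBigO_sub
  obtain ⟨C, hC⟩ := h2.bound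
  rw [Metric.eventually_nhds_iff] at hC
  obtain ⟨ε, hε, hC⟩ := hC
  refine ⟨C, ?_⟩
  filter_upwards [Ioo_mem_nhdsGT hε] with s hs
  have hb : ∀ x ∈ Icc 0 s, ‖deriv e x‖ ≤ C * s := fun x hx => by
    have h3 := hC (y := x) (by rw [Real.dist_eq, sub_zero, abs_of_nonneg hx.1]; exact hx.2.trans_lt hs.2)
    rw [h1, sub_zero, sub_zero, Real.norm_eq_abs, abs_of_nonneg hx.1] at h3
    refine h3.trans ?_
    rcases hx.1.eq_or_lt with h | h
    -- At the origin the estimate holds because C s ≥ 0, which is read off from the bound at the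
    -- other endpoint.
    · subst h
      have h4 := hC (y := s) (by rw [Real.dist_eq, sub_zero, abs_of_pos hs.1]; exact hs.2)
      rw [h1, sub_zero, sub_zero, Real.norm_eq_abs, abs_of_pos hs.1] at h4
      simpa using (norm_nonneg _).trans h4
    · have : 0 ≤ C := by
        by_contra hneg
        push Not at hneg
        have := mul_neg_of_neg_of_pos hneg h
        linarith [norm_nonneg (deriv e x)]
      exact mul_le_mul_of_nonneg_left hx.2 this
  have := (convex_Icc 0 s).norm_image_sub_le_of_norm_deriv_le
    (fun x _ => he.differentiable (by simp) x) hb (left_mem_Icc.2 hs.1.le) (right_mem_Icc.2 hs.1.le)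
  rw [h0, sub_zero, sub_zero, Real.norm_eq_abs, abs_of_pos hs.1] at this
  linarith [this]

/-- Uniqueness for the second order equation `u'' = g u`. -/
theorem newton_unique {g : ℝ → ℝ} (hg : ContDiff ℝ ∞ g) {u u₁ v v₁ : ℝ → ℝ} {T : ℝ}
    (hu : ∀ s ∈ Icc 0 T, HasDerivAt u (u₁ s) s) (hu₁ : ∀ s ∈ Icc 0 T, HasDerivAt u₁ (g (u s)) s)
    (hv : ∀ s ∈ Icc 0 T, HasDerivAt v (v₁ s) s) (hv₁ : ∀ s ∈ Icc 0 T, HasDerivAt v₁ (g (v s)) s)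
    (h0 : u 0 = v 0) (h1 : u₁ 0 = v₁ 0) : ∀ s ∈ Icc 0 T, u s = v s ∧ u₁ s = v₁ s := by
  have hcu : ContinuousOn u (Icc 0 T) := fun s hs => (hu s hs).continuousAt.continuousWithinAt
  have hcv : ContinuousOn v (Icc 0 T) := fun s hs => (hv s hs).continuousAt.continuousWithinAt
  obtain ⟨A, hA⟩ := (isCompact_Icc.image_of_continuousOn hcu).isBounded.subset_closedBall 0
  obtain ⟨B, hB⟩ := (isCompact_Icc.image_of_continuousOn hcv).isBounded.subset_closedBall 0
  obtain ⟨K, hK⟩ := (isCompact_closedBall (0 : ℝ) (max A B)).exists_bound_of_continuousOn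
    ((hg.continuous_deriv (by simp)).continuousOn)
  -- Both solutions stay in a fixed compact ball, on which g is Lipschitz; Gronwall is then applied
  -- to the pair of differences of values and velocities.
  have hlip : ∀ s ∈ Icc 0 T, ‖g (u s) - g (v s)‖ ≤ K * ‖u s - v s‖ := fun s hs =>
    (convex_closedBall (0 : ℝ) (max A B)).norm_image_sub_le_of_norm_deriv_le
      (fun x _ => hg.differentiable (by simp) x) hK
      (closedBall_subset_closedBall (le_max_right A B) (hB ⟨s, hs, rfl⟩))
      (closedBall_subset_closedBall (le_max_left A B) (hA ⟨s, hs, rfl⟩))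
  have hd : ∀ s ∈ Icc 0 T, HasDerivAt (fun s => (u s - v s, u₁ s - v₁ s))
      (u₁ s - v₁ s, g (u s) - g (v s)) s := fun s hs =>
    ((hu s hs).sub (hv s hs)).prodMk ((hu₁ s hs).sub (hv₁ s hs))
  have key := eq_zero_of_abs_deriv_le_mul_abs_self_of_eq_zero_right (K := max 1 K)
    (f := fun s => (u s - v s, u₁ s - v₁ s)) (f' := fun s => (u₁ s - v₁ s, g (u s) - g (v s)))
    (a := 0) (b := T)
    (fun s hs => (hd s hs).continuousAt.continuousWithinAt)
    (fun s hs => (hd s (Ico_subset_Icc_self hs)).hasDerivWithinAt)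
    (by simp [h0, h1]) (fun s hs => by
      have hs := Ico_subset_Icc_self hs
      rw [Prod.norm_def, Prod.norm_def]
      dsimp only
      refine max_le ?_ ?_
      · calc ‖u₁ s - v₁ s‖ = 1 * ‖u₁ s - v₁ s‖ := (one_mul _).symm
          _ ≤ _ := mul_le_mul (le_max_left _ _) (le_max_right _ _) (norm_nonneg _)
            (zero_le_one.trans (le_max_left _ _))
      · refine (hlip s hs).trans ?_
        exact mul_le_mul (le_max_right _ _) (le_max_left _ _) (norm_nonneg _)
          (zero_le_one.trans (le_max_left _ _)))
  intro s hs
  have := key s hs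
  simp only [Prod.mk_eq_zero, sub_eq_zero] at this
  exact this

end Scalar

/-! ### Great circles. -/

section Geodesics

variable {E : Type*} [NormedAddCommGroup E] [InnerProductSpace ℝ E]

/-- The great circle through `p` with initial velocity `w`. -/
def greatCircle (p w : E) (s : ℝ) : E := Real.cos s • p + Real.sin s • w

/-- The velocity of `greatCircle p w`. -/
def greatCircleVel (p w : E) (s : ℝ) : E := Real.cos s • w - Real.sin s • p

theorem hasDerivAt_greatCircle (p w : E) (s : ℝ) :
    HasDerivAt (greatCircle p w) (greatCircleVel p w s) s := by
  have := ((Real.hasDerivAt_cos s).smul_const p).add ((Real.hasDerivAt_sin s).smul_const w)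
  refine this.congr_deriv ?_
  simp only [greatCircleVel]; module

theorem hasDerivAt_greatCircleVel (p w : E) (s : ℝ) :
    HasDerivAt (greatCircleVel p w) (-greatCircle p w s) s := by
  have := ((Real.hasDerivAt_cos s).smul_const w).sub ((Real.hasDerivAt_sin s).smul_const p)
  refine this.congr_deriv ?_
  simp only [greatCircle]; module

theorem contDiff_greatCircle (p w : E) : ContDiff ℝ ∞ (greatCircle p w) := by
  unfold greatCircle; fun_prop

theorem contDiff_greatCircleVel (p w : E) : ContDiff ℝ ∞ (greatCircleVel p w) := by
  unfold greatCircleVel; fun_prop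

@[simp] theorem greatCircle_zero (p w : E) : greatCircle p w 0 = p := by simp [greatCircle]

@[simp] theorem greatCircleVel_zero (p w : E) : greatCircleVel p w 0 = w := by
  simp [greatCircleVel]

theorem greatCircle_add (p w : E) (s t : ℝ) :
    greatCircle (greatCircle p w s) (greatCircleVel p w s) t = greatCircle p w (s + t) := by
  simp only [greatCircle, greatCircleVel, Real.cos_add, Real.sin_add]; module

theorem greatCircleVel_add (p w : E) (s t : ℝ) :
    greatCircleVel (greatCircle p w s) (greatCircleVel p w s) t = greatCircleVel p w (s + t) := by
  simp only [greatCircle, greatCircleVel, Real.cos_add, Real.sin_add]; module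

theorem greatCircle_neg (p w : E) (s : ℝ) : greatCircle p (-w) s = greatCircle p w (-s) := by
  simp [greatCircle]

theorem greatCircleVel_neg (p w : E) (s : ℝ) :
    greatCircleVel p (-w) s = -greatCircleVel p w (-s) := by
  simp [greatCircleVel]; module

variable {p w : E}

theorem norm_greatCircle (hp : ‖p‖ = 1) (hw : ‖w‖ = 1) (hpw : ⟪w, p⟫_ℝ = 0) (s : ℝ) :
    ‖greatCircle p w s‖ = 1 := by
  have : ‖greatCircle p w s‖ ^ 2 = 1 := by
    rw [greatCircle, norm_add_sq_real, norm_smul, norm_smul, hp, hw, inner_smul_left,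
      inner_smul_right, real_inner_comm, hpw]
    simp
  rwa [pow_eq_one_iff_of_nonneg (norm_nonneg _) two_ne_zero] at this

theorem norm_greatCircleVel (hp : ‖p‖ = 1) (hw : ‖w‖ = 1) (hpw : ⟪w, p⟫_ℝ = 0) (s : ℝ) :
    ‖greatCircleVel p w s‖ = 1 := by
  have : greatCircleVel p w s = greatCircle w (-p) s := by
    simp [greatCircle, greatCircleVel, sub_eq_add_neg]
  rw [this]
  exact norm_greatCircle hw (by simpa) (by rw [inner_neg_left, real_inner_comm, hpw, neg_zero]) s

theorem inner_greatCircleVel (hp : ‖p‖ = 1) (hw : ‖w‖ = 1) (hpw : ⟪w, p⟫_ℝ = 0) (s : ℝ) :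
    ⟪greatCircleVel p w s, greatCircle p w s⟫_ℝ = 0 := by
  simp only [greatCircle, greatCircleVel, inner_sub_left, inner_add_right, inner_smul_left,
    inner_smul_right, hpw, real_inner_comm w p, real_inner_self_eq_norm_sq, hp, hw]
  simp; ring

end Geodesics

/-! ### Great circles as gradient curves through critical points. -/

section GradientDirections

variable {E : Type*} [NormedAddCommGroup E] [InnerProductSpace ℝ E] [CompleteSpace E]

/-- The unit vector `w`, tangent to the unit sphere at `p`, spans the direction of the gradient of
`F`, and it is an eigenvector of the Hessian along the sphere, as the gradient is. At critical
points only the second condition is significant. -/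
structure IsGradientDirection (F : E → ℝ) (b : ℝ → ℝ) (p w : E) : Prop where
  norm_base : ‖p‖ = 1
  norm_dir : ‖w‖ = 1
  inner_eq : ⟪w, p⟫_ℝ = 0
  gradient_eq : gradient F p = ⟪gradient F p, w⟫_ℝ • w
  hess_eq : hess F p w = (deriv b (F p) / 2) • w - ⟪gradient F p, w⟫_ℝ • p
  nondegenerate : ⟪gradient F p, w⟫_ℝ ≠ 0 ∨ deriv b (F p) ≠ 0

theorem IsGradientDirection.neg {F : E → ℝ} {b : ℝ → ℝ} {p w : E}
    (h : IsGradientDirection F b p w) : IsGradientDirection F b p (-w) where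
  norm_base := h.norm_base
  norm_dir := by rw [norm_neg, h.norm_dir]
  inner_eq := by rw [inner_neg_left, h.inner_eq, neg_zero]
  gradient_eq := by simpa using h.gradient_eq
  hess_eq := by
    rw [map_neg, h.hess_eq, inner_neg_right]; module
  nondegenerate := by simpa using h.nondegenerate

namespace IsConicalTransnormal

variable {F : E → ℝ} {b : ℝ → ℝ} (hF : IsConicalTransnormal F b)

theorem ne_zero_of_norm_eq_one {G : Type*} [NormedAddCommGroup G] {x : G} (hx : ‖x‖ = 1) :
    x ≠ 0 := norm_ne_zero_iff.1 (by simp [hx])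

include hF

theorem isGradientDirection_of_gradient_ne_zero {p w : E} (hp : ‖p‖ = 1) (hw : ‖w‖ = 1)
    {k : ℝ} (hk : k ≠ 0) (h : gradient F p = k • w) : IsGradientDirection F b p w := by
  have hkk : ⟪gradient F p, w⟫_ℝ = k := by
    rw [h, inner_smul_left, real_inner_self_eq_norm_sq, hw]; simp
  have hb : b (F p) = k ^ 2 := by
    rw [← hF.norm_gradient p hp, h, norm_smul, hw]; simp
  refine ⟨hp, hw, ?_, by rw [hkk, h], ?_, Or.inl (by rwa [hkk])⟩
  · have := hF.inner_gradient_self (ne_zero_of_norm_eq_one hp)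
    rw [h, inner_smul_left] at this
    simpa [hk] using this
  · have := hF.hess_gradient hp
    rw [h, _root_.map_smul, hb] at this
    have h2 : k • hess F p w = k • ((deriv b (F p) / 2) • w - k • p) := by
      rw [this]; module
    rw [hkk]
    exact smul_right_injective _ hk h2

/-- At a critical point `p` lies in the kernel of the Hessian, so an eigenvector with nonzero
eigenvalue is orthogonal to it. -/
theorem isGradientDirection_of_gradient_eq_zero {p w : E} (hp : ‖p‖ = 1) (hw : ‖w‖ = 1)
    (h0 : gradient F p = 0) (hb : deriv b (F p) ≠ 0)
    (h : hess F p w = (deriv b (F p) / 2) • w) : IsGradientDirection F b p w := by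
  refine ⟨hp, hw, ?_, by simp [h0], by rw [h, h0]; simp, Or.inr hb⟩
  have h1 := hess_symm (hF.contDiffAt p (ne_zero_of_norm_eq_one hp)) w p
  rw [hF.hess_self (ne_zero_of_norm_eq_one hp), h0, h, inner_smul_left] at h1
  simpa [hb] using h1

section AlongGreatCircle

variable {p w : E} (hp : ‖p‖ = 1) (hw : ‖w‖ = 1) (hpw : ⟪w, p⟫_ℝ = 0)

include hp hw hpw

theorem contDiff_gradient_greatCircle :
    ContDiff ℝ ∞ fun s => gradient F (greatCircle p w s) :=
  contDiff_iff_contDiffAt.2 fun s =>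
    (hF.contDiffAt _ (ne_zero_of_norm_eq_one (norm_greatCircle hp hw hpw s))).gradient_infty.comp s
      (contDiff_greatCircle p w).contDiffAt

theorem contDiff_hess_greatCircle :
    ContDiff ℝ ∞ fun s => hess F (greatCircle p w s) :=
  contDiff_iff_contDiffAt.2 fun s =>
    (hF.contDiffAt _ (ne_zero_of_norm_eq_one (norm_greatCircle hp hw hpw s))).hess_infty.comp s
      (contDiff_greatCircle p w).contDiffAt

theorem hasDerivAt_comp_greatCircle (s : ℝ) :
    HasDerivAt (fun s => F (greatCircle p w s))
      ⟪gradient F (greatCircle p w s), greatCircleVel p w s⟫_ℝ s := by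
  rw [inner_gradient_left]
  have h1 := ((hF.contDiffAt _ (ne_zero_of_norm_eq_one (norm_greatCircle hp hw hpw s))).differentiableAt
    (by simp)).hasFDerivAt
  exact h1.comp_hasDerivAt s (hasDerivAt_greatCircle p w s)

theorem hasDerivAt_gradient_greatCircle (s : ℝ) :
    HasDerivAt (fun s => gradient F (greatCircle p w s))
      (hess F (greatCircle p w s) (greatCircleVel p w s)) s :=
  (hF.contDiffAt _ (ne_zero_of_norm_eq_one
    (norm_greatCircle hp hw hpw s))).hasFDerivAt_gradient.comp_hasDerivAt s
    (hasDerivAt_greatCircle p w s)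

theorem hasDerivAt_inner_gradient_greatCircle (s : ℝ) :
    HasDerivAt (fun s => ⟪gradient F (greatCircle p w s), greatCircleVel p w s⟫_ℝ)
      ⟪hess F (greatCircle p w s) (greatCircleVel p w s), greatCircleVel p w s⟫_ℝ s := by
  have := (hF.hasDerivAt_gradient_greatCircle hp hw hpw s).inner ℝ (hasDerivAt_greatCircleVel p w s)
  refine this.congr_deriv ?_
  rw [inner_neg_right, hF.inner_gradient_self
    (ne_zero_of_norm_eq_one (norm_greatCircle hp hw hpw s))]
  simp

/-- This expression, called the defect below, is the part of the gradient orthogonal to the velocity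
of the great circle. The circle runs along the gradient exactly where it vanishes. -/
theorem contDiff_gradient_defect :
    ContDiff ℝ ∞ fun s => gradient F (greatCircle p w s) -
      ⟪gradient F (greatCircle p w s), greatCircleVel p w s⟫_ℝ • greatCircleVel p w s := by
  have h1 := hF.contDiff_gradient_greatCircle hp hw hpw
  have h2 := contDiff_greatCircleVel p w
  exact h1.sub ((h1.inner ℝ h2).smul h2)

theorem hasDerivAt_gradient_defect (s : ℝ) :
    HasDerivAt (fun s => gradient F (greatCircle p w s) -
      ⟪gradient F (greatCircle p w s), greatCircleVel p w s⟫_ℝ • greatCircleVel p w s)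
      (hess F (greatCircle p w s) (greatCircleVel p w s) -
        (⟪hess F (greatCircle p w s) (greatCircleVel p w s), greatCircleVel p w s⟫_ℝ •
          greatCircleVel p w s -
        ⟪gradient F (greatCircle p w s), greatCircleVel p w s⟫_ℝ • greatCircle p w s)) s := by
  have h1 := hF.hasDerivAt_gradient_greatCircle hp hw hpw s
  have h2 := hF.hasDerivAt_inner_gradient_greatCircle hp hw hpw s
  have := h1.sub (h2.smul (hasDerivAt_greatCircleVel p w s))
  refine this.congr_deriv ?_
  module

/-- With k = ⟨∇F, v⟩, the relation k v = ∇F - e expresses k H v through the known H ∇F and through H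
e. The factor k is kept on the left because it may vanish. -/
theorem mul_inner_gradient_defect (s : ℝ) {e : E}
    (he : e = gradient F (greatCircle p w s) -
      ⟪gradient F (greatCircle p w s), greatCircleVel p w s⟫_ℝ • greatCircleVel p w s) :
    ⟪gradient F (greatCircle p w s), greatCircleVel p w s⟫_ℝ *
      ⟪hess F (greatCircle p w s) (greatCircleVel p w s) -
        (⟪hess F (greatCircle p w s) (greatCircleVel p w s), greatCircleVel p w s⟫_ℝ •
          greatCircleVel p w s -
        ⟪gradient F (greatCircle p w s), greatCircleVel p w s⟫_ℝ • greatCircle p w s), e⟫_ℝ =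
      deriv b (F (greatCircle p w s)) / 2 * ‖e‖ ^ 2 - ⟪hess F (greatCircle p w s) e, e⟫_ℝ := by
  have hg1 := norm_greatCircle hp hw hpw s
  have hv1 := norm_greatCircleVel hp hw hpw s
  have hgv := inner_greatCircleVel hp hw hpw s
  have hgrad := hF.inner_gradient_self (ne_zero_of_norm_eq_one hg1)
  have hH := hF.hess_gradient hg1
  set γ := greatCircle p w s
  set v := greatCircleVel p w s
  set X := gradient F γ
  set k := ⟪X, v⟫_ℝ
  have hev : ⟪v, e⟫_ℝ = 0 := by
    rw [he, inner_sub_right, inner_smul_right, real_inner_self_eq_norm_sq, hv1, real_inner_comm]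
    ring
  have heγ : ⟪γ, e⟫_ℝ = 0 := by
    rw [he, inner_sub_right, inner_smul_right, real_inner_comm, hgrad, real_inner_comm, hgv]
    ring
  have hXe : ⟪X, e⟫_ℝ = ‖e‖ ^ 2 := by
    have : X = e + k • v := by rw [he]; abel
    rw [this, inner_add_left, inner_smul_left, hev, real_inner_self_eq_norm_sq]; simp
  have hkv : k • hess F γ v = (deriv b (F γ) / 2) • X - b (F γ) • γ - hess F γ e := by
    rw [← hH, ← _root_.map_smul, ← map_sub]; congr 1; rw [he]; abel
  have hk2 : k * ⟪hess F γ v, e⟫_ℝ = deriv b (F γ) / 2 * ‖e‖ ^ 2 - ⟪hess F γ e, e⟫_ℝ := by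
    have := congrArg (fun z => ⟪z, e⟫_ℝ) hkv
    simp only [inner_sub_left, inner_smul_left, heγ, hXe] at this
    simpa using this
  rw [inner_sub_left, inner_sub_left, inner_smul_left, inner_smul_left, hev, heγ]
  simpa using hk2

theorem norm_sq_gradient_defect_hasDerivAt (s : ℝ) :
    HasDerivAt (fun s => ‖gradient F (greatCircle p w s) -
      ⟪gradient F (greatCircle p w s), greatCircleVel p w s⟫_ℝ • greatCircleVel p w s‖ ^ 2)
      (2 * ⟪hess F (greatCircle p w s) (greatCircleVel p w s) -
        (⟪hess F (greatCircle p w s) (greatCircleVel p w s), greatCircleVel p w s⟫_ℝ •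
          greatCircleVel p w s -
        ⟪gradient F (greatCircle p w s), greatCircleVel p w s⟫_ℝ • greatCircle p w s),
        gradient F (greatCircle p w s) -
      ⟪gradient F (greatCircle p w s), greatCircleVel p w s⟫_ℝ • greatCircleVel p w s⟫_ℝ) s := by
  have := (hF.hasDerivAt_gradient_defect hp hw hpw s).norm_sq
  refine this.congr_deriv ?_
  rw [real_inner_comm]

end AlongGreatCircle

/-- The defect vanishes to the right when the gradient does not vanish at the base point. -/
theorem eventually_defect_eq_zero_of_ne {p w : E} (h : IsGradientDirection F b p w)
    (hk : ⟪gradient F p, w⟫_ℝ ≠ 0) :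
    ∀ᶠ s in 𝓝[>] (0 : ℝ), gradient F (greatCircle p w s) -
      ⟪gradient F (greatCircle p w s), greatCircleVel p w s⟫_ℝ • greatCircleVel p w s = 0 ∧
      ⟪gradient F (greatCircle p w s), greatCircleVel p w s⟫_ℝ ≠ 0 := by
  have hp := h.norm_base
  have hw := h.norm_dir
  have hpw := h.inner_eq
  set e : ℝ → E := fun s => gradient F (greatCircle p w s) -
      ⟪gradient F (greatCircle p w s), greatCircleVel p w s⟫_ℝ • greatCircleVel p w s with he
  set k : ℝ → ℝ := fun s => ⟪gradient F (greatCircle p w s), greatCircleVel p w s⟫_ℝ with hkdef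
  have hkc : Continuous k :=
    (hF.contDiff_gradient_greatCircle hp hw hpw).continuous.inner
      (contDiff_greatCircleVel p w).continuous
  have hk0 : k 0 ≠ 0 := by simpa [hkdef] using hk
  have hbc : Continuous fun s => deriv b (F (greatCircle p w s)) :=
    (hF.contDiff.continuous_deriv (by simp)).comp
      (continuous_iff_continuousAt.2 fun s =>
        (hF.hasDerivAt_comp_greatCircle hp hw hpw s).continuousAt)
  have hHc : Continuous fun s => hess F (greatCircle p w s) :=
    (hF.contDiff_hess_greatCircle hp hw hpw).continuous
  -- The Gronwall rate for the squared defect: it is finite because k does not vanish near 0, and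
  -- bounded by its value at 0 plus one.
  set c : ℝ → ℝ := fun s => 2 * (|deriv b (F (greatCircle p w s)) / 2| +
    ‖hess F (greatCircle p w s)‖) / |k s| with hc
  have hcc : ContinuousAt c 0 := by
    refine ContinuousAt.div ?_ hkc.abs.continuousAt (abs_ne_zero.2 hk0)
    exact (continuous_const.mul ((hbc.div_const 2).abs.add hHc.norm)).continuousAt
  have hev : ∀ᶠ s in 𝓝 (0 : ℝ), k s ≠ 0 ∧ c s < c 0 + 1 :=
    (hkc.continuousAt.eventually_ne hk0).and (hcc.eventually_lt continuousAt_const (by simp))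
  obtain ⟨ε, hε, hball⟩ := Metric.eventually_nhds_iff.1 hev
  filter_upwards [Ioo_mem_nhdsGT hε] with T hT
  have hin : ∀ s ∈ Icc 0 T, k s ≠ 0 ∧ c s < c 0 + 1 := fun s hs => hball (by
    rw [Real.dist_eq, sub_zero, abs_of_nonneg hs.1]; exact hs.2.trans_lt hT.2)
  have hd := hF.norm_sq_gradient_defect_hasDerivAt hp hw hpw
  have key := eq_zero_of_abs_deriv_le_mul_abs_self_of_eq_zero_right (K := c 0 + 1)
    (f := fun s => ‖e s‖ ^ 2) (a := 0) (b := T)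
    (fun s _ => (hd s).continuousAt.continuousWithinAt) (fun s _ => (hd s).hasDerivWithinAt)
    (by
      have := h.gradient_eq
      simp only [he, greatCircle_zero, greatCircleVel_zero]
      rw [← this]; simp)
    (fun s hs => by
      have hs := Ico_subset_Icc_self hs
      have h1 := hF.mul_inner_gradient_defect hp hw hpw s (e := e s) rfl
      have hks := (hin s hs).1
      rw [norm_mul, Real.norm_two]
      have h2 : |k s| * (2 * ‖⟪hess F (greatCircle p w s) (greatCircleVel p w s) -
        (⟪hess F (greatCircle p w s) (greatCircleVel p w s), greatCircleVel p w s⟫_ℝ •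
          greatCircleVel p w s - k s • greatCircle p w s), e s⟫_ℝ‖) ≤
          |k s| * (c s * ‖e s‖ ^ 2) := by
        calc _ = 2 * |deriv b (F (greatCircle p w s)) / 2 * ‖e s‖ ^ 2 -
              ⟪hess F (greatCircle p w s) (e s), e s⟫_ℝ| := by
              rw [← h1, Real.norm_eq_abs, abs_mul]; ring
          _ ≤ 2 * (|deriv b (F (greatCircle p w s)) / 2| * ‖e s‖ ^ 2 +
              ‖hess F (greatCircle p w s)‖ * ‖e s‖ ^ 2) := by
              refine mul_le_mul_of_nonneg_left ((abs_sub _ _).trans (add_le_add ?_ ?_)) zero_le_two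
              · rw [abs_mul, abs_of_nonneg (sq_nonneg ‖e s‖)]
              · refine (abs_real_inner_le_norm _ _).trans ?_
                rw [sq, ← mul_assoc]
                exact mul_le_mul_of_nonneg_right (ContinuousLinearMap.le_opNorm _ _) (norm_nonneg _)
          _ = _ := by
              have : |k s| ≠ 0 := abs_ne_zero.2 hks
              simp only [hc]; field_simp
      have h3 := le_of_mul_le_mul_left h2 (abs_pos.2 hks)
      refine h3.trans ?_
      rw [Real.norm_eq_abs, abs_of_nonneg (sq_nonneg ‖e s‖)]
      exact mul_le_mul_of_nonneg_right (hin s hs).2.le (sq_nonneg _))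
  have hT' : T ∈ Icc 0 T := right_mem_Icc.2 hT.1.le
  refine ⟨?_, (hin T hT').1⟩
  exact norm_eq_zero.1 ((pow_eq_zero_iff two_ne_zero).1 (key T hT'))

/-- The defect vanishes to the right when the base point is a critical point. -/
theorem eventually_defect_eq_zero_of_eq {p w : E} (h : IsGradientDirection F b p w)
    (hk : ⟪gradient F p, w⟫_ℝ = 0) :
    ∀ᶠ s in 𝓝[>] (0 : ℝ), gradient F (greatCircle p w s) -
      ⟪gradient F (greatCircle p w s), greatCircleVel p w s⟫_ℝ • greatCircleVel p w s = 0 ∧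
      ⟪gradient F (greatCircle p w s), greatCircleVel p w s⟫_ℝ ≠ 0 := by
  have hp := h.norm_base
  have hw := h.norm_dir
  have hpw := h.inner_eq
  have hX : gradient F p = 0 := by rw [h.gradient_eq, hk, zero_smul]
  have hHw : hess F p w = (deriv b (F p) / 2) • w := by rw [h.hess_eq, hk]; simp
  set l : ℝ := deriv b (F p) / 2 with hl
  have hl0 : l ≠ 0 := div_ne_zero (h.nondegenerate.resolve_left (by simp [hk])) two_ne_zero
  set e : ℝ → E := fun s => gradient F (greatCircle p w s) -
      ⟪gradient F (greatCircle p w s), greatCircleVel p w s⟫_ℝ • greatCircleVel p w s with he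
  set k : ℝ → ℝ := fun s => ⟪gradient F (greatCircle p w s), greatCircleVel p w s⟫_ℝ with hkdef
  have hbc : Continuous fun s => deriv b (F (greatCircle p w s)) :=
    (hF.contDiff.continuous_deriv (by simp)).comp
      (continuous_iff_continuousAt.2 fun s =>
        (hF.hasDerivAt_comp_greatCircle hp hw hpw s).continuousAt)
  have hHc : Continuous fun s => hess F (greatCircle p w s) :=
    (hF.contDiff_hess_greatCircle hp hw hpw).continuous
  have hec : ContDiff ℝ ∞ e := hF.contDiff_gradient_defect hp hw hpw
  -- The defect vanishes to second order: its value is zero as ∇F(p) = 0, and its derivative is zero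
  -- as `w` is an eigenvector of the Hessian. Its square is thus of order s⁴.
  obtain ⟨C, hC⟩ := exists_norm_le_mul_sq hec (by simp [he, hX, -inner_gradient_left]) (by
    rw [(hF.hasDerivAt_gradient_defect hp hw hpw 0).deriv]
    simp [hX, hHw, inner_smul_left, hw])
  have hkd : HasDerivAt k l 0 := by
    refine (hF.hasDerivAt_inner_gradient_greatCircle hp hw hpw 0).congr_deriv ?_
    simp [hHw, inner_smul_left, hw]
  have hk1 : ∀ᶠ s in 𝓝[>] (0 : ℝ), |k s - l * s| ≤ |l| / 8 * s := by
    have := (hkd.isLittleO).def (show 0 < |l| / 8 by positivity)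
    filter_upwards [nhdsWithin_le_nhds this, self_mem_nhdsWithin] with s hs hs0
    have hk0 : k 0 = 0 := by simp [hkdef, hk, -inner_gradient_left]
    rw [hk0] at hs
    simp only [sub_zero, smul_eq_mul, Real.norm_eq_abs, abs_of_pos (show (0 : ℝ) < s from hs0)] at hs
    rwa [mul_comm l]
  have hb1 : ∀ᶠ s in 𝓝[>] (0 : ℝ), |deriv b (F (greatCircle p w s)) / 2 - l| < |l| / 16 := by
    have : ContinuousAt (fun s => |deriv b (F (greatCircle p w s)) / 2 - l|) 0 :=
      ((hbc.div_const 2).sub continuous_const).abs.continuousAt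
    exact nhdsWithin_le_nhds (this.eventually_lt continuousAt_const (by
      have : 0 < |l| / 16 := by positivity
      simpa [hl] using this))
  have hH1 : ∀ᶠ s in 𝓝[>] (0 : ℝ), ‖hess F (greatCircle p w s) - hess F p‖ < |l| / 16 := by
    have : ContinuousAt (fun s => ‖hess F (greatCircle p w s) - hess F p‖) 0 :=
      (hHc.sub continuous_const).norm.continuousAt
    exact nhdsWithin_le_nhds (this.eventually_lt continuousAt_const (by simp; positivity))
  have hall := hC.and (hk1.and (hb1.and (hH1.and self_mem_nhdsWithin)))
  obtain ⟨ε, hε, hball⟩ := mem_nhdsGT_iff_exists_Ioo_subset.1 hall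
  have hkne : ∀ s ∈ Ioo 0 ε, k s ≠ 0 := fun s hs h0 => by
    have := (hball hs).2.1
    rw [h0, zero_sub, abs_neg, abs_mul, abs_of_pos hs.1] at this
    nlinarith [mul_pos (abs_pos.2 hl0) hs.1]
  have hfin := eq_zero_of_mul_deriv_le (h := fun s => ‖e s‖ ^ 2) (C := C ^ 2) (ε := ε)
    (fun s _ => hF.norm_sq_gradient_defect_hasDerivAt hp hw hpw s) (fun s _ => sq_nonneg _)
    (fun s hs => by
      obtain ⟨-, h1, h2, h3, -⟩ := hball hs
      have h4 := hF.mul_inner_gradient_defect hp hw hpw s (e := e s) rfl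
      set D := ⟪hess F (greatCircle p w s) (greatCircleVel p w s) -
        (⟪hess F (greatCircle p w s) (greatCircleVel p w s), greatCircleVel p w s⟫_ℝ •
          greatCircleVel p w s - k s • greatCircle p w s), e s⟫_ℝ with hD
      set β := deriv b (F (greatCircle p w s)) / 2 with hβ
      have h4 : k s * D = β * ‖e s‖ ^ 2 - ⟪hess F (greatCircle p w s) (e s), e s⟫_ℝ := h4
      change s * (2 * D) ≤ 3 * ‖e s‖ ^ 2
      -- The Hessian at `p` is l times a projection, so this term has a sign and can be dropped; no
      -- spectral information on the direction of the defect is required.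
      have h5 : l * ⟪hess F p (e s), e s⟫_ℝ = ‖hess F p (e s)‖ ^ 2 := by
        have h6 := hF.hess_hess_of_gradient_eq_zero hp hX (e s)
        rw [← real_inner_self_eq_norm_sq,
          ← hess_symm (hF.contDiffAt p (ne_zero_of_norm_eq_one hp)), h6, inner_smul_left]
        simp [hl]
      have h7 : |⟪(hess F (greatCircle p w s) - hess F p) (e s), e s⟫_ℝ| ≤ |l| / 16 * ‖e s‖ ^ 2 := by
        refine (abs_real_inner_le_norm _ _).trans ?_
        rw [sq, ← mul_assoc]
        exact mul_le_mul_of_nonneg_right ((ContinuousLinearMap.le_opNorm _ _).trans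
          (mul_le_mul_of_nonneg_right h3.le (norm_nonneg _))) (norm_nonneg _)
      have h8 : ⟪hess F (greatCircle p w s) (e s), e s⟫_ℝ =
          ⟪hess F p (e s), e s⟫_ℝ + ⟪(hess F (greatCircle p w s) - hess F p) (e s), e s⟫_ℝ := by
        rw [sub_apply, inner_sub_left]; ring
      -- The constant is 9/8 = 1 + 1/16 + 1/16, the two small terms being the errors in b'/2 and in
      -- the Hessian. With l k ≥ (7/8) l² s this gives 2 s D ≤ (18/7)|e|², which is below 3|e|².
      have hN : l * (k s * D) ≤ l ^ 2 * (9 / 8) * ‖e s‖ ^ 2 := by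
        rw [h4, h8]
        have a1 : l * ((β - l) * ‖e s‖ ^ 2) ≤ |l| * (|l| / 16 * ‖e s‖ ^ 2) := by
          refine (le_abs_self _).trans ?_
          rw [abs_mul, abs_mul, abs_of_nonneg (sq_nonneg ‖e s‖)]
          gcongr
        have a2 : -(l * ⟪(hess F (greatCircle p w s) - hess F p) (e s), e s⟫_ℝ) ≤
            |l| * (|l| / 16 * ‖e s‖ ^ 2) := by
          refine (neg_le_abs _).trans ?_
          rw [abs_mul]
          gcongr
        have a3 : |l| * (|l| / 16 * ‖e s‖ ^ 2) = l ^ 2 / 16 * ‖e s‖ ^ 2 := by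
          rw [← sq_abs l]; ring
        nlinarith [sq_nonneg ‖hess F p (e s)‖]
      have hs0 := hs.1
      have hlk : l ^ 2 * (7 / 8) * s ≤ l * k s := by
        have : |l * (k s - l * s)| ≤ |l| * (|l| / 8 * s) := by rw [abs_mul]; gcongr
        have a3 : |l| * (|l| / 8 * s) = l ^ 2 / 8 * s := by rw [← sq_abs l]; ring
        rw [a3] at this
        nlinarith [neg_abs_le (l * (k s - l * s))]
      have hl2 : 0 < l ^ 2 := by positivity
      rcases le_or_gt D 0 with hDle | hDpos
      · nlinarith [sq_nonneg ‖e s‖]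
      · have a1 : l ^ 2 * (7 / 8 * s * D) ≤ l ^ 2 * (9 / 8 * ‖e s‖ ^ 2) := by
          nlinarith [mul_le_mul_of_nonneg_right hlk hDpos.le]
        have := le_of_mul_le_mul_left a1 hl2
        nlinarith [sq_nonneg ‖e s‖])
    (fun s hs => by
      have := (hball hs).1
      calc ‖e s‖ ^ 2 ≤ (C * s ^ 2) ^ 2 := by gcongr
        _ = C ^ 2 * s ^ 4 := by ring)
  filter_upwards [Ioo_mem_nhdsGT (show (0 : ℝ) < ε from hε)] with s hs
  exact ⟨norm_eq_zero.1 ((pow_eq_zero_iff two_ne_zero).1 (hfin s hs)), hkne s hs⟩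

theorem eventually_isGradientDirection {p w : E} (h : IsGradientDirection F b p w) :
    ∀ᶠ s in 𝓝[>] (0 : ℝ),
      IsGradientDirection F b (greatCircle p w s) (greatCircleVel p w s) := by
  have : ∀ᶠ s in 𝓝[>] (0 : ℝ), gradient F (greatCircle p w s) -
      ⟪gradient F (greatCircle p w s), greatCircleVel p w s⟫_ℝ • greatCircleVel p w s = 0 ∧
      ⟪gradient F (greatCircle p w s), greatCircleVel p w s⟫_ℝ ≠ 0 := by
    by_cases hk : ⟪gradient F p, w⟫_ℝ = 0
    · exact hF.eventually_defect_eq_zero_of_eq h hk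
    · exact hF.eventually_defect_eq_zero_of_ne h hk
  filter_upwards [this] with s hs
  exact hF.isGradientDirection_of_gradient_ne_zero
    (norm_greatCircle h.norm_base h.norm_dir h.inner_eq s)
    (norm_greatCircleVel h.norm_base h.norm_dir h.inner_eq s) hs.2 (sub_eq_zero.1 hs.1)

omit hF in
theorem IsGradientDirection.inner_hess_eq {p w : E} (h : IsGradientDirection F b p w) :
    ⟪hess F p w, w⟫_ℝ = deriv b (F p) / 2 := by
  rw [h.hess_eq, inner_sub_left, inner_smul_left, inner_smul_left, real_inner_self_eq_norm_sq,
    h.norm_dir, real_inner_comm w p, h.inner_eq]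
  simp

theorem contDiff_half_deriv : ContDiff ℝ ∞ fun t => deriv b t / 2 := by
  have : ContDiff ℝ ∞ (deriv b) := by simpa using hF.contDiff.iterate_deriv 1
  exact this.div_const 2

/-- The property `IsGradientDirection` is closed along great circles. -/
theorem isGradientDirection_of_forall_Ico {p w : E} (h : IsGradientDirection F b p w) {T : ℝ}
    (hT : 0 < T) (hall : ∀ s ∈ Ico 0 T,
      IsGradientDirection F b (greatCircle p w s) (greatCircleVel p w s)) :
    IsGradientDirection F b (greatCircle p w T) (greatCircleVel p w T) := by
  have hp := h.norm_base
  have hw := h.norm_dir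
  have hpw := h.inner_eq
  have hgc := (hF.contDiff_gradient_greatCircle hp hw hpw).continuous
  have hHc := (hF.contDiff_hess_greatCircle hp hw hpw).continuous
  have hvc := (contDiff_greatCircleVel p w).continuous
  have hcc := (contDiff_greatCircle p w).continuous
  have hkc := hgc.inner (𝕜 := ℝ) hvc
  have hbc : Continuous fun s => deriv b (F (greatCircle p w s)) :=
    (hF.contDiff.continuous_deriv (by simp)).comp
      (continuous_iff_continuousAt.2 fun s =>
        (hF.hasDerivAt_comp_greatCircle hp hw hpw s).continuousAt)
  have hcl : IsClosed {s | gradient F (greatCircle p w s) =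
      ⟪gradient F (greatCircle p w s), greatCircleVel p w s⟫_ℝ • greatCircleVel p w s ∧
      hess F (greatCircle p w s) (greatCircleVel p w s) =
        (deriv b (F (greatCircle p w s)) / 2) • greatCircleVel p w s -
          ⟪gradient F (greatCircle p w s), greatCircleVel p w s⟫_ℝ • greatCircle p w s} :=
    (isClosed_eq hgc (hkc.smul hvc)).inter (isClosed_eq (hHc.clm_apply hvc)
      (((hbc.div_const 2).smul hvc).sub (hkc.smul hcc)))
  have hTcl : T ∈ closure (Ico 0 T) := by
    rw [closure_Ico hT.ne]; exact right_mem_Icc.2 hT.le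
  have hmem := hcl.closure_subset_iff.2
    (fun s hs => And.intro (hall s hs).gradient_eq (hall s hs).hess_eq) hTcl
  have hpT := norm_greatCircle hp hw hpw T
  have hwT := norm_greatCircleVel hp hw hpw T
  have hHI : ∀ s ∈ Icc 0 T, ⟪hess F (greatCircle p w s) (greatCircleVel p w s),
      greatCircleVel p w s⟫_ℝ = deriv b (F (greatCircle p w s)) / 2 := fun s hs => by
    rcases hs.2.eq_or_lt with rfl | hlt
    · rw [hmem.2, inner_sub_left, inner_smul_left, inner_smul_left, real_inner_self_eq_norm_sq,
        hwT, real_inner_comm (greatCircleVel p w s) (greatCircle p w s),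
        inner_greatCircleVel hp hw hpw]
      simp
    · exact IsGradientDirection.inner_hess_eq (hall s ⟨hs.1, hlt⟩)
  refine ⟨hpT, hwT, inner_greatCircleVel hp hw hpw T, hmem.1, hmem.2, ?_⟩
  -- Nondegeneracy cannot be lost: otherwise F along the reversed circle and a constant function
  -- solve u'' = b'(u)/2 with the same data, and the degeneracy spreads back to the starting point.
  by_contra hneg
  push Not at hneg
  obtain ⟨hk0, hb0⟩ := hneg
  have key := newton_unique hF.contDiff_half_deriv (T := T)
    (u := fun s => F (greatCircle p w (T - s)))
    (u₁ := fun s => -⟪gradient F (greatCircle p w (T - s)), greatCircleVel p w (T - s)⟫_ℝ)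
    (v := fun _ => F (greatCircle p w T)) (v₁ := fun _ => 0)
    (fun s _ => by
      have := (hF.hasDerivAt_comp_greatCircle hp hw hpw (T - s)).comp_const_sub T s
      exact this)
    (fun s hs => by
      have := (hF.hasDerivAt_inner_gradient_greatCircle hp hw hpw (T - s)).comp_const_sub T s
      refine this.neg.congr_deriv ?_
      rw [neg_neg]
      exact hHI _ ⟨by linarith [hs.2], by linarith [hs.1]⟩)
    (fun s _ => hasDerivAt_const _ _) (fun s _ => by simpa [hb0] using hasDerivAt_const s (0 : ℝ))
    (by simp) (by simpa using hk0) T (right_mem_Icc.2 hT.le)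
  simp only [sub_self, greatCircle_zero, greatCircleVel_zero, neg_eq_zero] at key
  rcases h.nondegenerate with h1 | h1
  · exact h1 key.2
  · rw [key.1] at h1; exact h1 hb0

theorem isGradientDirection_greatCircle_of_nonneg {p w : E} (h : IsGradientDirection F b p w)
    {s : ℝ} (hs : 0 ≤ s) :
    IsGradientDirection F b (greatCircle p w s) (greatCircleVel p w s) := by
  by_contra hneg
  -- Continuation up to the first failure: the property passes to the infimum of the bad times by
  -- closedness, and beyond it by `eventually_isGradientDirection`.
  set B : Set ℝ := {s | 0 ≤ s ∧
    ¬ IsGradientDirection F b (greatCircle p w s) (greatCircleVel p w s)} with hB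
  have hBne : B.Nonempty := ⟨s, hs, hneg⟩
  have hBbdd : BddBelow B := ⟨0, fun t ht => ht.1⟩
  have h0 : 0 ≤ sInf B := le_csInf hBne fun t ht => ht.1
  have hlt : ∀ t ∈ Ico 0 (sInf B),
      IsGradientDirection F b (greatCircle p w t) (greatCircleVel p w t) := fun t ht => by
    by_contra hn
    exact absurd (csInf_le hBbdd ⟨ht.1, hn⟩) (not_le.2 ht.2)
  have hinf : IsGradientDirection F b (greatCircle p w (sInf B)) (greatCircleVel p w (sInf B)) := by
    rcases h0.eq_or_lt with h | hpos
    · rw [← h]; simpa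
    · exact hF.isGradientDirection_of_forall_Ico h hpos hlt
  have hev := hF.eventually_isGradientDirection hinf
  simp only [greatCircle_add, greatCircleVel_add] at hev
  obtain ⟨ε, hε, hsub⟩ := mem_nhdsGT_iff_exists_Ioo_subset.1 hev
  obtain ⟨t, ht, htlt⟩ := exists_lt_of_csInf_lt hBne
    (lt_add_of_pos_right (sInf B) (show (0 : ℝ) < ε from hε))
  rcases (csInf_le hBbdd ht).eq_or_lt with h1 | h1
  · exact ht.2 (h1 ▸ hinf)
  · have := hsub (show t - sInf B ∈ Ioo 0 ε from ⟨by linarith, by linarith⟩)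
    simp only [mem_ofPred_eq, add_sub_cancel] at this
    exact ht.2 this

/-- Great circles which start in the direction of the gradient remain gradient curves, even
beyond critical points. -/
theorem isGradientDirection_greatCircle {p w : E} (h : IsGradientDirection F b p w) (s : ℝ) :
    IsGradientDirection F b (greatCircle p w s) (greatCircleVel p w s) := by
  rcases le_total 0 s with hs | hs
  · exact hF.isGradientDirection_greatCircle_of_nonneg h hs
  · have := (hF.isGradientDirection_greatCircle_of_nonneg h.neg (neg_nonneg.2 hs)).neg
    simpa [greatCircle_neg, greatCircleVel_neg] using this

/-- Along a gradient great circle, the function is determined by its initial data. -/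
theorem comp_greatCircle_unique {p w q v : E} (h : IsGradientDirection F b p w)
    (h' : IsGradientDirection F b q v) (h0 : F p = F q)
    (h1 : ⟪gradient F p, w⟫_ℝ = ⟪gradient F q, v⟫_ℝ) (s : ℝ) :
    F (greatCircle p w s) = F (greatCircle q v s) ∧
      ⟪gradient F (greatCircle p w s), greatCircleVel p w s⟫_ℝ =
        ⟪gradient F (greatCircle q v s), greatCircleVel q v s⟫_ℝ := by
  have main : ∀ {p w q v : E}, IsGradientDirection F b p w → IsGradientDirection F b q v →
      F p = F q → ⟪gradient F p, w⟫_ℝ = ⟪gradient F q, v⟫_ℝ → ∀ s, 0 ≤ s →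
      F (greatCircle p w s) = F (greatCircle q v s) ∧
      ⟪gradient F (greatCircle p w s), greatCircleVel p w s⟫_ℝ =
        ⟪gradient F (greatCircle q v s), greatCircleVel q v s⟫_ℝ := by
    intro p w q v h h' h0 h1 s hs
    -- On a gradient circle the velocity is an eigenvector up to a radial term, so the second
    -- derivative of F along it is b'(F)/2, an autonomous equation.
    have aux : ∀ {p w : E}, IsGradientDirection F b p w → ∀ t, HasDerivAt
        (fun s => ⟪gradient F (greatCircle p w s), greatCircleVel p w s⟫_ℝ)
        (deriv b (F (greatCircle p w t)) / 2) t := fun h t => by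
      refine (hF.hasDerivAt_inner_gradient_greatCircle h.norm_base h.norm_dir h.inner_eq
        t).congr_deriv ?_
      exact IsGradientDirection.inner_hess_eq (hF.isGradientDirection_greatCircle h t)
    exact newton_unique hF.contDiff_half_deriv
      (fun t _ => hF.hasDerivAt_comp_greatCircle h.norm_base h.norm_dir h.inner_eq t)
      (fun t _ => aux h t)
      (fun t _ => hF.hasDerivAt_comp_greatCircle h'.norm_base h'.norm_dir h'.inner_eq t)
      (fun t _ => aux h' t) (by simpa using h0)
      (by simpa only [greatCircle_zero, greatCircleVel_zero] using h1) s (right_mem_Icc.2 hs)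
  rcases le_total 0 s with hs | hs
  · exact main h h' h0 h1 s hs
  · have := main h.neg h'.neg h0 (by rw [inner_neg_right, inner_neg_right, h1]) (-s)
      (neg_nonneg.2 hs)
    simpa only [greatCircle_neg, greatCircleVel_neg, neg_neg, inner_neg_right, neg_inj] using this

end IsConicalTransnormal

end GradientDirections

/-! ### Tangent spaces through normal retractions. -/

section Retraction

variable {E : Type*} [NormedAddCommGroup E] [InnerProductSpace ℝ E]

/-- Two differentials of a function along `M` agree on the tangent space. -/
theorem HasFDerivWithinAt.eq_of_mem_tangentSubspace {M : Set E} {G : Type*}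
    [NormedAddCommGroup G] [NormedSpace ℝ G] {f : E → G} {f₁ f₂ : E →L[ℝ] G} {x : E}
    (h₁ : HasFDerivWithinAt f f₁ M x) (h₂ : HasFDerivWithinAt f f₂ M x) {v : E}
    (hv : v ∈ tangentSubspace M x) : f₁ v = f₂ v := by
  have : tangentSubspace M x ≤ LinearMap.eqLocus (f₁ : E →ₗ[ℝ] G) f₂ :=
    Submodule.span_le.2 fun w hw => h₁.unique_on h₂ hw
  exact this hv

/-- `P` is a smooth retraction of the open set `U` to its `n`-dimensional subset `M`, whose
differentials at the points of `M` are symmetric, hence orthogonal projections. -/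
structure IsNormalRetraction (n : ℕ) (U M : Set E) (P : E → E) : Prop where
  isOpen : IsOpen U
  subset : M ⊆ U
  contDiffOn : ContDiffOn ℝ ∞ P U
  mapsTo : MapsTo P U M
  eq_self : ∀ x ∈ M, P x = x
  symm : ∀ x ∈ M, ∀ u v, ⟪fderiv ℝ P x u, v⟫_ℝ = ⟪u, fderiv ℝ P x v⟫_ℝ
  finrank_range : ∀ x ∈ M, finrank ℝ (LinearMap.range (fderiv ℝ P x : E →ₗ[ℝ] E)) = n

namespace IsNormalRetraction

variable {n : ℕ} {U M : Set E} {P : E → E} (hP : IsNormalRetraction n U M P)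
include hP

theorem mem_nhds {x : E} (hx : x ∈ M) : U ∈ 𝓝 x := hP.isOpen.mem_nhds (hP.subset hx)

theorem contDiffAt {x : E} (hx : x ∈ U) : ContDiffAt ℝ ∞ P x :=
  hP.contDiffOn.contDiffAt (hP.isOpen.mem_nhds hx)

theorem hasFDerivAt {x : E} (hx : x ∈ U) : HasFDerivAt P (fderiv ℝ P x) x :=
  ((hP.contDiffAt hx).differentiableAt (by simp)).hasFDerivAt

theorem fderiv_fderiv {x : E} (hx : x ∈ M) (v : E) :
    fderiv ℝ P x (fderiv ℝ P x v) = fderiv ℝ P x v := by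
  have h1 := hP.hasFDerivAt (hP.subset hx)
  have h2 : HasFDerivAt P (fderiv ℝ P x) (P x) := by rwa [hP.eq_self x hx]
  have h3 : P ∘ P =ᶠ[𝓝 x] P :=
    Filter.eventually_of_mem (hP.mem_nhds hx) fun z hz => hP.eq_self _ (hP.mapsTo hz)
  have h4 := (h2.comp x h1).unique (h1.congr_of_eventuallyEq h3)
  exact congrArg (fun L : E →L[ℝ] E => L v) h4

theorem fderiv_apply_of_mem_tangentConeAt {x : E} (hx : x ∈ M) {v : E}
    (hv : v ∈ tangentConeAt ℝ M x) : fderiv ℝ P x v = v := by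
  have h1 := (hP.hasFDerivAt (hP.subset hx)).hasFDerivWithinAt (s := M)
  have h2 : HasFDerivWithinAt P (ContinuousLinearMap.id ℝ E) M x :=
    (hasFDerivWithinAt_id x M).congr (fun y hy => hP.eq_self y hy) (hP.eq_self x hx)
  exact h1.unique_on h2 hv

/-- The retraction maps the open set `U`, whose tangent cone is everything, into `M`. With the
fixed-point property on the cone, the tangent cone is the range of the differential, hence already a
linear space. -/
theorem fderiv_mem_tangentConeAt {x : E} (hx : x ∈ M) (v : E) :
    fderiv ℝ P x v ∈ tangentConeAt ℝ M x := by
  have h1 := (hP.hasFDerivAt (hP.subset hx)).hasFDerivWithinAt (s := U)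
  have h2 : v ∈ tangentConeAt ℝ U x := by
    rw [tangentConeAt_of_mem_nhds (hP.mem_nhds hx)]; trivial
  have h3 := h1.mapsTo_tangent_cone h2
  rw [hP.eq_self x hx] at h3
  exact tangentConeAt_mono hP.mapsTo.image_subset h3

theorem mem_tangentSubspace_iff {x : E} (hx : x ∈ M) {v : E} :
    v ∈ tangentSubspace M x ↔ fderiv ℝ P x v = v := by
  constructor
  · intro hv
    have : tangentSubspace M x ≤ LinearMap.eqLocus (fderiv ℝ P x : E →ₗ[ℝ] E) LinearMap.id :=
      Submodule.span_le.2 fun w hw => hP.fderiv_apply_of_mem_tangentConeAt hx hw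
    exact this hv
  · intro hv
    rw [← hv]
    exact Submodule.subset_span (hP.fderiv_mem_tangentConeAt hx v)

theorem fderiv_mem_tangentSubspace {x : E} (hx : x ∈ M) (v : E) :
    fderiv ℝ P x v ∈ tangentSubspace M x :=
  (hP.mem_tangentSubspace_iff hx).2 (hP.fderiv_fderiv hx v)

theorem range_fderiv {x : E} (hx : x ∈ M) :
    LinearMap.range (fderiv ℝ P x : E →ₗ[ℝ] E) = tangentSubspace M x := by
  ext v
  constructor
  · rintro ⟨u, rfl⟩; exact hP.fderiv_mem_tangentSubspace hx u
  · intro hv; exact ⟨v, (hP.mem_tangentSubspace_iff hx).1 hv⟩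

theorem finrank_tangentSubspace {x : E} (hx : x ∈ M) : finrank ℝ (tangentSubspace M x) = n := by
  rw [← hP.range_fderiv hx, hP.finrank_range x hx]

end IsNormalRetraction

end Retraction

/-! ### Retraction onto a regular level set along gradient circles. -/

section LevelSets

variable {E : Type*} [NormedAddCommGroup E] [InnerProductSpace ℝ E] [CompleteSpace E]

namespace IsConicalTransnormal

variable {F : E → ℝ} {b : ℝ → ℝ} (hF : IsConicalTransnormal F b)
include hF

theorem contDiff_comp_greatCircle {p w : E} (hp : ‖p‖ = 1) (hw : ‖w‖ = 1) (hpw : ⟪w, p⟫_ℝ = 0) :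
    ContDiff ℝ ∞ fun s => F (greatCircle p w s) :=
  contDiff_iff_contDiffAt.2 fun s =>
    (hF.contDiffAt _ (ne_zero_of_norm_eq_one (norm_greatCircle hp hw hpw s))).comp s
      (contDiff_greatCircle p w).contDiffAt

/-- The unit normal field `∇F / |∇F|`, as a function which is constant along rays. -/
theorem isGradientDirection_unit_gradient {p : E} (hp : ‖p‖ = 1) (hb : 0 < b (F p)) :
    IsGradientDirection F b p ((√(b (F p)))⁻¹ • gradient F p) ∧
      ⟪gradient F p, (√(b (F p)))⁻¹ • gradient F p⟫_ℝ = √(b (F p)) := by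
  have hs : 0 < √(b (F p)) := Real.sqrt_pos.2 hb
  have hn : ‖gradient F p‖ = √(b (F p)) := by
    rw [← hF.norm_gradient p hp, Real.sqrt_sq (norm_nonneg _)]
  constructor
  · refine hF.isGradientDirection_of_gradient_ne_zero hp ?_ hs.ne' ?_
    · rw [norm_smul, norm_inv, Real.norm_eq_abs, abs_of_pos hs, hn, inv_mul_cancel₀ hs.ne']
    · rw [smul_smul, mul_inv_cancel₀ hs.ne', one_smul]
  · rw [inner_smul_right, real_inner_self_eq_norm_sq, hn]
    field_simp

/-- A local parameter of the values of `F` near a regular value: the time which the unit speed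
gradient curve through `x₀` takes to reach a given value. -/
theorem exists_time_function {p w : E} (h : IsGradientDirection F b p w)
    (hk : 0 < ⟪gradient F p, w⟫_ℝ) :
    ∃ (O : Set ℝ) (T : ℝ → ℝ), IsOpen O ∧ F p ∈ O ∧ ContDiffOn ℝ ∞ T O ∧ T (F p) = 0 ∧
      ∀ t ∈ O, F (greatCircle p w (T t)) = t ∧
        0 < ⟪gradient F (greatCircle p w (T t)), greatCircleVel p w (T t)⟫_ℝ := by
  set u : ℝ → ℝ := fun s => F (greatCircle p w s) with hu
  have hus : ContDiff ℝ ∞ u := hF.contDiff_comp_greatCircle h.norm_base h.norm_dir h.inner_eq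
  set k : ℝ → ℝ := fun s => ⟪gradient F (greatCircle p w s), greatCircleVel p w s⟫_ℝ with hkdef
  have hud : ∀ s, HasDerivAt u (k s) s :=
    hF.hasDerivAt_comp_greatCircle h.norm_base h.norm_dir h.inner_eq
  have hkc : Continuous k :=
    (hF.contDiff_gradient_greatCircle h.norm_base h.norm_dir h.inner_eq).continuous.inner
      (contDiff_greatCircleVel p w).continuous
  have hk0 : 0 < k 0 := by simpa only [hkdef, greatCircle_zero, greatCircleVel_zero] using hk
  let L : ℝ ≃L[ℝ] ℝ := ContinuousLinearEquiv.unitsEquivAut ℝ (Units.mk0 (k 0) hk0.ne')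
  have hL : HasFDerivAt u (L : ℝ →L[ℝ] ℝ) 0 := by
    refine (hud 0).hasFDerivAt.congr_fderiv ?_
    ext; simp [L]
  let e := hus.contDiffAt.toOpenPartialHomeomorph u hL (by simp)
  have heu : ∀ s, e s = u s := fun s => rfl
  have h0s : (0 : ℝ) ∈ e.source := hus.contDiffAt.mem_toOpenPartialHomeomorph_source hL (by simp)
  have hu0 : u 0 = F p := by simp [hu]
  have hTc : e.symm (F p) = 0 := by rw [← hu0, ← heu]; exact e.left_inv h0s
  have htar : F p ∈ e.target := by rw [← hu0, ← heu]; exact e.map_source h0s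
  refine ⟨e.target ∩ e.symm ⁻¹' {s | 0 < k s}, e.symm,
    e.isOpen_inter_preimage_symm (isOpen_lt continuous_const hkc), ⟨htar, ?_⟩, ?_, hTc, ?_⟩
  · simpa [hTc] using hk0
  · intro t ht
    exact (e.contDiffAt_symm_deriv (f₀' := k (e.symm t)) ht.2.ne' ht.1 (hud _)
      -- Smoothness of the inverse at every point of the domain, not only at the base value, uses
      -- that the speed k stays positive there.
      hus.contDiffAt).contDiffWithinAt
  · intro t ht
    exact ⟨e.right_inv ht.1, ht.2⟩

/-- The intersection of a regular level set of `F` with the unit sphere is a smooth retract of a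
neighbourhood. -/
theorem exists_retraction {c : ℝ} (hb : 0 < b c) {x₀ : E} (hx₀ : ‖x₀‖ = 1) (hc : F x₀ = c) :
    ∃ (U : Set E) (P : E → E), IsOpen U ∧ {x | ‖x‖ = 1 ∧ F x = c} ⊆ U ∧ ContDiffOn ℝ ∞ P U ∧
      MapsTo P U {x | ‖x‖ = 1 ∧ F x = c} ∧ ∀ x, ‖x‖ = 1 → F x = c → P x = x ∧
      ∀ v, fderiv ℝ P x v = v - ⟪x, v⟫_ℝ • x - (⟪gradient F x, v⟫_ℝ / b c) • gradient F x := by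
  subst hc
  obtain ⟨hg0, hg0'⟩ := hF.isGradientDirection_unit_gradient hx₀ hb
  set w₀ := (√(b (F x₀)))⁻¹ • gradient F x₀
  obtain ⟨O, T, hO, hcO, hT, hT0, hTO⟩ := hF.exists_time_function hg0
    (by rw [hg0']; exact Real.sqrt_pos.2 hb)
  have hbO : ∀ t ∈ O, 0 < b t ∧
      ⟪gradient F (greatCircle x₀ w₀ (T t)), greatCircleVel x₀ w₀ (T t)⟫_ℝ = √(b t) := by
    intro t ht
    obtain ⟨h1, h2⟩ := hTO t ht
    have h3 := hF.isGradientDirection_greatCircle hg0 (T t)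
    have h4 := hF.norm_gradient _ h3.norm_base
    rw [h1, h3.gradient_eq, norm_smul, h3.norm_dir, mul_one, Real.norm_eq_abs, sq_abs] at h4
    rw [← h4]
    exact ⟨by positivity, (Real.sqrt_sq h2.le).symm⟩
  set U : Set E := {0}ᶜ ∩ F ⁻¹' O with hU
  have hFc : ContinuousOn F {0}ᶜ := fun z hz => (hF.contDiffAt z hz).continuousAt.continuousWithinAt
  have hUo : IsOpen U := hFc.isOpen_inter_preimage isOpen_compl_singleton hO
  set q : E → E := fun z => ‖z‖⁻¹ • z
  set N : E → E := fun z => (‖z‖ * (√(b (F z)))⁻¹) • gradient F z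
  -- Project to the sphere, then go back along the normal great circle for the time that leads from
  -- the value F(z) to c.
  set P : E → E := fun z => greatCircle (q z) (N z) (-T (F z)) with hPdef
  have hTs : ∀ z ∈ U, ContDiffAt ℝ ∞ (fun z => -T (F z)) z := fun z hz =>
    ((hT.contDiffAt (hO.mem_nhds hz.2)).comp z (hF.contDiffAt z hz.1)).neg
  have hqs : ∀ z ∈ U, ContDiffAt ℝ ∞ q z := fun z hz =>
    ((contDiffAt_norm ℝ hz.1).inv (norm_ne_zero_iff.2 hz.1)).smul contDiffAt_id
  have hNs : ∀ z ∈ U, ContDiffAt ℝ ∞ N z := fun z hz => by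
    have hbz := (hbO _ hz.2).1
    have h1 : ContDiffAt ℝ ∞ (fun z => √(b (F z))) z :=
      (hF.contDiff.contDiffAt.comp z (hF.contDiffAt z hz.1)).sqrt hbz.ne'
    exact ((contDiffAt_norm ℝ hz.1).mul (h1.inv (Real.sqrt_pos.2 hbz).ne')).smul
      (hF.contDiffAt z hz.1).gradient_infty
  have hunit : ∀ z ∈ U, IsGradientDirection F b (q z) (N z) ∧ F (q z) = F z ∧
      ⟪gradient F (q z), N z⟫_ℝ = √(b (F z)) := by
    intro z hz
    have hn : 0 < ‖z‖ := norm_pos_iff.2 hz.1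
    have hq1 : ‖q z‖ = 1 := by
      simp only [q]; rw [norm_smul, norm_inv, norm_norm, inv_mul_cancel₀ hn.ne']
    have hFq : F (q z) = F z := hF.map_smul z hz.1 _ (inv_pos.2 hn)
    have hNz : N z = (√(b (F (q z))))⁻¹ • gradient F (q z) := by
      have h1 := hF.gradient_smul hz.1 (inv_pos.2 hn)
      rw [hFq]
      simp only [N]
      rw [← h1, smul_smul, mul_comm ‖z‖, mul_assoc, mul_inv_cancel₀ hn.ne', mul_one]
    have := hF.isGradientDirection_unit_gradient hq1 (by rw [hFq]; exact (hbO _ hz.2).1)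
    rw [← hNz] at this
    exact ⟨this.1, hFq, by rw [this.2, hFq]⟩
  refine ⟨U, P, hUo, ?_, ?_, ?_, ?_⟩
  · rintro x ⟨hx1, hx2⟩
    exact ⟨ne_zero_of_norm_eq_one hx1, by rw [mem_preimage, hx2]; exact hcO⟩
  · intro z hz
    refine ContDiffAt.contDiffWithinAt ?_
    simp only [hPdef, greatCircle]
    exact ((hTs z hz).cos.smul (hqs z hz)).add ((hTs z hz).sin.smul (hNs z hz))
  · intro z hz
    obtain ⟨h1, h2, h3⟩ := hunit z hz
    refine ⟨norm_greatCircle h1.norm_base h1.norm_dir h1.inner_eq _, ?_⟩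
    have h4 := hF.isGradientDirection_greatCircle hg0 (T (F z))
    have h5 := (hF.comp_greatCircle_unique h1 h4 (h2.trans (hTO _ hz.2).1.symm)
      (h3.trans (hbO _ hz.2).2.symm) (-T (F z))).1
    simp only [hPdef]
    rw [h5, greatCircle_add]
    simp
  · intro x hx1 hx2
    have hxU : x ∈ U := ⟨ne_zero_of_norm_eq_one hx1, by rw [mem_preimage, hx2]; exact hcO⟩
    have hx0 := ne_zero_of_norm_eq_one hx1
    have hqx : q x = x := by simp [q, hx1]
    have hNx : N x = (√(b (F x₀)))⁻¹ • gradient F x := by simp [N, hx1, hx2]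
    have hsq : 0 < √(b (F x₀)) := Real.sqrt_pos.2 hb
    refine ⟨by simp [hPdef, hx2, hT0, hqx], fun v => ?_⟩
    -- The time function inverts F along the reference circle, which has derivative √b at the
    -- starting point.
    have hTd : HasDerivAt T (√(b (F x₀)))⁻¹ (F x₀) := by
      have hd := ((hT.contDiffAt (hO.mem_nhds hcO)).differentiableAt (by simp)).hasDerivAt
      have h1 : HasDerivAt (fun s => F (greatCircle x₀ w₀ s)) √(b (F x₀)) (T (F x₀)) := by
        rw [hT0, ← hg0']
        simpa only [greatCircle_zero, greatCircleVel_zero] using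
          hF.hasDerivAt_comp_greatCircle hg0.norm_base hg0.norm_dir hg0.inner_eq 0
      have h2 := h1.comp (F x₀) hd
      have h3 : (fun s => F (greatCircle x₀ w₀ s)) ∘ T =ᶠ[𝓝 (F x₀)] id :=
        Filter.eventually_of_mem (hO.mem_nhds hcO) fun t ht => (hTO t ht).1
      have h4 := h2.unique ((hasDerivAt_id _).congr_of_eventuallyEq h3)
      rwa [eq_inv_of_mul_eq_one_right h4] at hd
    have hline := hasDerivAt_line (((hF.contDiffAt x hx0).differentiableAt (by simp)).hasFDerivAt) v
    have hFx : F (x + (0 : ℝ) • v) = F x₀ := by simpa using hx2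
    have hτ : HasDerivAt (fun t : ℝ => -T (F (x + t • v)))
        (-((√(b (F x₀)))⁻¹ * ⟪gradient F x, v⟫_ℝ)) 0 := by
      rw [inner_gradient_left]
      have hTd' : HasDerivAt T (√(b (F x₀)))⁻¹ (F (x + (0 : ℝ) • v)) := by rwa [hFx]
      exact (hTd'.comp (0 : ℝ) hline).neg
    have hid : HasDerivAt (fun t : ℝ => x + t • v) v 0 := by
      simpa using ((hasDerivAt_id (0 : ℝ)).smul_const v).const_add x
    have hq' : HasDerivAt (fun t : ℝ => q (x + t • v)) (v - ⟪x, v⟫_ℝ • x) 0 := by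
      have hnorm : HasDerivAt (fun t : ℝ => ‖x + t • v‖) ⟪x, v⟫_ℝ 0 := by
        have h1 := hid.norm_sq
        have h2 := h1.sqrt (by simp [hx1])
        simp only [Real.sqrt_sq (norm_nonneg _)] at h2
        refine h2.congr_deriv ?_
        simp [hx1]
      have := (hnorm.inv (by simp [hx1])).smul hid
      refine this.congr_deriv ?_
      simp [hx1]; abel
    -- The derivative of the normal field need not be computed: the time is 0 on the level set, so
    -- it enters with the factor sin 0.
    have hN' := hasDerivAt_line ((hNs x hxU).differentiableAt (by simp)).hasFDerivAt v
    have hP' := (hτ.cos.smul hq').add (hτ.sin.smul hN')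
    have hPd : DifferentiableAt ℝ P x := by
      have : ContDiffAt ℝ ∞ P x := by
        simp only [hPdef, greatCircle]
        exact ((hTs x hxU).cos.smul (hqs x hxU)).add ((hTs x hxU).sin.smul (hNs x hxU))
      exact this.differentiableAt (by simp)
    have := (hasDerivAt_line hPd.hasFDerivAt v).unique hP'
    rw [this]
    have h0 : -T (F (x + (0 : ℝ) • v)) = 0 := by rw [hFx, hT0, neg_zero]
    rw [h0]
    simp only [zero_smul, add_zero, hNx, hqx, Real.cos_zero, Real.sin_zero]
    have hbb : b (F x₀) = √(b (F x₀)) * √(b (F x₀)) := (Real.mul_self_sqrt hb.le).symm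
    rw [smul_smul, div_eq_mul_inv, hbb, mul_inv, ← hbb]
    module

end IsConicalTransnormal

end LevelSets

/-! ### Hausdorff measure on submanifolds and half of the area formula. -/

section Area

theorem LipschitzOnWith.euclideanHausdorffMeasure_image_le {X Y : Type*} [EMetricSpace X]
    [EMetricSpace Y] [MeasurableSpace X] [BorelSpace X] [MeasurableSpace Y] [BorelSpace Y] {K : ℝ≥0}
    {f : X → Y} {s : Set X} (h : LipschitzOnWith K f s) (n : ℕ) :
    μHE[n] (f '' s) ≤ (K : ℝ≥0∞) ^ n * μHE[n] s := by
  simp_rw [Measure.euclideanHausdorffMeasure_def, Measure.smul_apply]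
  have := h.hausdorffMeasure_image_le (d := n) n.cast_nonneg
  rw [ENNReal.rpow_natCast] at this
  rw [mul_smul_comm]
  gcongr

variable {E : Type*} [NormedAddCommGroup E] [InnerProductSpace ℝ E]

namespace IsNormalRetraction

variable {n : ℕ} {U M : Set E} {P : E → E} (hP : IsNormalRetraction n U M P)
include hP

/-- A symmetric idempotent is an orthogonal projection, so Cauchy–Schwarz applies to |Dv|² = ⟨v,
Dv⟩. -/
theorem norm_fderiv_apply_le {x : E} (hx : x ∈ M) (v : E) : ‖fderiv ℝ P x v‖ ≤ ‖v‖ := by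
  have h1 : ‖fderiv ℝ P x v‖ * ‖fderiv ℝ P x v‖ ≤ ‖fderiv ℝ P x v‖ * ‖v‖ := by
    rw [← real_inner_self_eq_norm_mul_norm, hP.symm x hx, hP.fderiv_fderiv hx, real_inner_comm]
    exact real_inner_le_norm _ _
  by_cases h0 : ‖fderiv ℝ P x v‖ = 0
  · rw [h0]; exact norm_nonneg v
  · exact le_of_mul_le_mul_left h1 ((norm_nonneg _).lt_of_ne' h0)

/-- The orthogonal projection to the tangent space. -/
def proj {x : E} (hx : x ∈ M) : E →L[ℝ] tangentSubspace M x :=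
  (fderiv ℝ P x).codRestrict (tangentSubspace M x) (hP.fderiv_mem_tangentSubspace hx)

theorem lipschitzWith_proj {x : E} (hx : x ∈ M) : LipschitzWith 1 (hP.proj hx) :=
  LipschitzWith.of_dist_le_mul fun y z => by
    rw [dist_eq_norm, dist_eq_norm, ← map_sub, NNReal.coe_one, one_mul]
    exact hP.norm_fderiv_apply_le hx _

theorem hasStrictFDerivAt {x : E} (hx : x ∈ U) : HasStrictFDerivAt P (fderiv ℝ P x) x :=
  (hP.contDiffAt hx).hasStrictFDerivAt (by simp)

/-- Near `x`, the set `M` is close to its tangent space at `x`. -/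
theorem exists_nhds_norm_sub_le {x : E} (hx : x ∈ M) {ε : ℝ≥0} (hε : 0 < ε) :
    ∃ V ∈ 𝓝 x, ∀ y ∈ M ∩ V, ∀ z ∈ M ∩ V,
      ‖(y - z) - fderiv ℝ P x (y - z)‖ ≤ ε * ‖y - z‖ := by
  obtain ⟨V, hV, happ⟩ := (hP.hasStrictFDerivAt (hP.subset hx)).approximates_deriv_on_nhds
    (Or.inr hε)
  refine ⟨V, hV, fun y hy z hz => ?_⟩
  have := happ y hy.2 z hz.2
  rwa [hP.eq_self y hy.1, hP.eq_self z hz.1] at this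

variable [MeasurableSpace E] [BorelSpace E]

/-- If `B ⊆ M` is almost flat, its area is controlled by that of its projection. -/
theorem measure_le_of_flat {x : E} (hx : x ∈ M) {ε : ℝ≥0} (hε : ε < 1) {B : Set E}
    (hB : ∀ y ∈ B, ∀ z ∈ B, ‖(y - z) - fderiv ℝ P x (y - z)‖ ≤ ε * ‖y - z‖) :
    InjOn (hP.proj hx) B ∧
      LipschitzOnWith (1 - ε)⁻¹ (Function.invFunOn (hP.proj hx) B) (hP.proj hx '' B) ∧
      μHE[n] B ≤ ((1 - ε)⁻¹ : ℝ≥0) ^ n * μHE[n] (hP.proj hx '' B) := by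
  have hε1 : (0 : ℝ) < 1 - ε := sub_pos.2 (by exact_mod_cast hε)
  have hcoe : ((1 - ε : ℝ≥0) : ℝ) = 1 - ε := by rw [NNReal.coe_sub hε.le, NNReal.coe_one]
  have hlow : ∀ y ∈ B, ∀ z ∈ B, ‖y - z‖ ≤ ((1 - ε)⁻¹ : ℝ≥0) * ‖hP.proj hx y - hP.proj hx z‖ := by
    intro y hy z hz
    have h1 := hB y hy z hz
    have h2 : ‖y - z‖ ≤ ‖(y - z) - fderiv ℝ P x (y - z)‖ + ‖fderiv ℝ P x (y - z)‖ := by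
      simpa using norm_add_le ((y - z) - fderiv ℝ P x (y - z)) (fderiv ℝ P x (y - z))
    have h3 : ‖hP.proj hx y - hP.proj hx z‖ = ‖fderiv ℝ P x (y - z)‖ := by
      rw [← map_sub]; rfl
    rw [h3, NNReal.coe_inv, hcoe, le_inv_mul_iff₀ hε1]
    linarith
  have hinj : InjOn (hP.proj hx) B := fun y hy z hz h => by
    have := hlow y hy z hz
    rw [h, sub_self, norm_zero, mul_zero] at this
    exact sub_eq_zero.1 (norm_le_zero_iff.1 this)
  have hinv := hinj.leftInvOn_invFunOn
  have hlip : LipschitzOnWith (1 - ε)⁻¹ (Function.invFunOn (hP.proj hx) B) (hP.proj hx '' B) := by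
    refine LipschitzOnWith.of_dist_le_mul ?_
    rintro _ ⟨y, hy, rfl⟩ _ ⟨z, hz, rfl⟩
    rw [hinv hy, hinv hz, dist_eq_norm, dist_eq_norm]
    exact hlow y hy z hz
  refine ⟨hinj, hlip, ?_⟩
  have := hlip.euclideanHausdorffMeasure_image_le n
  rwa [hinv.image_image] at this

variable [FiniteDimensional ℝ E]

theorem isAddHaarMeasure {x : E} (hx : x ∈ M) :
    (μHE[n] : Measure (tangentSubspace M x)).IsAddHaarMeasure := by
  have := hP.finrank_tangentSubspace hx
  subst this
  infer_instance

/-- Near each point `M` is a Lipschitz image of a bounded piece of its tangent space, where the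
measure is a Haar measure; compactness does the rest. -/
theorem measure_lt_top (hM : IsCompact M) : μHE[n] M < ⊤ := by
  refine hM.measure_lt_top_of_nhdsWithin fun x hx => ?_
  obtain ⟨V, hV, hflat⟩ := hP.exists_nhds_norm_sub_le hx (ε := 1 / 2) (by norm_num)
  have hfl := hP.measure_le_of_flat hx (ε := 1 / 2) (by
    rw [← NNReal.coe_lt_coe]; norm_num) hflat
  refine ⟨M ∩ V, Filter.inter_mem self_mem_nhdsWithin (nhdsWithin_le_nhds hV), ?_⟩
  refine hfl.2.2.trans_lt (ENNReal.mul_lt_top (ENNReal.pow_lt_top ENNReal.coe_lt_top) ?_)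
  have := hP.isAddHaarMeasure hx
  exact (((hP.lipschitzWith_proj hx).isBounded_image
    (hM.isBounded.subset inter_subset_left))).measure_lt_top

/-- The area distortion of a map near a point of `M`. -/
theorem exists_nhds_mul_measure_le {x : E} (hx : x ∈ M) {Φ : E → E} {Φ' : E →L[ℝ] E}
    (hΦ : HasStrictFDerivAt Φ Φ' x) {m : ℝ≥0}
    (hm : (m : ℝ≥0∞) < ENNReal.ofReal
      |((hP.proj hx).comp (Φ'.comp (tangentSubspace M x).subtypeL)).det|) :
    ∃ V ∈ 𝓝 x, ∀ B ⊆ M ∩ V, (m : ℝ≥0∞) * μHE[n] B ≤ μHE[n] (Φ '' B) := by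
  have := hP.isAddHaarMeasure hx
  set A := (hP.proj hx).comp (Φ'.comp (tangentSubspace M x).subtypeL) with hA
  -- The room between m and m' absorbs the factor (1 - ε)ⁿ by which flattening `M` to its tangent
  -- space may change areas.
  obtain ⟨m', hmm', hm'⟩ := ENNReal.lt_iff_exists_nnreal_btwn.1 hm
  have hmm' : m < m' := by exact_mod_cast hmm'
  have h1 := mul_le_addHaar_image_of_lt_det (μHE[n] : Measure (tangentSubspace M x)) A hm'
  obtain ⟨δ, hδ, happ⟩ := (h1.and self_mem_nhdsWithin).exists
  obtain ⟨hδ, happ⟩ := And.intro (show 0 < δ from happ) hδ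
  have h2 : ∀ᶠ ε : ℝ≥0 in 𝓝[>] 0, m < m' * (1 - ε) ^ n ∧
      (ε + ‖Φ'‖₊ * ε) * (1 - ε)⁻¹ < δ ∧ ε < 1 := by
    refine Filter.Eventually.filter_mono nhdsWithin_le_nhds ?_
    refine Filter.Eventually.and ?_ (Filter.Eventually.and ?_ (Iio_mem_nhds zero_lt_one))
    · have : ContinuousAt (fun ε : ℝ≥0 => m' * (1 - ε) ^ n) 0 := by fun_prop
      exact continuousAt_const.eventually_lt this (by simpa using hmm')
    · have : ContinuousAt (fun ε : ℝ≥0 => (ε + ‖Φ'‖₊ * ε) * (1 - ε)⁻¹) 0 := by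
        refine ContinuousAt.mul (by fun_prop) (ContinuousAt.inv₀ (by fun_prop) (by simp))
      exact this.eventually_lt continuousAt_const (by simpa using hδ)
  obtain ⟨ε, ⟨hε1, hε2, hε3⟩, hε0⟩ := (h2.and self_mem_nhdsWithin).exists
  have hε0 : 0 < ε := hε0
  obtain ⟨V₁, hV₁, hflat⟩ := hP.exists_nhds_norm_sub_le hx hε0
  obtain ⟨V₂, hV₂, hΦV⟩ := hΦ.approximates_deriv_on_nhds (Or.inr hε0)
  refine ⟨V₁ ∩ V₂, Filter.inter_mem hV₁ hV₂, fun B hB => ?_⟩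
  have hflatB : ∀ y ∈ B, ∀ z ∈ B, ‖(y - z) - fderiv ℝ P x (y - z)‖ ≤ ε * ‖y - z‖ :=
    fun y hy z hz => hflat y ⟨(hB hy).1, (hB hy).2.1⟩ z ⟨(hB hz).1, (hB hz).2.1⟩
  obtain ⟨hinj, hlip, hmeas⟩ := hP.measure_le_of_flat hx hε3 hflatB
  have hinv := hinj.leftInvOn_invFunOn
  set S := hP.proj hx '' B with hS
  set h := Function.invFunOn (hP.proj hx) B with hh
  -- In the chart given by projection to the tangent space, and after projecting the image back, Φ
  -- is close to the linear map A. The known estimate for maps of a finite-dimensional space then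
  -- applies.
  have happS : ApproximatesLinearOn (fun s => hP.proj hx (Φ (h s))) A S δ := by
    rintro _ ⟨y, hy, rfl⟩ _ ⟨z, hz, rfl⟩
    dsimp only
    rw [hinv hy, hinv hz]
    have e1 : hP.proj hx (Φ y) - hP.proj hx (Φ z) - A (hP.proj hx y - hP.proj hx z) =
        hP.proj hx ((Φ y - Φ z - Φ' (y - z)) +
          Φ' ((y - z) - fderiv ℝ P x (y - z))) := by
      have : A (hP.proj hx y - hP.proj hx z) = hP.proj hx (Φ' (fderiv ℝ P x (y - z))) := by
        rw [← map_sub]; rfl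
      rw [this, ← map_sub, ← map_sub, map_sub Φ' (y - z)]
      congr 1
      abel
    rw [e1]
    have e2 : ‖y - z‖ ≤ (1 - ε : ℝ≥0)⁻¹ * ‖hP.proj hx y - hP.proj hx z‖ := by
      have := hlip.dist_le_mul _ (mem_image_of_mem _ hy) _ (mem_image_of_mem _ hz)
      rwa [hinv hy, hinv hz, dist_eq_norm, dist_eq_norm] at this
    calc ‖hP.proj hx ((Φ y - Φ z - Φ' (y - z)) + Φ' ((y - z) - fderiv ℝ P x (y - z)))‖
        ≤ ‖(Φ y - Φ z - Φ' (y - z)) + Φ' ((y - z) - fderiv ℝ P x (y - z))‖ :=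
          hP.norm_fderiv_apply_le hx _
      _ ≤ ‖Φ y - Φ z - Φ' (y - z)‖ + ‖Φ' ((y - z) - fderiv ℝ P x (y - z))‖ := norm_add_le _ _
      _ ≤ ε * ‖y - z‖ + ‖Φ'‖ * (ε * ‖y - z‖) := by
          gcongr
          · exact hΦV y (hB hy).2.2 z (hB hz).2.2
          · exact (Φ'.le_opNorm _).trans (by gcongr; exact hflatB y hy z hz)
      _ = (ε + ‖Φ'‖₊ * ε : ℝ≥0) * ‖y - z‖ := by push_cast; ring
      _ ≤ (ε + ‖Φ'‖₊ * ε : ℝ≥0) * ((1 - ε : ℝ≥0)⁻¹ * ‖hP.proj hx y - hP.proj hx z‖) := by gcongr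
      _ ≤ δ * ‖hP.proj hx y - hP.proj hx z‖ := by
          rw [← mul_assoc]
          gcongr
          exact_mod_cast hε2.le
  have himage : (fun s => hP.proj hx (Φ (h s))) '' S = hP.proj hx '' (Φ '' B) := by
    rw [hS, image_image, image_image]
    exact image_congr fun y hy => by rw [hinv hy]
  have hne : (1 - ε : ℝ≥0) ≠ 0 := (tsub_pos_of_lt hε3).ne'
  calc (m : ℝ≥0∞) * μHE[n] B
      ≤ (m' * (1 - ε) ^ n : ℝ≥0) * (((1 - ε)⁻¹ : ℝ≥0) ^ n * μHE[n] S) := by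
        gcongr
    _ = m' * μHE[n] S := by
        rw [← mul_assoc, ← ENNReal.coe_pow, ← ENNReal.coe_mul, mul_assoc, ← mul_pow,
          mul_inv_cancel₀ hne, one_pow, mul_one]
    _ ≤ μHE[n] ((fun s => hP.proj hx (Φ (h s))) '' S) := happ S _ happS
    _ = μHE[n] (hP.proj hx '' (Φ '' B)) := by rw [himage]
    _ ≤ μHE[n] (Φ '' B) := by
        simpa using ((hP.lipschitzWith_proj hx).lipschitzOnWith
          (s := Φ '' B)).euclideanHausdorffMeasure_image_le n

/-- One half of the area formula for an injective map defined on `M`. -/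
theorem lintegral_det_le_measure_image (hM : IsCompact M) {Φ : E → E} {Φ' : E → E →L[ℝ] E}
    (hΦ : ∀ x ∈ M, HasStrictFDerivAt Φ (Φ' x) x) (hinj : InjOn Φ M) {J : E → ℝ}
    (hJ : ContinuousOn J M) (hJ0 : ∀ x ∈ M, 0 < J x)
    (hJdet : ∀ x, ∀ hx : x ∈ M,
      J x ≤ |((hP.proj hx).comp ((Φ' x).comp (tangentSubspace M x).subtypeL)).det|) :
    ∫⁻ x in M, ENNReal.ofReal (J x) ∂(μHE[n]) ≤ μHE[n] (Φ '' M) := by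
  have hμM := hP.measure_lt_top hM
  have hMm : MeasurableSet M := hM.isClosed.measurableSet
  have hΦc : ContinuousOn Φ M := fun x hx => (hΦ x hx).hasFDerivAt.continuousAt.continuousWithinAt
  -- The error is twice η: once because J varies locally by at most η, once because the local
  -- constant m lies η below J.
  have key : ∀ η : ℝ≥0, 0 < η → ∫⁻ x in M, ENNReal.ofReal (J x) ∂(μHE[n]) ≤
      μHE[n] (Φ '' M) + 2 * η * μHE[n] M := by
    intro η hη
    have hloc : ∃ s, M ⊆ s ∧ MeasurableSet s ∧ ∀ B ⊆ M ∩ s, MeasurableSet B →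
        ∫⁻ x in B, ENNReal.ofReal (J x) ∂(μHE[n]) ≤ μHE[n] (Φ '' B) + 2 * η * μHE[n] B := by
      -- The estimate is demanded of all measurable subsets, so that overlapping pieces can be cut
      -- apart; injectivity keeps the images of disjoint pieces disjoint.
      refine hM.induction_on (p := fun t => ∃ s, t ⊆ s ∧ MeasurableSet s ∧ ∀ B ⊆ M ∩ s,
        MeasurableSet B → ∫⁻ x in B, ENNReal.ofReal (J x) ∂(μHE[n]) ≤
          μHE[n] (Φ '' B) + 2 * η * μHE[n] B) ?_ ?_ ?_ ?_
      · refine ⟨∅, Subset.rfl, MeasurableSet.empty, fun B hB _ => ?_⟩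
        rw [inter_empty, subset_empty_iff] at hB
        simp [hB]
      · rintro s t hst ⟨s', h1, h2⟩
        exact ⟨s', hst.trans h1, h2⟩
      · rintro s t ⟨s', hs, hs1, hs2⟩ ⟨t', ht, ht1, ht2⟩
        refine ⟨s' ∪ t', union_subset_union hs ht, hs1.union ht1, fun B hB hBm => ?_⟩
        have hB1 : B ∩ s' ⊆ M ∩ s' := fun y hy => ⟨(hB hy.1).1, hy.2⟩
        have hB2 : B \ s' ⊆ M ∩ t' := fun y hy => ⟨(hB hy.1).1, (hB hy.1).2.resolve_left hy.2⟩
        have hBM : B ⊆ M := fun y hy => (hB hy).1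
        have hd : Disjoint (Φ '' (B ∩ s')) (Φ '' (B \ s')) := by
          rw [Set.disjoint_left]
          rintro _ ⟨y, hy, rfl⟩ ⟨z, hz, hyz⟩
          exact hz.2 (hinj (hBM hz.1) (hBM hy.1) hyz ▸ hy.2)
        have hm2 : MeasurableSet (Φ '' (B \ s')) :=
          (hBm.diff hs1).image_of_continuousOn_injOn (hΦc.mono (sdiff_subset.trans hBM))
            (hinj.mono (sdiff_subset.trans hBM))
        calc ∫⁻ x in B, ENNReal.ofReal (J x) ∂(μHE[n])
            = ∫⁻ x in B ∩ s', ENNReal.ofReal (J x) ∂(μHE[n]) +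
              ∫⁻ x in B \ s', ENNReal.ofReal (J x) ∂(μHE[n]) :=
              (lintegral_inter_add_sdiff _ B hs1).symm
          _ ≤ (μHE[n] (Φ '' (B ∩ s')) + 2 * η * μHE[n] (B ∩ s')) +
              (μHE[n] (Φ '' (B \ s')) + 2 * η * μHE[n] (B \ s')) :=
              add_le_add (hs2 _ hB1 (hBm.inter hs1)) (ht2 _ hB2 (hBm.diff hs1))
          _ = (μHE[n] (Φ '' (B ∩ s')) + μHE[n] (Φ '' (B \ s'))) +
              2 * η * (μHE[n] (B ∩ s') + μHE[n] (B \ s')) := by ring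
          _ = μHE[n] (Φ '' B) + 2 * η * μHE[n] B := by
              rw [measure_inter_add_sdiff B hs1, ← measure_union hd hm2, ← image_union,
                inter_union_sdiff]
      · intro x hx
        set m : ℝ≥0 := (J x - η).toNNReal with hm
        have hmlt : (m : ℝ≥0∞) < ENNReal.ofReal
            |((hP.proj hx).comp ((Φ' x).comp (tangentSubspace M x).subtypeL)).det| := by
          refine lt_of_lt_of_le ?_ (ENNReal.ofReal_le_ofReal (hJdet x hx))
          rw [ENNReal.ofReal, ENNReal.coe_lt_coe, hm, Real.toNNReal_lt_toNNReal_iff (hJ0 x hx)]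
          have : (0 : ℝ) < η := hη
          linarith
        obtain ⟨V, hV, hVB⟩ := hP.exists_nhds_mul_measure_le hx (hΦ x hx) hmlt
        have hJx : ∀ᶠ y in 𝓝[M] x, J y < J x + η :=
          (hJ x hx).eventually_lt continuousWithinAt_const
            (lt_add_of_pos_right _ (by exact_mod_cast hη))
        obtain ⟨V', hV', hVJ⟩ := mem_nhdsWithin_iff_exists_mem_nhds_inter.1 hJx
        obtain ⟨O, hOV, hO, hxO⟩ := _root_.mem_nhds_iff.1 (Filter.inter_mem hV hV')
        refine ⟨O, mem_nhdsWithin_of_mem_nhds (hO.mem_nhds hxO), O, Subset.rfl, hO.measurableSet,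
          fun B hB hBm => ?_⟩
        calc ∫⁻ y in B, ENNReal.ofReal (J y) ∂(μHE[n])
            ≤ ∫⁻ _ in B, (m + 2 * η : ℝ≥0∞) ∂(μHE[n]) := by
              refine setLIntegral_mono' hBm fun y hy => ?_
              have h1 : J y < J x + η := hVJ ⟨(hOV (hB hy).2).2, (hB hy).1⟩
              have h2 : (m + 2 * η : ℝ≥0∞) = ENNReal.ofReal (m + 2 * η) := by
                rw [ENNReal.ofReal_add (by positivity) (by positivity),
                  ENNReal.ofReal_mul (by norm_num)]
                simp
              rw [h2]
              refine ENNReal.ofReal_le_ofReal ?_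
              have h3 : J x - η ≤ m := Real.le_coe_toNNReal _
              linarith
          _ = m * μHE[n] B + 2 * η * μHE[n] B := by
              rw [setLIntegral_const, add_mul]
          _ ≤ _ := add_le_add_left (hVB B fun y hy => ⟨(hB hy).1, (hOV (hB hy).2).1⟩) _
    obtain ⟨s, hMs, -, hs⟩ := hloc
    exact hs M (subset_inter Subset.rfl hMs) hMm
  refine ENNReal.le_of_forall_pos_le_add fun η hη _ => ?_
  by_cases hz : μHE[n] M = 0
  · have := key η hη
    rw [hz, mul_zero, add_zero] at this
    exact this.trans le_self_add
  · set c : ℝ≥0 := (μHE[n] M).toNNReal with hc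
    have hcM : μHE[n] M = c := (ENNReal.coe_toNNReal hμM.ne).symm
    have hc0 : c ≠ 0 := fun h => hz (by rw [hcM, h]; rfl)
    have := key (η / (2 * c)) (by positivity)
    refine this.trans_eq ?_
    rw [hcM]
    congr 1
    have : 2 * (η / (2 * c)) * c = η := by field_simp
    exact_mod_cast congrArg (fun r : ℝ≥0 => (r : ℝ≥0∞)) this

end IsNormalRetraction

end Area

/-! ### Smoothness of the determinant and its derivative at the identity. -/

section Determinant

variable {E : Type*} [NormedAddCommGroup E] [InnerProductSpace ℝ E] [FiniteDimensional ℝ E]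

theorem contDiff_det : ContDiff ℝ ∞ fun A : E →L[ℝ] E => A.det := by
  let b := stdOrthonormalBasis ℝ E
  have : (fun A : E →L[ℝ] E => A.det) = fun A : E →L[ℝ] E =>
      ∑ σ : Equiv.Perm (Fin (finrank ℝ E)), (Equiv.Perm.sign σ : ℤ) •
        ∏ i, ⟪b (σ i), A (b i)⟫_ℝ := by
    ext A
    rw [ContinuousLinearMap.det, ← LinearMap.det_toMatrix b.toBasis, Matrix.det_apply]
    refine Finset.sum_congr rfl fun σ _ => ?_
    congr 1
    refine Finset.prod_congr rfl fun i _ => ?_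
    rw [LinearMap.toMatrix_apply]
    simp [b.repr_apply_apply]
  rw [this]
  refine ContDiff.sum fun σ _ => ?_
  simp only [zsmul_eq_mul]
  refine contDiff_const.mul (contDiff_prod fun i _ => ?_)
  exact contDiff_const.inner ℝ (contDiff_id.clm_apply contDiff_const)

theorem hasDerivAt_det_one_add (A : E →L[ℝ] E) :
    HasDerivAt (fun t : ℝ => (1 + t • A).det) (LinearMap.trace ℝ E A) 0 := by
  let b := (stdOrthonormalBasis ℝ E).toBasis
  have h : (fun t : ℝ => (1 + t • A).det) = fun t : ℝ =>
      1 + (LinearMap.toMatrix b b A).trace * t + Polynomial.eval t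
        (1 + (Polynomial.X : Polynomial ℝ) •
          (LinearMap.toMatrix b b A).map Polynomial.C).det.divX.divX * t ^ 2 := by
    ext t
    rw [← Matrix.det_one_add_smul, ContinuousLinearMap.det, ← LinearMap.det_toMatrix b]
    congr 1
    rw [ContinuousLinearMap.toLinearMap_add, ContinuousLinearMap.toLinearMap_smul, map_add, map_smul]
    congr 1
    exact LinearMap.toMatrix_one b
  rw [h, LinearMap.trace_eq_matrix_trace ℝ b]
  generalize (1 + (Polynomial.X : Polynomial ℝ) •
          (LinearMap.toMatrix b b A).map Polynomial.C).det.divX.divX = q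
  have h1 := (((hasDerivAt_id (0 : ℝ)).const_mul (LinearMap.toMatrix b b A).trace).const_add 1).add
    ((q.hasDerivAt 0).mul (hasDerivAt_pow 2 (0 : ℝ)))
  refine h1.congr_deriv ?_
  simp

theorem HasDerivAt.det_of_eq_one {B : ℝ → E →L[ℝ] E} {A : E →L[ℝ] E} {t : ℝ}
    (hB : HasDerivAt B A t) (h1 : B t = 1) :
    HasDerivAt (fun s => (B s).det) (LinearMap.trace ℝ E A) t := by
  have hd : HasFDerivAt (fun A : E →L[ℝ] E => A.det) (fderiv ℝ (fun A : E →L[ℝ] E => A.det) 1) 1 :=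
    (contDiff_det.differentiable (by simp) _).hasFDerivAt
  have hval := (hasDerivAt_line hd A).unique (hasDerivAt_det_one_add A)
  rw [← hval]
  rw [← h1] at hd ⊢
  exact hd.comp_hasDerivAt t hB

end Determinant

/-! ### Differentiation under the integral sign. -/

section ParametricIntegral

variable {E : Type*} [NormedAddCommGroup E] [NormedSpace ℝ E] [MeasurableSpace E] [BorelSpace E]
  [SecondCountableTopology E]

theorem ContinuousOn.integrableOn_of_isCompact_of_lt_top {X : Type*} [TopologicalSpace X]
    [T2Space X] [MeasurableSpace X] [OpensMeasurableSpace X] [SecondCountableTopology X]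
    {μ : Measure X} {M : Set X} (hM : IsCompact M) (hμ : μ M < ⊤) {f : X → ℝ}
    (hf : ContinuousOn f M) : IntegrableOn f M μ := by
  obtain ⟨C, hC⟩ := hM.exists_bound_of_continuousOn hf
  have : IsFiniteMeasure (μ.restrict M) := ⟨by rwa [Measure.restrict_apply_univ]⟩
  exact Integrable.of_bound (hf.aestronglyMeasurable hM.isClosed.measurableSet) C
    ((ae_restrict_iff' hM.isClosed.measurableSet).2 (Filter.Eventually.of_forall hC))

/-- Differentiation under the integral over a compact set of finite measure. -/
theorem hasDerivAt_setIntegral_of_contDiffOn {μ : Measure E} {M : Set E} (hM : IsCompact M)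
    (hμ : μ M < ⊤) {Ω : Set (ℝ × E)} (hΩ : IsOpen Ω) (hMΩ : ∀ x ∈ M, ((0 : ℝ), x) ∈ Ω)
    {H : ℝ × E → ℝ} (hH : ContDiffOn ℝ ∞ H Ω) :
    HasDerivAt (fun t => ∫ x in M, H (t, x) ∂μ) (∫ x in M, fderiv ℝ H (0, x) (1, 0) ∂μ) 0 := by
  have hMm : MeasurableSet M := hM.isClosed.measurableSet
  -- A uniform time interval for all points of `M`, on which the time derivative is bounded by
  -- compactness.
  obtain ⟨u, v, hu, hv, h0u, hMv, huv⟩ := generalized_tube_lemma (isCompact_singleton (x := (0 : ℝ)))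
    hM hΩ (by rintro ⟨t, x⟩ ⟨rfl, hx⟩; exact hMΩ x hx)
  obtain ⟨ε, hε, hball⟩ := Metric.nhds_basis_closedBall.mem_iff.1 (hu.mem_nhds (h0u rfl))
  have hsub : closedBall (0 : ℝ) ε ×ˢ M ⊆ Ω := (prod_mono hball hMv).trans huv
  have hfd : ContinuousOn (fun q => fderiv ℝ H q (1, 0)) Ω :=
    ((hH.continuousOn_fderiv_of_isOpen hΩ (by simp))).clm_apply continuousOn_const
  have hslice : ∀ t ∈ closedBall (0 : ℝ) ε, ∀ {f : ℝ × E → ℝ}, ContinuousOn f Ω →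
      ContinuousOn (fun x => f (t, x)) M := fun t ht f hf =>
    hf.comp (by fun_prop) fun x hx => hsub (mk_mem_prod ht hx)
  obtain ⟨C, hC⟩ := ((isCompact_closedBall (0 : ℝ) ε).prod hM).exists_bound_of_continuousOn
    (hfd.mono hsub)
  refine (hasDerivAt_integral_of_dominated_loc_of_deriv_le (μ := μ.restrict M)
    (F := fun t x => H (t, x)) (F' := fun t x => fderiv ℝ H (t, x) (1, 0)) (bound := fun _ => C)
    (closedBall_mem_nhds 0 hε) ?_ ?_ ?_ ?_ ?_ ?_).2
  · filter_upwards [closedBall_mem_nhds (0 : ℝ) hε] with t ht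
    exact (hslice t ht hH.continuousOn).aestronglyMeasurable hMm
  · exact (hslice 0 (mem_closedBall_self hε.le) hH.continuousOn).integrableOn_of_isCompact_of_lt_top
      hM hμ
  · exact (hslice 0 (mem_closedBall_self hε.le) hfd).aestronglyMeasurable hMm
  · exact (ae_restrict_iff' hMm).2 (Filter.Eventually.of_forall fun x hx t ht =>
      hC (t, x) (mk_mem_prod ht hx))
  · exact integrableOn_const hμ.ne
  · refine (ae_restrict_iff' hMm).2 (Filter.Eventually.of_forall fun x hx t ht => ?_)
    have h1 := ((hH.contDiffAt (hΩ.mem_nhds (hsub (mk_mem_prod ht hx)))).differentiableAt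
      (by simp)).hasFDerivAt
    exact h1.comp_hasDerivAt t ((hasDerivAt_id t).prodMk (hasDerivAt_const t x))

end ParametricIntegral

/-! ### The divergence theorem from the maximality of volume. -/

section Divergence

variable {E : Type*} [NormedAddCommGroup E] [InnerProductSpace ℝ E]

namespace IsNormalRetraction

variable {n : ℕ} {U M : Set E} {P : E → E} (hP : IsNormalRetraction n U M P)
include hP

/-- The endomorphism on the left preserves the tangent space and induces the identity on the
quotient. It replaces a determinant on a varying tangent space by one on the fixed space E, where
smooth dependence on the point is evident. -/
theorem det_tangential [FiniteDimensional ℝ E] {x : E} (hx : x ∈ M) (K : E →L[ℝ] E) :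
    ((fderiv ℝ P x).comp (K.comp (fderiv ℝ P x)) + 1 - fderiv ℝ P x).det =
      ((hP.proj hx).comp (K.comp (tangentSubspace M x).subtypeL)).det := by
  set e := (fderiv ℝ P x).comp (K.comp (fderiv ℝ P x)) + 1 - fderiv ℝ P x with he
  have hev : ∀ v, e v = fderiv ℝ P x (K (fderiv ℝ P x v)) + v - fderiv ℝ P x v := fun v => rfl
  have hmem := hP.fderiv_mem_tangentSubspace hx
  have hinv : tangentSubspace M x ≤ (tangentSubspace M x).comap (e : E →ₗ[ℝ] E) := fun v hv => by
    rw [Submodule.mem_comap, ContinuousLinearMap.coe_coe, hev]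
    exact sub_mem (add_mem (hmem _) hv) (hmem _)
  have h1 := LinearMap.det_eq_det_mul_det (tangentSubspace M x) (e : E →ₗ[ℝ] E) hinv
  have h2 : (tangentSubspace M x).mapQ _ (e : E →ₗ[ℝ] E) hinv = LinearMap.id := by
    refine Submodule.linearMap_qext _ (LinearMap.ext fun v => ?_)
    change Submodule.Quotient.mk (e v) = Submodule.Quotient.mk v
    rw [Submodule.Quotient.eq, hev]
    have : fderiv ℝ P x (K (fderiv ℝ P x v)) + v - fderiv ℝ P x v - v =
      fderiv ℝ P x (K (fderiv ℝ P x v)) - fderiv ℝ P x v := by abel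
    rw [this]
    exact sub_mem (hmem _) (hmem _)
  rw [h2, LinearMap.det_id, mul_one] at h1
  rw [ContinuousLinearMap.det, h1, ContinuousLinearMap.det]
  congr 1
  refine LinearMap.ext fun v => Subtype.ext ?_
  have hv := (hP.mem_tangentSubspace_iff hx).1 v.2
  change e v = fderiv ℝ P x (K v)
  rw [hev, hv]; abel

section Displacement

variable {V : Set E} {W : E → E}

omit hP in
/-- The points at which the displacement `x ↦ P (x + t W(x))` is defined. -/
def displacementDomain (U V : Set E) (W : E → E) : Set (ℝ × E) :=
  (univ ×ˢ (U ∩ V)) ∩ (fun q : ℝ × E => q.2 + q.1 • W q.2) ⁻¹' U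

omit hP in
/-- The displacement of `M` in the direction of the vector field `W`. -/
def displacement (P W : E → E) (q : ℝ × E) : E := P (q.2 + q.1 • W q.2)

omit hP in
theorem contDiffOn_displacement_aux (hW : ContDiffOn ℝ ∞ W V) :
    ContDiffOn ℝ ∞ (fun q : ℝ × E => q.2 + q.1 • W q.2) (univ ×ˢ (U ∩ V)) :=
  contDiffOn_snd.add (contDiffOn_fst.smul
    (hW.comp contDiffOn_snd fun _ hq => hq.2.2))

theorem isOpen_displacementDomain (hV : IsOpen V) (hW : ContDiffOn ℝ ∞ W V) :
    IsOpen (displacementDomain U V W) :=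
  (contDiffOn_displacement_aux hW).continuousOn.isOpen_inter_preimage
    (isOpen_univ.prod (hP.isOpen.inter hV)) hP.isOpen

theorem contDiffOn_displacement (hW : ContDiffOn ℝ ∞ W V) :
    ContDiffOn ℝ ∞ (displacement P W) (displacementDomain U V W) :=
  hP.contDiffOn.comp ((contDiffOn_displacement_aux hW).mono inter_subset_left) fun _ hq => hq.2

theorem zero_mem_displacementDomain (hMV : M ⊆ V) {x : E} (hx : x ∈ M) :
    ((0 : ℝ), x) ∈ displacementDomain U V W :=
  ⟨⟨trivial, hP.subset hx, hMV hx⟩, by simpa using hP.subset hx⟩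

omit hP in
theorem displacement_zero (x : E) : displacement P W (0, x) = P x := by simp [displacement]

end Displacement

section DisplacementDerivative

variable {V : Set E} {W : E → E} (hV : IsOpen V) (hMV : M ⊆ V) (hW : ContDiffOn ℝ ∞ W V)
include hV hMV hW

omit hMV in
theorem contDiffAt_displacement {q : ℝ × E} (hq : q ∈ displacementDomain U V W) :
    ContDiffAt ℝ ∞ (displacement P W) q :=
  (hP.contDiffOn_displacement hW).contDiffAt ((hP.isOpen_displacementDomain hV hW).mem_nhds hq)

omit hMV in
theorem hasStrictFDerivAt_displacement {t : ℝ} {x : E} (hq : (t, x) ∈ displacementDomain U V W) :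
    HasStrictFDerivAt (fun z => displacement P W (t, z))
      ((fderiv ℝ (displacement P W) (t, x)).comp (ContinuousLinearMap.inr ℝ ℝ E)) x :=
  ((hP.contDiffAt_displacement hV hW hq).hasStrictFDerivAt (by simp)).comp x
    ((hasStrictFDerivAt_const t x).prodMk (hasStrictFDerivAt_id x))

theorem fderiv_displacement_zero {x : E} (hx : x ∈ M) :
    (fderiv ℝ (displacement P W) (0, x)).comp (ContinuousLinearMap.inr ℝ ℝ E) = fderiv ℝ P x := by
  have h1 := (hP.hasStrictFDerivAt_displacement hV hW
    (hP.zero_mem_displacementDomain hMV hx)).hasFDerivAt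
  have h2 : (fun z => displacement P W (0, z)) = P := funext fun z => displacement_zero z
  rw [h2] at h1
  exact h1.unique (hP.hasFDerivAt (hP.subset hx))

/-- Along `M`, the velocity of the displacement is `W`. -/
theorem fderiv_displacement_apply {x : E} (hx : x ∈ M) (hWx : W x ∈ tangentSubspace M x) :
    fderiv ℝ (displacement P W) (0, x) (1, 0) = W x := by
  have hline : HasDerivAt (fun t : ℝ => (t, x)) (((1 : ℝ), (0 : E))) 0 :=
    (hasDerivAt_id _).prodMk (hasDerivAt_const _ x)
  have h4 := ((hP.contDiffAt_displacement hV hW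
    (hP.zero_mem_displacementDomain hMV hx)).differentiableAt
      (by simp)).hasFDerivAt.comp_hasDerivAt (0 : ℝ) hline
  have h5 := hasDerivAt_line (hP.hasFDerivAt (hP.subset hx)) (W x)
  rw [h4.unique h5, (hP.mem_tangentSubspace_iff hx).1 hWx]

theorem hasFDerivAt_fderiv_displacement {x : E} (hx : x ∈ M) :
    HasFDerivAt (fderiv ℝ (displacement P W))
      (fderiv ℝ (fderiv ℝ (displacement P W)) (0, x)) (0, x) :=
  (((hP.contDiffAt_displacement hV hW
    (hP.zero_mem_displacementDomain hMV hx)).fderiv_right (m := ∞) (by simp)).differentiableAt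
    (by simp)).hasFDerivAt

/-- By the symmetry of second derivatives this is the spatial derivative of the initial velocity.
That velocity agrees with `W` only on `M`, whence the restriction to tangent vectors. -/
theorem fderiv_fderiv_displacement_apply (hWM : ∀ x ∈ M, W x ∈ tangentSubspace M x)
    {x : E} (hx : x ∈ M) {v : E} (hv : v ∈ tangentSubspace M x) :
    fderiv ℝ (fderiv ℝ (displacement P W)) (0, x) (1, 0) (0, v) = fderiv ℝ W x v := by
  have hG2 := hP.hasFDerivAt_fderiv_displacement hV hMV hW hx
  have hpair : HasFDerivAt (fun z : E => ((0 : ℝ), z)) (ContinuousLinearMap.inr ℝ ℝ E) x :=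
    (hasFDerivAt_const (0 : ℝ) x).prodMk (hasFDerivAt_id x)
  have h8 : HasFDerivAt (fun z => fderiv ℝ (displacement P W) (0, z))
      ((fderiv ℝ (fderiv ℝ (displacement P W)) (0, x)).comp (ContinuousLinearMap.inr ℝ ℝ E)) x :=
    HasFDerivAt.comp (g := fderiv ℝ (displacement P W)) (f := fun z : E => ((0 : ℝ), z)) x hG2 hpair
  have h7 := h8.clm_apply (hasFDerivAt_const ((1 : ℝ), (0 : E)) x)
  have hWA := h7.hasFDerivWithinAt (s := M) |>.congr
    (fun y hy => (hP.fderiv_displacement_apply hV hMV hW hy (hWM y hy)).symm)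
    (hP.fderiv_displacement_apply hV hMV hW hx (hWM x hx)).symm
  have hWD : HasFDerivWithinAt W (fderiv ℝ W x) M x :=
    ((hW.contDiffAt (hV.mem_nhds (hMV hx))).differentiableAt (by simp)).hasFDerivAt.hasFDerivWithinAt
  rw [← hWA.eq_of_mem_tangentSubspace hWD hv,
    ((hP.contDiffAt_displacement hV hW (hP.zero_mem_displacementDomain hMV hx)).isSymmSndFDerivAt
      two_le_minSmoothness_infty).eq]
  simp

/-- The determinant of the differential of the displacement along the tangent spaces. -/
def distortion (P W : E → E) (q : ℝ × E) : ℝ :=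
  ((fderiv ℝ P q.2).comp (((fderiv ℝ (displacement P W) q).comp
    (ContinuousLinearMap.inr ℝ ℝ E)).comp (fderiv ℝ P q.2)) + 1 - fderiv ℝ P q.2).det

omit hMV in
theorem contDiffOn_distortion [FiniteDimensional ℝ E] :
    ContDiffOn ℝ ∞ (distortion P W) (displacementDomain U V W) := by
  have hKs : ContDiffOn ℝ ∞ (fun q => (fderiv ℝ (displacement P W) q).comp
      (ContinuousLinearMap.inr ℝ ℝ E)) (displacementDomain U V W) :=
    ((hP.contDiffOn_displacement hW).fderiv_of_isOpen (hP.isOpen_displacementDomain hV hW)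
      (m := ∞) (by simp)).clm_comp contDiffOn_const
  have hDs : ContDiffOn ℝ ∞ (fun q : ℝ × E => fderiv ℝ P q.2) (displacementDomain U V W) :=
    (hP.contDiffOn.fderiv_of_isOpen hP.isOpen (m := ∞) (by simp)).comp contDiffOn_snd
      fun q hq => hq.1.2.1
  exact contDiff_det.comp_contDiffOn
      (((hDs.clm_comp (hKs.clm_comp hDs)).add contDiffOn_const).sub hDs)

theorem tangential_fderiv_displacement_zero {x : E} (hx : x ∈ M) :
    (fderiv ℝ P x).comp (((fderiv ℝ (displacement P W) (0, x)).comp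
      (ContinuousLinearMap.inr ℝ ℝ E)).comp (fderiv ℝ P x)) + 1 - fderiv ℝ P x = 1 := by
  rw [hP.fderiv_displacement_zero hV hMV hW hx]
  ext v
  change fderiv ℝ P x (fderiv ℝ P x (fderiv ℝ P x v)) + v - fderiv ℝ P x v = v
  rw [hP.fderiv_fderiv hx, hP.fderiv_fderiv hx]; abel

theorem distortion_zero [FiniteDimensional ℝ E] {x : E} (hx : x ∈ M) :
    distortion P W (0, x) = 1 := by
  rw [distortion, hP.tangential_fderiv_displacement_zero hV hMV hW hx]
  exact LinearMap.det_id

theorem fderiv_distortion [FiniteDimensional ℝ E] (hWM : ∀ x ∈ M, W x ∈ tangentSubspace M x)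
    {x : E} (hx : x ∈ M) :
    fderiv ℝ (distortion P W) (0, x) (1, 0) = LinearMap.trace ℝ E
      ((fderiv ℝ P x).comp ((fderiv ℝ W x).comp (fderiv ℝ P x)) : E →L[ℝ] E) := by
  have hline : HasDerivAt (fun t : ℝ => (t, x)) (((1 : ℝ), (0 : E))) 0 :=
    (hasDerivAt_id _).prodMk (hasDerivAt_const _ x)
  have hq := hP.zero_mem_displacementDomain (W := W) hMV hx
  have hlhs := (((hP.contDiffOn_distortion hV hW).contDiffAt
    ((hP.isOpen_displacementDomain hV hW).mem_nhds hq)).differentiableAt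
    (by simp)).hasFDerivAt.comp_hasDerivAt (0 : ℝ) hline
  have hG2 := HasFDerivAt.comp_hasDerivAt (l := fderiv ℝ (displacement P W))
    (f := fun t : ℝ => (t, x)) (0 : ℝ)
    (hP.hasFDerivAt_fderiv_displacement hV hMV hW hx) hline
  have hKd := hG2.clm_comp (hasDerivAt_const (0 : ℝ) (ContinuousLinearMap.inr ℝ ℝ E))
  have hBd := (((hasDerivAt_const (0 : ℝ) (fderiv ℝ P x)).clm_comp
    (hKd.clm_comp (hasDerivAt_const (0 : ℝ) (fderiv ℝ P x)))).add_const 1).sub_const (fderiv ℝ P x)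
  have hdet := hBd.det_of_eq_one (hP.tangential_fderiv_displacement_zero hV hMV hW hx)
  rw [hlhs.unique hdet]
  congr 2
  ext v
  have := hP.fderiv_fderiv_displacement_apply hV hMV hW hWM hx (hP.fderiv_mem_tangentSubspace hx v)
  simp [this]

/-- Compactness of M × M reduces this to neighbourhoods of pairs. Off the diagonal continuity
separates the images. On the diagonal the displacement is close to the tangential projection, which
nearly preserves differences of points of `M`. -/
theorem eventually_injOn_displacement (hM : IsCompact M) :
    ∀ᶠ t : ℝ in 𝓝 0, InjOn (fun z => displacement P W (t, z)) M := by
  set G := displacement P W with hGdef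
  have h0 : ∀ x ∈ M, ((0 : ℝ), x) ∈ displacementDomain U V W :=
    fun x hx => hP.zero_mem_displacementDomain hMV hx
  have hGd : ∀ x ∈ M, ContDiffAt ℝ ∞ G (0, x) := fun x hx =>
    hP.contDiffAt_displacement hV hW (h0 x hx)
  have hev2 : ∀ᶠ t : ℝ in 𝓝 0, ∀ p ∈ M ×ˢ M, p.1 ∈ M → p.2 ∈ M → G (t, p.1) = G (t, p.2) →
      p.1 = p.2 := by
    refine (hM.prod hM).eventually_forall_of_forall_eventually ?_
    rintro ⟨x, y⟩ ⟨hx, hy⟩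
    by_cases hxy : x = y
    · subst hxy
      obtain ⟨V₁, hV₁, hflat⟩ := hP.exists_nhds_norm_sub_le hx (ε := 1 / 4) (by norm_num)
      obtain ⟨V₂, hV₂, happ⟩ := ((hGd x hx).hasStrictFDerivAt
        (by simp)).approximates_deriv_on_nhds (c := 1 / 4) (Or.inr (by norm_num))
      have c1 : Filter.Tendsto (fun z : ℝ × E × E => (z.1, z.2.1)) (𝓝 (0, x, x)) (𝓝 (0, x)) :=
        Continuous.tendsto' (by fun_prop) _ _ rfl
      have c2 : Filter.Tendsto (fun z : ℝ × E × E => (z.1, z.2.2)) (𝓝 (0, x, x)) (𝓝 (0, x)) :=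
        Continuous.tendsto' (by fun_prop) _ _ rfl
      have c3 : Filter.Tendsto (fun z : ℝ × E × E => z.2.1) (𝓝 (0, x, x)) (𝓝 x) :=
        Continuous.tendsto' (by fun_prop) _ _ rfl
      have c4 : Filter.Tendsto (fun z : ℝ × E × E => z.2.2) (𝓝 (0, x, x)) (𝓝 x) :=
        Continuous.tendsto' (by fun_prop) _ _ rfl
      filter_upwards [c1 hV₂, c2 hV₂, c3 hV₁, c4 hV₁] with ⟨t, y, z⟩ h1 h2 h3 h4 hyM hzM heq
      have e1 := hflat y ⟨hyM, h3⟩ z ⟨hzM, h4⟩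
      have e2 := happ (t, y) h1 (t, z) h2
      have e3 : fderiv ℝ G (0, x) ((t, y) - (t, z)) = fderiv ℝ P x (y - z) := by
        have : ((t, y) - (t, z) : ℝ × E) = ContinuousLinearMap.inr ℝ ℝ E (y - z) := by simp
        rw [this, ← hP.fderiv_displacement_zero hV hMV hW hx]; rfl
      have e4 : ‖((t, y) - (t, z) : ℝ × E)‖ = ‖y - z‖ := by simp [Prod.norm_def]
      rw [e3, e4, heq, sub_self, zero_sub, norm_neg] at e2
      have e5 : ‖y - z‖ ≤ ‖(y - z) - fderiv ℝ P x (y - z)‖ + ‖fderiv ℝ P x (y - z)‖ := by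
        simpa using norm_add_le ((y - z) - fderiv ℝ P x (y - z)) (fderiv ℝ P x (y - z))
      have e6 : ((1 / 4 : ℝ≥0) : ℝ) = 1 / 4 := by norm_num
      rw [e6] at e1 e2
      -- The two errors add up to at most half of the distance.
      have : ‖y - z‖ ≤ 0 := by linarith [norm_nonneg (y - z)]
      exact sub_eq_zero.1 (norm_le_zero_iff.1 this)
    · have c1 : ContinuousAt (fun z : ℝ × E × E => G (z.1, z.2.1)) (0, x, y) :=
        ContinuousAt.comp (g := G) (f := fun z : ℝ × E × E => (z.1, z.2.1))
          (hGd x hx).continuousAt (by fun_prop)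
      have c2 : ContinuousAt (fun z : ℝ × E × E => G (z.1, z.2.2)) (0, x, y) :=
        ContinuousAt.comp (g := G) (f := fun z : ℝ × E × E => (z.1, z.2.2))
          (hGd y hy).continuousAt (by fun_prop)
      have hne : G (0, x) ≠ G (0, y) := by
        rw [hGdef, displacement_zero, displacement_zero, hP.eq_self x hx, hP.eq_self y hy]
        exact hxy
      filter_upwards [(c1.prodMk c2).eventually (isOpen_ne_fun continuous_fst continuous_snd |>.mem_nhds hne)] with z hz _ _ heq using absurd heq hz
  filter_upwards [hev2] with t ht2
  exact fun y hy z hz h => ht2 (y, z) ⟨hy, hz⟩ hy hz h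

end DisplacementDerivative

variable [FiniteDimensional ℝ E] [MeasurableSpace E] [BorelSpace E]

/-- The divergence theorem on the closed submanifold `M`. -/
theorem integral_trace_eq_zero (hM : IsCompact M) {V : Set E} (hV : IsOpen V) (hMV : M ⊆ V)
    {W : E → E} (hW : ContDiffOn ℝ ∞ W V) (hWM : ∀ x ∈ M, W x ∈ tangentSubspace M x) :
    ∫ x in M, LinearMap.trace ℝ E
      ((fderiv ℝ P x).comp ((fderiv ℝ W x).comp (fderiv ℝ P x)) : E →L[ℝ] E) ∂(μHE[n]) = 0 := by
  have hMm : MeasurableSet M := hM.isClosed.measurableSet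
  have hμ := hP.measure_lt_top hM
  have hΩ := hP.isOpen_displacementDomain hV hW
  have h0 : ∀ x ∈ M, ((0 : ℝ), x) ∈ displacementDomain U V W :=
    fun x hx => hP.zero_mem_displacementDomain hMV hx
  have hJs := hP.contDiffOn_distortion hV hW
  have hI := hasDerivAt_setIntegral_of_contDiffOn hM hμ hΩ h0 hJs
  rw [setIntegral_congr_fun hMm fun x hx => hP.fderiv_distortion hV hMV hW hWM hx] at hI
  -- The integrated Jacobian bounds from below the area of an image contained in `M`; it is
  -- therefore at most the area of `M`, its value at time 0.
  refine IsLocalMax.hasDerivAt_eq_zero ?_ hI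
  have hev1 : ∀ᶠ t : ℝ in 𝓝 0, ∀ x ∈ M, (t, x) ∈ displacementDomain U V W ∧
      0 < distortion P W (t, x) := by
    refine hM.eventually_forall_of_forall_eventually fun x hx => ?_
    have h1 : ContinuousAt (distortion P W) (0, x) :=
      hJs.continuousOn.continuousAt (hΩ.mem_nhds (h0 x hx))
    exact (hΩ.eventually_mem (h0 x hx)).and (continuousAt_const.eventually_lt h1
      (by rw [hP.distortion_zero hV hMV hW hx]; norm_num))
  filter_upwards [hev1, hP.eventually_injOn_displacement hV hMV hW hM] with t ht1 hinj
  have hJt : ContinuousOn (fun x => distortion P W (t, x)) M :=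
    hJs.continuousOn.comp (by fun_prop) fun x hx => (ht1 x hx).1
  have harea := hP.lintegral_det_le_measure_image hM
    (fun x hx => hP.hasStrictFDerivAt_displacement hV hW (ht1 x hx).1) hinj hJt
    (fun x hx => (ht1 x hx).2) (fun x hx => by
      rw [← hP.det_tangential hx]
      exact le_abs_self _)
  have himage : (fun z => displacement P W (t, z)) '' M ⊆ M := by
    rintro _ ⟨z, hz, rfl⟩
    exact hP.mapsTo (ht1 z hz).1.2
  have hle := harea.trans (measure_mono himage)
  have h1 : ∫ x in M, distortion P W (0, x) ∂(μHE[n]) = (μHE[n] M).toReal := by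
    rw [setIntegral_congr_fun hMm (g := fun _ => (1 : ℝ))
      fun x hx => hP.distortion_zero hV hMV hW hx]
    simp [Measure.real]
  rw [h1, integral_eq_lintegral_of_nonneg_ae
    ((ae_restrict_iff' hMm).2 (Filter.Eventually.of_forall fun x hx => (ht1 x hx).2.le))
    (hJt.aestronglyMeasurable hMm)]
  exact ENNReal.toReal_mono hμ.ne hle

end IsNormalRetraction

end Divergence

/-! ### Submanifolds as zero sets of submersions. -/

section Submersions

variable {E : Type*} [NormedAddCommGroup E] [InnerProductSpace ℝ E] [FiniteDimensional ℝ E]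

-- A right inverse of `A x`, kept fixed, makes the composite invertible for nearby parameters, since
-- units form an open set.
omit [FiniteDimensional ℝ E] in
theorem eventually_surjective {G : Type*} [NormedAddCommGroup G] [NormedSpace ℝ G]
    [FiniteDimensional ℝ G] {X : Type*} [TopologicalSpace X] {A : X → E →L[ℝ] G} {x : X}
    (hA : ContinuousAt A x) (hs : Function.Surjective (A x)) :
    ∀ᶠ y in 𝓝 x, Function.Surjective (A y) := by
  have : CompleteSpace G := FiniteDimensional.complete ℝ G
  obtain ⟨R, hR⟩ := (A x : E →ₗ[ℝ] G).exists_rightInverse_of_surjective (LinearMap.range_eq_top.2 hs)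
  let R' : G →L[ℝ] E := LinearMap.toContinuousLinearMap R
  have h1 : ContinuousAt (fun y => (A y).comp R') x := hA.clm_comp continuousAt_const
  have h2 : (A x).comp R' = 1 := by
    ext v; exact congrArg (fun L : G →ₗ[ℝ] G => L v) hR
  have h3 : IsUnit ((A x).comp R') := h2 ▸ isUnit_one
  filter_upwards [h1.eventually (Units.isOpen.mem_nhds h3)] with y hy
  obtain ⟨u, hu⟩ := hy
  intro v
  refine ⟨R' (((u⁻¹ : (G →L[ℝ] G)ˣ) : G →L[ℝ] G) v), ?_⟩
  have : (A y).comp R' * (u⁻¹ : (G →L[ℝ] G)ˣ) = 1 := by rw [← hu]; exact u.mul_inv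
  exact congrArg (fun L : G →L[ℝ] G => L v) this

omit [FiniteDimensional ℝ E] in
theorem IsSubmanifoldNear.congr {k : ℕ} {N N' : Set E} {y : E} (h : IsSubmanifoldNear k N y)
    (hNN' : ∀ᶠ z in 𝓝 y, z ∈ N ↔ z ∈ N') : IsSubmanifoldNear k N' y := by
  obtain ⟨r, hr, U, g, hU, hyU, hg, hs, hNU⟩ := h
  obtain ⟨O, hO, hOo, hyO⟩ := _root_.mem_nhds_iff.1 hNN'
  refine ⟨r, hr, U ∩ O, g, hU.inter hOo, ⟨hyU, hyO⟩, hg.mono inter_subset_left,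
    fun z hz => hs z hz.1, ?_⟩
  ext z
  have h1 : z ∈ N ∩ U ↔ z ∈ {z ∈ U | g z = 0} := by rw [hNU]
  constructor
  · rintro ⟨hz, hzU, hzO⟩
    exact ⟨⟨hzU, hzO⟩, (h1.1 ⟨(hO hzO).2 hz, hzU⟩).2⟩
  · rintro ⟨⟨hzU, hzO⟩, hgz⟩
    exact ⟨(hO hzO).1 (h1.2 ⟨hzU, hgz⟩).1, hzU, hzO⟩

/-- A submanifold is cut out near `y` by a map with values in a linear subspace `S`. -/
theorem isSubmanifoldNear_of_submersion {N : Set E} {y : E} (S : Submodule ℝ E) {g : E → E}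
    (hg : ∀ᶠ z in 𝓝 y, ContDiffAt ℝ ∞ g z) (hgS : ∀ z, g z ∈ S)
    (hsurj : ∀ v ∈ S, ∃ u, fderiv ℝ g y u = v) (hN : ∀ᶠ z in 𝓝 y, z ∈ N ↔ g z = 0) :
    IsSubmanifoldNear (finrank ℝ E - finrank ℝ S) N y := by
  let e := (stdOrthonormalBasis ℝ S).repr
  -- Coordinates on `S` after orthogonal projection. As `g` takes its values in `S`, nothing of its
  -- zero set is lost.
  let Q : E →L[ℝ] EuclideanSpace ℝ (Fin (finrank ℝ S)) :=
    e.toContinuousLinearEquiv.toContinuousLinearMap.comp S.orthogonalProjectionOnto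
  have hQ : ∀ v ∈ S, Q v = 0 → v = 0 := by
    intro v hv h
    have h1 : S.orthogonalProjectionOnto v = 0 := e.map_eq_zero_iff.1 h
    have h2 := Submodule.orthogonalProjectionOnto_mem_subspace_eq_self (⟨v, hv⟩ : S)
    rw [h1] at h2
    exact (congrArg Subtype.val h2).symm
  have hQs : ∀ v, ∃ u ∈ S, Q u = v := by
    intro v
    refine ⟨(e.symm v : S), (e.symm v).2, ?_⟩
    change e (S.orthogonalProjectionOnto ((e.symm v : S) : E)) = v
    rw [Submodule.orthogonalProjectionOnto_mem_subspace_eq_self, e.apply_symm_apply]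
  have hy := hg.self_of_nhds
  have hder : ∀ z, ContDiffAt ℝ ∞ g z → fderiv ℝ (fun z => Q (g z)) z = Q.comp (fderiv ℝ g z) :=
    fun z hz => (Q.hasFDerivAt.comp z (hz.differentiableAt (by simp)).hasFDerivAt).fderiv
  have hcont : ContinuousAt (fun z => Q.comp (fderiv ℝ g z)) y :=
    continuousAt_const.clm_comp (hy.continuousAt_fderiv (by simp))
  have hsy : Function.Surjective (Q.comp (fderiv ℝ g y)) := by
    intro v
    obtain ⟨u, hu, huv⟩ := hQs v
    obtain ⟨u', hu'⟩ := hsurj u hu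
    exact ⟨u', by rw [ContinuousLinearMap.comp_apply, hu', huv]⟩
  have hev := hg.and ((eventually_surjective hcont hsy).and hN)
  obtain ⟨O, hO, hOo, hyO⟩ := _root_.mem_nhds_iff.1 hev
  refine ⟨finrank ℝ S, (Nat.sub_add_cancel S.finrank_le).symm, O,
    fun z => Q (g z), hOo, hyO, ?_, ?_, ?_⟩
  · exact fun z hz => (Q.contDiff.contDiffAt.comp z (hO hz).1).contDiffWithinAt
  · intro z hz
    rw [hder z (hO hz).1]
    exact (hO hz).2.1
  · ext z
    constructor
    · rintro ⟨hzN, hzO⟩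
      exact ⟨hzO, by change Q (g z) = 0; rw [(hO hzO).2.2.1 hzN, map_zero]⟩
    · rintro ⟨hzO, hz⟩
      exact ⟨(hO hzO).2.2.2 (hQ _ (hgS z) hz), hzO⟩

end Submersions

/-! ### Focal points, critical points and the structure of the focal set. -/

section Focal

variable {E : Type*} [NormedAddCommGroup E] [InnerProductSpace ℝ E] [FiniteDimensional ℝ E]
  [CompleteSpace E]

namespace IsConicalTransnormal

variable {F : E → ℝ} {b : ℝ → ℝ} (hF : IsConicalTransnormal F b)
include hF

omit [FiniteDimensional ℝ E] in
theorem continuousAt_deriv_comp {y : E} (hy : y ≠ 0) :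
    ContinuousAt (fun z => deriv b (F z)) y :=
  ContinuousAt.comp (g := deriv b) (hF.contDiff.continuous_deriv (by simp)).continuousAt
    (hF.contDiffAt y hy).continuousAt

/-- The critical set in the unit sphere is a submanifold near nondegenerate points. -/
theorem isSubmanifoldNear_critical {y : E} (hy : ‖y‖ = 1) (h0 : gradient F y = 0)
    (hb : deriv b (F y) ≠ 0) :
    ∃ k, IsSubmanifoldNear k {z | ‖z‖ = 1 ∧ gradient F z = 0} y := by
  have hy0 := ne_zero_of_norm_eq_one hy
  set H := hess F y with hH
  set l := deriv b (F y) / 2 with hl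
  have hl0 : l ≠ 0 := div_ne_zero hb two_ne_zero
  have hHH : ∀ v, H (H v) = l • H v := hF.hess_hess_of_gradient_eq_zero hy h0
  have hHy : H y = 0 := by rw [hH, hF.hess_self hy0, h0, neg_zero]
  have hyH : ∀ v, ⟪H v, y⟫_ℝ = 0 := fun v => by
    rw [hess_symm (hF.contDiffAt y hy0), ← hH, hHy, inner_zero_right]
  -- The gradient alone is not a submersion onto its target; composing it with the Hessian at y
  -- keeps only the normal directions. The image of H is orthogonal to y, so the second term encodes
  -- the sphere independently.
  set g : E → E := fun z => H (gradient F z) + (‖z‖ ^ 2 - 1) • y with hg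
  have hgs : ∀ z, z ≠ 0 → ContDiffAt ℝ ∞ g z := fun z hz =>
    (H.contDiff.contDiffAt.comp z (hF.contDiffAt z hz).gradient_infty).add
      (((contDiff_norm_sq ℝ).contDiffAt.sub contDiffAt_const).smul contDiffAt_const)
  have hgd : ∀ v, fderiv ℝ g y v = l • H v + (2 * ⟪y, v⟫_ℝ) • y := by
    intro v
    have h1 : HasFDerivAt (fun z => H (gradient F z)) (H.comp H) y :=
      H.hasFDerivAt.comp y (hF.contDiffAt y hy0).hasFDerivAt_gradient
    have h2 := ((hasStrictFDerivAt_norm_sq y).hasFDerivAt.sub_const 1).smul_const y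
    have h3 : HasFDerivAt g _ y := h1.add h2
    rw [h3.fderiv]
    simp [hHH]
  have hzero : ∀ z, g z = 0 ↔ H (gradient F z) = 0 ∧ ‖z‖ ^ 2 = 1 := by
    intro z
    constructor
    · intro hz
      have h1 := congrArg (fun u => ⟪u, y⟫_ℝ) hz
      simp only [hg, inner_add_left, hyH, inner_smul_left, real_inner_self_eq_norm_sq, hy,
        inner_zero_left] at h1
      have h2 : ‖z‖ ^ 2 = 1 := by simpa [sub_eq_zero] using h1
      refine ⟨?_, h2⟩
      simpa [hg, h2] using hz
    · rintro ⟨h1, h2⟩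
      simp [hg, h1, h2]
  let L : E →ₗ[ℝ] E := (fderiv ℝ g y : E →ₗ[ℝ] E)
  have hHS : ∀ v, H v ∈ LinearMap.range L := fun v => by
    refine ⟨(l⁻¹ ^ 2) • H v, ?_⟩
    change fderiv ℝ g y _ = _
    rw [hgd, _root_.map_smul, hHH, inner_smul_right, real_inner_comm, hyH, smul_smul, smul_smul]
    have : l * (l ^ 2)⁻¹ * l = 1 := by field_simp
    simp [this]
  have hyS : y ∈ LinearMap.range L := by
    refine ⟨(1 / 2 : ℝ) • y, ?_⟩
    change fderiv ℝ g y _ = _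
    rw [hgd, _root_.map_smul, hHy, inner_smul_right, real_inner_self_eq_norm_sq, hy]
    simp
  refine ⟨_, isSubmanifoldNear_of_submersion (LinearMap.range L)
    ((eventually_ne_zero hy0).mono hgs) (fun z => ?_) (fun v hv => hv) ?_⟩
  · exact add_mem (hHS _) (Submodule.smul_mem _ _ hyS)
  · have hc1 : ContinuousAt (fun z => ‖hess F z - H‖) y :=
      ((hF.contDiffAt y hy0).hess_infty.continuousAt.sub continuousAt_const).norm
    have hc2 : ContinuousAt (fun z => |deriv b (F z) / 2|) y :=
      ((hF.continuousAt_deriv_comp hy0).div_const 2).abs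
    have hlt : ∀ᶠ z in 𝓝 y, ‖hess F z - H‖ < |deriv b (F z) / 2| :=
      hc1.eventually_lt hc2 (by
        rw [← hH, sub_self, norm_zero]; exact abs_pos.2 hl0)
    filter_upwards [hlt] with z hz
    rw [hzero]
    constructor
    · rintro ⟨h1, h2⟩
      exact ⟨by rw [h2, map_zero], by rw [h1, one_pow]⟩
    · rintro ⟨h1, h2⟩
      have hz1 : ‖z‖ = 1 := by rwa [pow_eq_one_iff_of_nonneg (norm_nonneg _) two_ne_zero] at h2
      refine ⟨hz1, ?_⟩
      by_contra hne
      set v := gradient F z with hv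
      have h3 := hF.hess_gradient hz1
      -- A gradient v killed by H must vanish: the Hessian at z has quadratic form (b'/2)|v|² on v,
      -- while it differs from H by less than |b'/2|.
      have h4 : ⟪hess F z v, v⟫_ℝ = deriv b (F z) / 2 * ‖v‖ ^ 2 := by
        rw [h3, inner_sub_left, inner_smul_left, inner_smul_left, real_inner_self_eq_norm_sq,
          real_inner_comm, hF.inner_gradient_self (ne_zero_of_norm_eq_one hz1)]
        simp [hv]
      have h5 : ⟪hess F z v, v⟫_ℝ = ⟪(hess F z - H) v, v⟫_ℝ := by
        rw [sub_apply, h1, sub_zero]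
      have h6 : |⟪(hess F z - H) v, v⟫_ℝ| ≤ ‖hess F z - H‖ * ‖v‖ ^ 2 := by
        refine (abs_real_inner_le_norm _ _).trans ?_
        rw [sq, ← mul_assoc]
        exact mul_le_mul_of_nonneg_right (ContinuousLinearMap.le_opNorm _ _) (norm_nonneg _)
      rw [← h5, h4, abs_mul, abs_of_nonneg (sq_nonneg ‖v‖)] at h6
      have h7 : 0 < ‖v‖ ^ 2 := pow_pos (norm_pos_iff.2 hne) 2
      exact absurd (le_of_mul_le_mul_right h6 h7) (not_le.2 hz)

end IsConicalTransnormal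

/-- The intersection of a level set with the unit sphere. -/
def sphereLevel (F : E → ℝ) (c : ℝ) : Set E := {x | ‖x‖ = 1 ∧ F x = c}

/-- A smooth field of unit vectors along `sphereLevel F c` in the direction of the gradient. -/
structure IsGradientNormal (F : E → ℝ) (c : ℝ) (ξ : E → E) : Prop where
  contDiffOn : ContDiffOn ℝ ∞ ξ (sphereLevel F c)
  norm_eq_one : ∀ x ∈ sphereLevel F c, ‖ξ x‖ = 1
  gradient_eq : ∀ x ∈ sphereLevel F c, gradient F x = ⟪gradient F x, ξ x⟫_ℝ • ξ x

namespace IsGradientNormal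

variable {F : E → ℝ} {b : ℝ → ℝ} {c : ℝ} {ξ : E → E} (hξ : IsGradientNormal F c ξ)
  (hF : IsConicalTransnormal F b) (hb : 0 < b c)
include hξ hF hb

omit [FiniteDimensional ℝ E]

omit hb in
theorem inner_sq {x : E} (hx : x ∈ sphereLevel F c) : ⟪gradient F x, ξ x⟫_ℝ ^ 2 = b c := by
  rw [← hx.2, ← hF.norm_gradient x hx.1]
  conv_rhs => rw [hξ.gradient_eq x hx, norm_smul, hξ.norm_eq_one x hx, mul_one, Real.norm_eq_abs,
    sq_abs]

theorem inner_ne_zero {x : E} (hx : x ∈ sphereLevel F c) : ⟪gradient F x, ξ x⟫_ℝ ≠ 0 := by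
  intro h
  have := hξ.inner_sq hF hx
  rw [h] at this
  simp only [ne_eq, OfNat.ofNat_ne_zero, not_false_eq_true, zero_pow] at this
  exact hb.ne this

theorem isGradientDirection {x : E} (hx : x ∈ sphereLevel F c) :
    IsGradientDirection F b x (ξ x) :=
  hF.isGradientDirection_of_gradient_ne_zero hx.1 (hξ.norm_eq_one x hx)
    (hξ.inner_ne_zero hF hb hx) (hξ.gradient_eq x hx)

/-- The orientation of the unit normal field with respect to the gradient is locally constant. -/
theorem eventually_inner_eq {x : E} (hx : x ∈ sphereLevel F c) :
    ∀ᶠ y in 𝓝 x, y ∈ sphereLevel F c → ⟪gradient F y, ξ y⟫_ℝ = ⟪gradient F x, ξ x⟫_ℝ := by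
  rw [← eventually_nhdsWithin_iff]
  have hc : ContinuousWithinAt (fun y => ⟪gradient F y, ξ y⟫_ℝ) (sphereLevel F c) x :=
    ((hF.contDiffAt x (IsConicalTransnormal.ne_zero_of_norm_eq_one
      hx.1)).gradient_infty.continuousAt.continuousWithinAt).inner
      (𝕜 := ℝ) (hξ.contDiffOn.continuousOn x hx)
  have hne := hξ.inner_ne_zero hF hb hx
  set k := ⟪gradient F x, ξ x⟫_ℝ with hk
  -- The square is constant on the level set, so only the values k and -k occur, and continuity
  -- excludes the latter.
  have hev : ∀ᶠ y in 𝓝[sphereLevel F c] x, ⟪gradient F y, ξ y⟫_ℝ ≠ -k :=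
    hc.eventually_ne (by change k ≠ -k; intro h; apply hne; linarith)
  filter_upwards [hev, self_mem_nhdsWithin] with y hy hyM
  have := (hξ.inner_sq hF hyM).trans (hξ.inner_sq hF hx).symm
  exact (sq_eq_sq_iff_eq_or_eq_neg.1 this).resolve_right hy

theorem isGradientDirection_focal {x : E} (hx : x ∈ sphereLevel F c) (θ : ℝ) :
    IsGradientDirection F b (greatCircle x (ξ x) θ) (greatCircleVel x (ξ x) θ) :=
  hF.isGradientDirection_greatCircle (hξ.isGradientDirection hF hb hx) θ

/-- Focal points are critical points. -/
theorem gradient_focal_eq_zero {θ : ℝ} (hθ : Real.sin θ ≠ 0) {x : E} (hx : x ∈ sphereLevel F c)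
    {X : E} (hX : X ∈ tangentSubspace (sphereLevel F c) x) (hX0 : X ≠ 0)
    (heig : -(fderivWithin ℝ ξ (sphereLevel F c) x X) = Real.cot θ • X) :
    gradient F (greatCircle x (ξ x) θ) = 0 := by
  by_contra hne
  have hdir := hξ.isGradientDirection_focal hF hb hx θ
  set κ := ⟪gradient F (greatCircle x (ξ x) θ), greatCircleVel x (ξ x) θ⟫_ℝ with hκ
  have hκ0 : κ ≠ 0 := fun h => hne (by rw [hdir.gradient_eq, ← hκ, h, zero_smul])
  -- If the focal point were not critical, the velocity of the circle there would be κ⁻¹∇F with the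
  -- same κ for all nearby starting points. Going back along the circle is then a smooth left
  -- inverse of the focal map.
  have hleft : ∀ᶠ y in 𝓝[sphereLevel F c] x,
      Real.cos θ • greatCircle y (ξ y) θ -
        Real.sin θ • κ⁻¹ • gradient F (greatCircle y (ξ y) θ) = y := by
    filter_upwards [nhdsWithin_le_nhds (hξ.eventually_inner_eq hF hb hx), self_mem_nhdsWithin]
      with y hy hyM
    have h1 := (hF.comp_greatCircle_unique (hξ.isGradientDirection hF hb hyM)
      (hξ.isGradientDirection hF hb hx) (hyM.2.trans hx.2.symm) (hy hyM) θ).2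
    rw [(hξ.isGradientDirection_focal hF hb hyM θ).gradient_eq, h1, ← hκ, smul_smul κ⁻¹,
      inv_mul_cancel₀ hκ0, one_smul]
    have h2 := greatCircle_add y (ξ y) θ (-θ)
    rw [add_neg_cancel, greatCircle_zero] at h2
    conv_rhs => rw [← h2]
    simp only [greatCircle, greatCircleVel, Real.cos_neg, Real.sin_neg]
    module
  have hξd : HasFDerivWithinAt ξ (fderivWithin ℝ ξ (sphereLevel F c) x) (sphereLevel F c) x :=
    ((hξ.contDiffOn x hx).differentiableWithinAt (by simp)).hasFDerivWithinAt
  have hφ : HasFDerivWithinAt (fun y => greatCircle y (ξ y) θ)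
      (Real.cos θ • ContinuousLinearMap.id ℝ E +
        Real.sin θ • fderivWithin ℝ ξ (sphereLevel F c) x) (sphereLevel F c) x :=
    ((hasFDerivWithinAt_id x _).const_smul (Real.cos θ)).add (hξd.const_smul (Real.sin θ))
  have hQ := (((hasFDerivAt_id (greatCircle x (ξ x) θ)).const_smul (Real.cos θ)).sub
    (((hF.contDiffAt _ (IsConicalTransnormal.ne_zero_of_norm_eq_one hdir.norm_base)).hasFDerivAt_gradient.const_smul
      κ⁻¹).const_smul (Real.sin θ)))
  have hcomp := hQ.comp_hasFDerivWithinAt x hφ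
  have hid : HasFDerivWithinAt id (ContinuousLinearMap.id ℝ E) (sphereLevel F c) x :=
    hasFDerivWithinAt_id x _
  have hid' := hid.congr_of_eventuallyEq (f₁ := fun y => Real.cos θ • greatCircle y (ξ y) θ -
        Real.sin θ • κ⁻¹ • gradient F (greatCircle y (ξ y) θ)) hleft
    (hleft.self_of_nhdsWithin hx)
  have h3 := hid'.eq_of_mem_tangentSubspace hcomp hX
  apply hX0
  have h4 : fderivWithin ℝ ξ (sphereLevel F c) x X = -(Real.cot θ • X) := by rw [← heig, neg_neg]
  -- The focal map kills the principal vector: cos θ - sin θ cot θ = 0.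
  have h5 : (Real.cos θ • ContinuousLinearMap.id ℝ E +
        Real.sin θ • fderivWithin ℝ ξ (sphereLevel F c) x) X = 0 := by
    simp only [add_apply, smul_apply, ContinuousLinearMap.id_apply, h4, smul_neg, smul_smul]
    rw [Real.cot_eq_cos_div_sin, mul_div_cancel₀ _ hθ, add_neg_cancel]
  rw [ContinuousLinearMap.comp_apply, h5, map_zero] at h3
  exact h3

/-- Near a focal point, the critical set is contained in the focal set. -/
theorem eventually_mem_focal {θ : ℝ} {x : E} (hx : x ∈ sphereLevel F c)
    (h0 : gradient F (greatCircle x (ξ x) θ) = 0) :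
    ∀ᶠ z in 𝓝 (greatCircle x (ξ x) θ), ‖z‖ = 1 ∧ gradient F z = 0 →
      z ∈ (fun x => greatCircle x (ξ x) θ) '' sphereLevel F c := by
  have hdir := hξ.isGradientDirection_focal hF hb hx θ
  have hloc := hξ.eventually_inner_eq hF hb hx
  have hkx := hξ.inner_sq hF hx
  set y := greatCircle x (ξ x) θ with hy
  set w := greatCircleVel x (ξ x) θ with hw
  have hy0 := IsConicalTransnormal.ne_zero_of_norm_eq_one hdir.norm_base
  have hby : deriv b (F y) ≠ 0 := hdir.nondegenerate.resolve_left (by simp [h0])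
  set l := deriv b (F y) / 2 with hl
  have hl0 : l ≠ 0 := div_ne_zero hby two_ne_zero
  have hHw : hess F y w = l • w := by rw [hdir.hess_eq, h0]; simp [hl]
  -- At a critical z near y the Hessian has square b'/2 times itself, so every vector in its image
  -- is an eigenvector. Applying it to w and normalizing yields an eigendirection at z close to w.
  set h : E → E := fun z => l⁻¹ • hess F z w with hh
  have hhy : h y = w := by simp only [hh, hHw, smul_smul, inv_mul_cancel₀ hl0, one_smul]
  have hhc : ContinuousAt h y :=
    ((hF.contDiffAt y hy0).hess_infty.continuousAt.clm_apply continuousAt_const).const_smul _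
  set v : E → E := fun z => ‖h z‖⁻¹ • h z with hv
  have hvc : ContinuousAt v y :=
    (hhc.norm.inv₀ (by rw [hhy, hdir.norm_dir]; exact one_ne_zero)).smul hhc
  have hvy : v y = w := by simp only [hv, hhy, hdir.norm_dir, inv_one, one_smul]
  have hback : greatCircle y w (-θ) = x := by
    rw [hy, hw, greatCircle_add]; simp
  have hbackv : greatCircleVel y w (-θ) = ξ x := by
    rw [hy, hw, greatCircleVel_add]; simp
  have hgc : ContinuousAt (fun z => greatCircle z (v z) (-θ)) y :=
    (continuousAt_id.const_smul _).add (hvc.const_smul _)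
  have e1 : ∀ᶠ z in 𝓝 y, h z ≠ 0 :=
    hhc.eventually_ne (by rw [hhy]; exact IsConicalTransnormal.ne_zero_of_norm_eq_one hdir.norm_dir)
  have e2 : ∀ᶠ z in 𝓝 y, deriv b (F z) ≠ 0 := (hF.continuousAt_deriv_comp hy0).eventually_ne hby
  have hby0 : b (F y) = 0 := by rw [← hF.norm_gradient y hdir.norm_base, h0]; simp
  -- Since b' ≠ 0 at F(y), the zero of b is isolated; nearby critical points have the same critical
  -- value as y.
  have e3 : ∀ᶠ z in 𝓝 y, F z ≠ F y → b (F z) ≠ 0 := by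
    have h1 := ((hF.contDiff.differentiable (by simp) (F y)).hasDerivAt).eventually_ne hby (c := 0)
    rw [eventually_nhdsWithin_iff] at h1
    exact (hF.contDiffAt y hy0).continuousAt.eventually h1
  have e4 : ∀ᶠ z in 𝓝 y, greatCircle z (v z) (-θ) ∈ sphereLevel F c →
      ⟪gradient F (greatCircle z (v z) (-θ)), ξ (greatCircle z (v z) (-θ))⟫_ℝ =
        ⟪gradient F x, ξ x⟫_ℝ := by
    have : greatCircle y (v y) (-θ) = x := by rw [hvy, hback]
    have h1 : Filter.Tendsto (fun z => greatCircle z (v z) (-θ)) (𝓝 y)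
        (𝓝 (greatCircle y (v y) (-θ))) := hgc
    rw [this] at h1
    exact h1.eventually hloc
  filter_upwards [e1, e2, e3, e4] with z hz1 hz2 hz3 hz4
  rintro ⟨hzn, hzg⟩
  have hbz : b (F z) = 0 := by rw [← hF.norm_gradient z hzn, hzg]; simp
  have hFz : F z = F y := by
    by_contra hne
    exact hz3 hne hbz
  have hvz : ‖v z‖ = 1 := by
    simp only [hv]
    rw [norm_smul, norm_inv, norm_norm, inv_mul_cancel₀ (norm_ne_zero_iff.2 hz1)]
  have hzdir : IsGradientDirection F b z (v z) := by
    refine hF.isGradientDirection_of_gradient_eq_zero hzn hvz hzg hz2 ?_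
    simp only [hv, hh, _root_.map_smul]
    rw [hF.hess_hess_of_gradient_eq_zero hzn hzg]
    module
  have huniq := hF.comp_greatCircle_unique hzdir hdir hFz (by rw [hzg, h0]; simp) (-θ)
  rw [hback, hbackv] at huniq
  have hdir' := hF.isGradientDirection_greatCircle hzdir (-θ)
  have hmem : greatCircle z (v z) (-θ) ∈ sphereLevel F c :=
    ⟨hdir'.norm_base, huniq.1.trans hx.2⟩
  refine ⟨_, hmem, ?_⟩
  -- The circle arrives at the level set along ± the normal; `e4` fixes the sign, so that going
  -- forward by θ returns to z.
  have hξz : ξ (greatCircle z (v z) (-θ)) = greatCircleVel z (v z) (-θ) := by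
    have h1 := hξ.gradient_eq _ hmem
    rw [hz4 hmem] at h1
    have h2 := hdir'.gradient_eq
    rw [huniq.2] at h2
    exact smul_right_injective _ (hξ.inner_ne_zero hF hb hx) (h1.symm.trans h2)
  dsimp only
  rw [hξz, greatCircle_add]
  simp

theorem exists_isSubmanifoldNear_focal [FiniteDimensional ℝ E] {θ : ℝ}
    (hcrit : ∀ x ∈ sphereLevel F c, gradient F (greatCircle x (ξ x) θ) = 0) {y : E}
    (hy : y ∈ (fun x => greatCircle x (ξ x) θ) '' sphereLevel F c) :
    ∃ k, IsSubmanifoldNear k ((fun x => greatCircle x (ξ x) θ) '' sphereLevel F c) y := by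
  obtain ⟨x, hx, rfl⟩ := hy
  have hdir := hξ.isGradientDirection_focal hF hb hx θ
  obtain ⟨k, hk⟩ := hF.isSubmanifoldNear_critical hdir.norm_base (hcrit x hx)
    (hdir.nondegenerate.resolve_left (by rw [hcrit x hx]; simp))
  refine ⟨k, hk.congr ?_⟩
  filter_upwards [hξ.eventually_mem_focal hF hb hx (hcrit x hx)] with z hz
  refine ⟨hz, ?_⟩
  rintro ⟨x', hx', rfl⟩
  exact ⟨(hξ.isGradientDirection_focal hF hb hx' θ).norm_base, hcrit x' hx'⟩

end IsGradientNormal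

end Focal

/-! ### Hilbert–Schmidt norms and traces along a projection. -/

section HilbertSchmidt

variable {E : Type*} [NormedAddCommGroup E] [InnerProductSpace ℝ E] [FiniteDimensional ℝ E]

/-- The Hilbert-Schmidt norm of a map which factors through the orthogonal projection to `T`. -/
theorem sum_norm_sq_eq_of_comp_eq {T : Submodule ℝ E} {L Q : E →L[ℝ] E}
    (hL : ∀ v, L (Q v) = L v) (hQs : ∀ u v, ⟪Q u, v⟫_ℝ = ⟪u, Q v⟫_ℝ) (hQT : ∀ v, Q v ∈ T) :
    ∑ i, ‖L (stdOrthonormalBasis ℝ T i : E)‖ ^ 2 =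
      ∑ j, ‖L (stdOrthonormalBasis ℝ E j)‖ ^ 2 := by
  have : CompleteSpace E := FiniteDimensional.complete ℝ E
  set e := stdOrthonormalBasis ℝ E
  set f := stdOrthonormalBasis ℝ T
  set A := ContinuousLinearMap.adjoint L with hA
  -- The adjoint takes values in T, so its vectors have the same norm whether measured in a basis of
  -- T or of E.
  have hAT : ∀ v, A v ∈ T := fun v => by
    have : A v = Q (A v) := ext_inner_right ℝ fun u => by
      rw [hQs, hA, ContinuousLinearMap.adjoint_inner_left, ContinuousLinearMap.adjoint_inner_left,
        hL]
    rw [this]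
    exact hQT _
  have h1 : ∀ u : E, ‖L u‖ ^ 2 = ∑ k, ⟪u, A (e k)⟫_ℝ ^ 2 := fun u => by
    rw [← e.sum_sq_norm_inner_left (L u)]
    refine Finset.sum_congr rfl fun k _ => ?_
    rw [hA, ContinuousLinearMap.adjoint_inner_right, Real.norm_eq_abs, sq_abs]
  simp only [h1]
  rw [Finset.sum_comm]
  conv_rhs => rw [Finset.sum_comm]
  refine Finset.sum_congr rfl fun k _ => ?_
  have h2 := f.sum_sq_norm_inner_right ⟨A (e k), hAT _⟩
  have h3 := e.sum_sq_norm_inner_right (A (e k))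
  simp only [Real.norm_eq_abs, sq_abs] at h2 h3
  rw [h3]
  exact h2

omit [FiniteDimensional ℝ E] in
theorem trace_comp_comp_eq {Q B : E →L[ℝ] E} (hQ : ∀ v, Q (Q v) = Q v) :
    LinearMap.trace ℝ E ((Q.comp (B.comp Q) : E →L[ℝ] E) : E →ₗ[ℝ] E) =
      LinearMap.trace ℝ E (B.comp Q : E →L[ℝ] E) := by
  have h : ((B.comp Q : E →L[ℝ] E) : E →ₗ[ℝ] E) * (Q : E →ₗ[ℝ] E) = (B.comp Q : E →L[ℝ] E) := by
    ext v
    exact congrArg B (hQ v)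
  conv_rhs => rw [← h]
  exact LinearMap.trace_mul_comm ℝ _ _

end HilbertSchmidt

/-! ### First variation of the energy. -/

section FirstVariation

variable {E : Type*} [NormedAddCommGroup E] [InnerProductSpace ℝ E]
  {n : ℕ} {U M N : Set E} {P φ : E → E} (hP : IsNormalRetraction n U M P)
  {δ : ℝ} {F : ℝ → E → E} 

/-- The extension of a variation to a neighbourhood of `M`. -/
def extendedVariation (F : ℝ → E → E) (P : E → E) (p : ℝ × E) : E := F p.1 (P p.2)

/-- The extension of the variation field `∂F/∂t` at `t = 0` to a neighbourhood of `M`. -/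
def variationField (F : ℝ → E → E) (P : E → E) (z : E) : E :=
  fderiv ℝ (extendedVariation F P) (0, z) (1, 0)

include hP

namespace IsNormalRetraction

variable (hF : IsSmoothVariation M N φ δ F)
include hF

theorem contDiffOn_extendedVariation :
    ContDiffOn ℝ ∞ (extendedVariation F P) (Ioo (-δ) δ ×ˢ U) :=
  hF.smooth.comp (t := Ioo (-δ) δ ×ˢ M) (f := fun p : ℝ × E => (p.1, P p.2))
    (contDiff_fst.contDiffOn.prodMk
      (hP.contDiffOn.comp contDiff_snd.contDiffOn fun _ hp => hp.2))
    fun _ hp => ⟨hp.1, hP.mapsTo hp.2⟩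

theorem contDiffAt_extendedVariation {p : ℝ × E} (hp : p ∈ Ioo (-δ) δ ×ˢ U) :
    ContDiffAt ℝ ∞ (extendedVariation F P) p :=
  (hP.contDiffOn_extendedVariation hF).contDiffAt ((isOpen_Ioo.prod hP.isOpen).mem_nhds hp)

theorem hasFDerivAt_extendedVariation {p : ℝ × E} (hp : p ∈ Ioo (-δ) δ ×ˢ U) :
    HasFDerivAt (extendedVariation F P) (fderiv ℝ (extendedVariation F P) p) p :=
  ((hP.contDiffAt_extendedVariation hF hp).differentiableAt (by simp)).hasFDerivAt

theorem hasFDerivAt_extendedVariation_right {t : ℝ} {z : E} (ht : t ∈ Ioo (-δ) δ) (hz : z ∈ U) :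
    HasFDerivAt (fun z => F t (P z))
      ((fderiv ℝ (extendedVariation F P) (t, z)).comp (ContinuousLinearMap.inr ℝ ℝ E)) z :=
  (hP.hasFDerivAt_extendedVariation hF (p := (t, z)) ⟨ht, hz⟩).comp z
    (hasFDerivAt_prodMk_right t z)

theorem hasDerivAt_variationField (hδ : 0 < δ) {z : E} (hz : z ∈ U) :
    HasDerivAt (fun t => F t (P z)) (variationField F P z) 0 := by
  have h0 : (0 : ℝ) ∈ Ioo (-δ) δ := ⟨by linarith, hδ⟩
  have h1 := HasFDerivAt.comp (f := fun t : ℝ => (t, z)) (0 : ℝ)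
    (hP.hasFDerivAt_extendedVariation hF (p := (0, z)) ⟨h0, hz⟩) (hasFDerivAt_prodMk_left (0 : ℝ) z)
  exact h1.hasDerivAt

theorem contDiffOn_variationField (hδ : 0 < δ) : ContDiffOn ℝ ∞ (variationField F P) U := by
  have h0 : (0 : ℝ) ∈ Ioo (-δ) δ := ⟨by linarith, hδ⟩
  have h1 := (hP.contDiffOn_extendedVariation hF).fderiv_of_isOpen (m := ∞)
    (isOpen_Ioo.prod hP.isOpen) (by simp)
  have h2 : ContDiffOn ℝ ∞ (fun z => fderiv ℝ (extendedVariation F P) (0, z)) U :=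
    h1.comp (contDiff_prodMk_right (0 : ℝ)).contDiffOn fun z hz => ⟨h0, hz⟩
  exact h2.clm_apply contDiffOn_const

/-- The extended variation factors through the retraction, hence so does its velocity.
Differentiated, this says that dV ignores normal directions. -/
theorem variationField_comp (hδ : 0 < δ) {z : E} (hz : z ∈ U) :
    variationField F P (P z) = variationField F P z := by
  have h1 := hP.hasDerivAt_variationField hF hδ hz
  have h2 := hP.hasDerivAt_variationField hF hδ (hP.subset (hP.mapsTo hz))
  rw [hP.eq_self _ (hP.mapsTo hz)] at h2
  exact h2.unique h1

theorem fderiv_variationField_fderiv (hδ : 0 < δ) {x : E} (hx : x ∈ M) (v : E) :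
    fderiv ℝ (variationField F P) x (fderiv ℝ P x v) = fderiv ℝ (variationField F P) x v := by
  have h1 := (((hP.contDiffOn_variationField hF hδ).contDiffAt
    (hP.mem_nhds hx)).differentiableAt (by simp)).hasFDerivAt
  have h1' := h1
  rw [← hP.eq_self x hx] at h1'
  have h2 := h1'.comp x (hP.hasFDerivAt (hP.subset hx))
  have h3 := h1.congr_of_eventuallyEq (f₁ := variationField F P ∘ P)
    (Filter.eventually_of_mem (hP.mem_nhds hx) fun z hz => hP.variationField_comp hF hδ hz)
  have := h2.unique h3
  rw [hP.eq_self x hx] at this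
  exact congrArg (fun L : E →L[ℝ] E => L v) this

/-- Precomposition with the retraction annihilates the normal directions, so a fixed orthonormal
basis of E may replace the bases of the tangent spaces, which carry no continuity. The energy
density becomes manifestly smooth in (t, x). -/
theorem normSqDifferential_eq [FiniteDimensional ℝ E] {t : ℝ} (ht : t ∈ Ioo (-δ) δ) {x : E}
    (hx : x ∈ M) :
    normSqDifferential M (F t) x = ∑ j, ‖fderiv ℝ (extendedVariation F P) (t, x)
      (0, stdOrthonormalBasis ℝ E j)‖ ^ 2 := by
  set L := (fderiv ℝ (extendedVariation F P) (t, x)).comp (ContinuousLinearMap.inr ℝ ℝ E) with hL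
  have hLd := hP.hasFDerivAt_extendedVariation_right hF ht (hP.subset hx)
  rw [← hL] at hLd
  have h1 : ∀ v ∈ tangentSubspace M x, fderivWithin ℝ (F t) M x v = L v := by
    have hd : DifferentiableWithinAt ℝ (F t) M x := by
      have h2 : ContDiffOn ℝ ∞ (fun z => F t z) M :=
        hF.smooth.comp (contDiff_prodMk_right t).contDiffOn fun z hz => ⟨ht, hz⟩
      exact (h2 x hx).differentiableWithinAt (by simp)
    have h3 : HasFDerivWithinAt (F t) L M x :=
      hLd.hasFDerivWithinAt.congr (fun z hz => by simp only [hP.eq_self z hz])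
        (by simp only [hP.eq_self x hx])
    exact fun v hv => hd.hasFDerivWithinAt.eq_of_mem_tangentSubspace h3 hv
  have h2 : ∀ v, L (fderiv ℝ P x v) = L v := by
    intro v
    have hLd' := hLd
    rw [← hP.eq_self x hx] at hLd'
    have h3 := hLd'.comp x (hP.hasFDerivAt (hP.subset hx))
    have h4 := hLd.congr_of_eventuallyEq (f₁ := (fun z => F t (P z)) ∘ P)
      (Filter.eventually_of_mem (hP.mem_nhds hx) fun z hz => by
        rw [Function.comp_apply, hP.eq_self _ (hP.mapsTo hz)])
    exact congrArg (fun L : E →L[ℝ] E => L v) (h3.unique h4)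
  have h3 := sum_norm_sq_eq_of_comp_eq (T := tangentSubspace M x) h2 (hP.symm x hx)
    (hP.fderiv_mem_tangentSubspace hx)
  refine Eq.trans ?_ h3
  exact Finset.sum_congr rfl fun i _ => by rw [h1 _ (Subtype.coe_prop _)]

/-- The mixed second derivatives of the extended variation. -/
theorem fderiv_fderiv_extendedVariation (hδ : 0 < δ) {x : E} (hx : x ∈ U) (v : E) :
    fderiv ℝ (fderiv ℝ (extendedVariation F P)) (0, x) (1, 0) (0, v) =
      fderiv ℝ (variationField F P) x v := by
  have h0 : (0 : ℝ) ∈ Ioo (-δ) δ := ⟨by linarith, hδ⟩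
  have hc := hP.contDiffAt_extendedVariation hF (p := (0, x)) ⟨h0, hx⟩
  rw [(hc.isSymmSndFDerivAt two_le_minSmoothness_infty).eq]
  have h1 : HasFDerivAt (fderiv ℝ (extendedVariation F P))
      (fderiv ℝ (fderiv ℝ (extendedVariation F P)) (0, x)) ((0 : ℝ), x) :=
    ((hc.fderiv_right (m := ∞) (by simp)).differentiableAt (by simp)).hasFDerivAt
  have h1' : HasFDerivAt (fun z => fderiv ℝ (extendedVariation F P) (0, z))
      ((fderiv ℝ (fderiv ℝ (extendedVariation F P)) (0, x)).comp
        (ContinuousLinearMap.inr ℝ ℝ E)) x :=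
    have h4 : HasFDerivAt (fun z : E => ((0 : ℝ), z)) (ContinuousLinearMap.inr ℝ ℝ E) x :=
      hasFDerivAt_prodMk_right (0 : ℝ) x
    HasFDerivAt.comp (g := fderiv ℝ (extendedVariation F P)) x h1 h4
  have h2 := h1'.clm_apply
    (hasFDerivAt_const ((1 : ℝ), (0 : E)) x)
  have h3 : HasFDerivAt (variationField F P) _ x := h2
  rw [h3.fderiv]
  simp

/-- The first variation of the energy. -/
theorem hasDerivAt_energy [FiniteDimensional ℝ E] [MeasurableSpace E] [BorelSpace E]
    (hδ : 0 < δ) (hM : IsCompact M) :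
    HasDerivAt (fun t => energy n M (F t))
      (∫ x in M, ∑ j, ⟪fderiv ℝ (fun z => F 0 (P z)) x (stdOrthonormalBasis ℝ E j),
        fderiv ℝ (variationField F P) x (stdOrthonormalBasis ℝ E j)⟫_ℝ ∂(μHE[n])) 0 := by
  have h0 : (0 : ℝ) ∈ Ioo (-δ) δ := ⟨by linarith, hδ⟩
  have hΩ : IsOpen (Ioo (-δ) δ ×ˢ U) := isOpen_Ioo.prod hP.isOpen
  set e := stdOrthonormalBasis ℝ E with he
  have hmeas : MeasurableSet M := hM.isClosed.measurableSet
  have hfd := (hP.contDiffOn_extendedVariation hF).fderiv_of_isOpen (m := ∞) hΩ (by simp)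
  set H : ℝ × E → ℝ := fun p => ∑ j, ‖fderiv ℝ (extendedVariation F P) p (0, e j)‖ ^ 2 with hH
  have hHs : ContDiffOn ℝ ∞ H (Ioo (-δ) δ ×ˢ U) :=
    ContDiffOn.sum fun j _ => (hfd.clm_apply contDiffOn_const).norm_sq ℝ
  have h1 := (hasDerivAt_setIntegral_of_contDiffOn hM (hP.measure_lt_top hM) hΩ
    (fun x hx => ⟨h0, hP.subset hx⟩) hHs).const_mul (1 / 2 : ℝ)
  have h2 : (fun t => energy n M (F t)) =ᶠ[𝓝 0] fun t => 1 / 2 * ∫ x in M, H (t, x) ∂(μHE[n]) := by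
    filter_upwards [Ioo_mem_nhds h0.1 h0.2] with t ht
    rw [energy]
    congr 1
    exact setIntegral_congr_fun hmeas fun x hx => hP.normSqDifferential_eq hF ht hx
  have h3 := h1.congr_of_eventuallyEq h2
  refine h3.congr_deriv ?_
  symm
  rw [← integral_const_mul]
  refine setIntegral_congr_fun hmeas fun x hx => ?_
  have hxU := hP.subset hx
  have hd : HasFDerivAt (fderiv ℝ (extendedVariation F P))
      (fderiv ℝ (fderiv ℝ (extendedVariation F P)) (0, x)) ((0 : ℝ), x) :=
    ((hfd.contDiffAt (hΩ.mem_nhds ⟨h0, hxU⟩)).differentiableAt (by simp)).hasFDerivAt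
  have hHd : HasFDerivAt H _ ((0 : ℝ), x) := HasFDerivAt.fun_sum (u := Finset.univ) fun j _ =>
    (hd.clm_apply (hasFDerivAt_const ((0 : ℝ), e j) ((0 : ℝ), x))).norm_sq
  rw [hHd.fderiv, (hP.hasFDerivAt_extendedVariation_right hF h0 hxU).fderiv, sum_apply,
    Finset.mul_sum]
  refine Finset.sum_congr rfl fun j _ => ?_
  simp [hP.fderiv_fderiv_extendedVariation hF hδ hxU]

end IsNormalRetraction

end FirstVariation

/-! ### The focal map is a critical point of the energy. -/

section Criticality

variable {E : Type*} [NormedAddCommGroup E] [InnerProductSpace ℝ E] [FiniteDimensional ℝ E]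
  [CompleteSpace E] {F : E → ℝ} {b : ℝ → ℝ} {c : ℝ} {ξ : E → E} {n : ℕ} {U : Set E} {P : E → E}
  {θ δ : ℝ} {G : ℝ → E → E}

/-- The set of focal points at distance `θ` of a level set. -/
def focalSet (F : E → ℝ) (c : ℝ) (ξ : E → E) (θ : ℝ) : Set E :=
  (fun x => greatCircle x (ξ x) θ) '' sphereLevel F c

/-- `P` retracts a neighbourhood of a level set to it, and its differential at the points of the
level set is the projection along the normal space. -/
structure IsLevelRetraction (F : E → ℝ) (b : ℝ → ℝ) (c : ℝ) (n : ℕ) (U : Set E) (P : E → E) :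
    Prop where
  isNormalRetraction : IsNormalRetraction n U (sphereLevel F c) P
  fderiv_eq : ∀ x ∈ sphereLevel F c, ∀ v,
    fderiv ℝ P x v = v - ⟪x, v⟫_ℝ • x - (⟪gradient F x, v⟫_ℝ / b c) • gradient F x

namespace IsLevelRetraction

variable (hP : IsLevelRetraction F b c n U P) (hF : IsConicalTransnormal F b) (hb : 0 < b c)
include hP hF hb

omit [FiniteDimensional ℝ E] in
theorem mem_tangentSubspace_iff {x : E} (hx : x ∈ sphereLevel F c) {v : E} :
    v ∈ tangentSubspace (sphereLevel F c) x ↔ ⟪x, v⟫_ℝ = 0 ∧ ⟪gradient F x, v⟫_ℝ = 0 := by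
  have hx0 := IsConicalTransnormal.ne_zero_of_norm_eq_one hx.1
  rw [hP.isNormalRetraction.mem_tangentSubspace_iff hx, hP.fderiv_eq x hx]
  constructor
  · intro h
    have h1 : ⟪x, v⟫_ℝ • x + (⟪gradient F x, v⟫_ℝ / b c) • gradient F x = 0 := by
      rw [sub_sub, sub_eq_self] at h
      exact h
    have h2 : ⟪x, v⟫_ℝ = 0 := by
      have h3 := congrArg (fun u => ⟪x, u⟫_ℝ) h1
      simpa only [inner_add_right, inner_smul_right, real_inner_self_eq_norm_sq, hx.1,
        real_inner_comm (gradient F x) x, hF.inner_gradient_self hx0, mul_zero, add_zero, one_pow,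
        mul_one, inner_zero_right] using h3
    refine ⟨h2, ?_⟩
    rw [h2, zero_smul, zero_add] at h1
    have h3 := congrArg (fun u => ⟪gradient F x, u⟫_ℝ) h1
    rw [← hx.2] at h3 hb
    simp only [inner_smul_right, real_inner_self_eq_norm_sq, hF.norm_gradient x hx.1,
      inner_zero_right, div_mul_cancel₀ _ hb.ne'] at h3
    exact h3
  · rintro ⟨h1, h2⟩
    simp [h1, h2, -inner_gradient_left]

-- The Hessian is symmetric and preserves the span of x and ∇F, hence also its orthogonal
-- complement.
omit [FiniteDimensional ℝ E] in
theorem hess_mem_tangentSubspace {x : E} (hx : x ∈ sphereLevel F c) {v : E}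
    (hv : v ∈ tangentSubspace (sphereLevel F c) x) :
    hess F x v ∈ tangentSubspace (sphereLevel F c) x := by
  have hx0 := IsConicalTransnormal.ne_zero_of_norm_eq_one hx.1
  rw [hP.mem_tangentSubspace_iff hF hb hx] at hv ⊢
  constructor
  · rw [← hess_symm (hF.contDiffAt x hx0), hF.hess_self hx0, inner_neg_left, hv.2, neg_zero]
  · rw [← hess_symm (hF.contDiffAt x hx0), hF.hess_gradient hx.1, inner_sub_left, inner_smul_left,
      inner_smul_left, hv.1, hv.2]
    simp

variable (hξ : IsGradientNormal F c ξ)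
  (hcrit : ∀ x ∈ sphereLevel F c, gradient F (greatCircle x (ξ x) θ) = 0)
  (hG : IsSmoothVariation (sphereLevel F c) (focalSet F c ξ θ)
    (fun x => greatCircle x (ξ x) θ) δ G) (hδ : 0 < δ)
include hξ hcrit hG hδ

-- The curve t ↦ G(t, x) consists of critical points on the sphere, so V is orthogonal to the focal
-- point y and lies in the kernel of the Hessian at y. The velocity w is an eigenvector with nonzero
-- eigenvalue, so V is orthogonal to w too. A rotation by θ turns the pair y, w into x, ξ(x).
omit [FiniteDimensional ℝ E] in
theorem variationField_mem_tangentSubspace {x : E} (hx : x ∈ sphereLevel F c) :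
    variationField G P x ∈ tangentSubspace (sphereLevel F c) x := by
  have hd := hP.isNormalRetraction.hasDerivAt_variationField hG hδ
    (hP.isNormalRetraction.subset hx)
  rw [hP.isNormalRetraction.eq_self x hx] at hd
  set V := variationField G P x with hV
  have h0 : G 0 x = greatCircle x (ξ x) θ := hG.initial hx
  have hdir := hξ.isGradientDirection_focal hF hb hx θ
  have hev : ∀ᶠ t in 𝓝 (0 : ℝ), ‖G t x‖ = 1 ∧ gradient F (G t x) = 0 := by
    filter_upwards [Ioo_mem_nhds (by linarith : -δ < 0) hδ] with t ht
    obtain ⟨x', hx', hxt⟩ := hG.mapsTo t ht hx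
    rw [← hxt]
    exact ⟨(hξ.isGradientDirection_focal hF hb hx' θ).norm_base, hcrit x' hx'⟩
  have hback := greatCircle_add x (ξ x) θ (-θ)
  have hbackv := greatCircleVel_add x (ξ x) θ (-θ)
  have hg := hcrit x hx
  set y := greatCircle x (ξ x) θ with hy
  set w := greatCircleVel x (ξ x) θ with hw
  have hy0 := IsConicalTransnormal.ne_zero_of_norm_eq_one hdir.norm_base
  have h1 : ⟪y, V⟫_ℝ = 0 := by
    have h2 := hd.norm_sq
    have h3 : HasDerivAt (fun t => ‖G t x‖ ^ 2) 0 0 :=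
      (hasDerivAt_const (0 : ℝ) (1 : ℝ)).congr_of_eventuallyEq
        (hev.mono fun t ht => by simp only [ht.1, one_pow])
    have h4 := h2.unique h3
    rw [h0] at h4
    linarith
  have h2 : hess F y V = 0 := by
    have h3 : HasFDerivAt (gradient F) (hess F y) (G 0 x) := by
      rw [h0]; exact (hF.contDiffAt y hy0).hasFDerivAt_gradient
    have h4 := h3.comp_hasDerivAt (0 : ℝ) hd
    have h5 : HasDerivAt (gradient F ∘ fun t => G t x) 0 0 :=
      (hasDerivAt_const (0 : ℝ) (0 : E)).congr_of_eventuallyEq (hev.mono fun t ht => ht.2)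
    exact h4.unique h5
  have h3 : ⟪w, V⟫_ℝ = 0 := by
    have h4 := hess_symm (hF.contDiffAt y hy0) w V
    rw [h2, inner_zero_right, hdir.hess_eq, hg, inner_zero_left, zero_smul, sub_zero,
      inner_smul_left] at h4
    have hne : deriv b (F y) / 2 ≠ 0 :=
      div_ne_zero (hdir.nondegenerate.resolve_left (by simp [hg])) two_ne_zero
    exact (mul_eq_zero.1 h4).resolve_left (by simpa using hne)
  rw [add_neg_cancel, greatCircle_zero] at hback
  rw [add_neg_cancel, greatCircleVel_zero] at hbackv
  rw [hP.mem_tangentSubspace_iff hF hb hx]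
  constructor
  · rw [← hback, greatCircle, inner_add_left, inner_smul_left, inner_smul_left, h1, h3]
    simp
  · rw [hξ.gradient_eq x hx, ← hbackv, greatCircleVel, inner_smul_left, inner_sub_left,
      inner_smul_left, inner_smul_left, h1, h3]
    simp

omit hδ hcrit hG [FiniteDimensional ℝ E] in
theorem eventually_comp_inner_eq {x : E} (hx : x ∈ sphereLevel F c) :
    ∀ᶠ z in 𝓝 x, ⟪gradient F (P z), ξ (P z)⟫_ℝ = ⟪gradient F x, ξ x⟫_ℝ := by
  have hR := hP.isNormalRetraction
  have h1 := (hR.contDiffAt (hR.subset hx)).continuousAt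
  have h2 : Filter.Tendsto P (𝓝 x) (𝓝 (P x)) := h1
  rw [hR.eq_self x hx] at h2
  filter_upwards [h2.eventually (hξ.eventually_inner_eq hF hb hx), hR.mem_nhds hx] with z hz hzU
  exact hz (hR.mapsTo hzU)

omit hδ hcrit hP [FiniteDimensional ℝ E] hG in
theorem normal_eq {x : E} (hx : x ∈ sphereLevel F c) :
    ξ x = (⟪gradient F x, ξ x⟫_ℝ / b c) • gradient F x := by
  have h1 := hξ.inner_sq hF hx
  conv_rhs => rw [hξ.gradient_eq x hx]
  rw [smul_smul]
  simp only [inner_smul_left, real_inner_self_eq_norm_sq, hξ.norm_eq_one x hx]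
  simp only [conj_trivial, one_pow, mul_one]
  rw [div_mul_eq_mul_div, ← sq, h1, div_self hb.ne', one_smul]

-- The normal ξ is a multiple of ∇F whose coefficient is locally constant on the level set. Thus dξ
-- is that multiple of the Hessian on tangent vectors.
omit hcrit hδ [FiniteDimensional ℝ E] in
theorem fderiv_initial {x : E} (hx : x ∈ sphereLevel F c) (u : E) :
    fderiv ℝ (fun z => G 0 (P z)) x u = Real.cos θ • fderiv ℝ P x u +
      (Real.sin θ * (⟪gradient F x, ξ x⟫_ℝ / b c)) • hess F x (fderiv ℝ P x u) := by
  have hR := hP.isNormalRetraction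
  have hx0 := IsConicalTransnormal.ne_zero_of_norm_eq_one hx.1
  set k := ⟪gradient F x, ξ x⟫_ℝ with hk
  have h1 : (fun z => G 0 (P z)) =ᶠ[𝓝 x] fun z => Real.cos θ • P z +
      (Real.sin θ * (k / b c)) • gradient F (P z) := by
    filter_upwards [hP.eventually_comp_inner_eq hF hb hξ hx, hR.mem_nhds hx] with z hz hzU
    have hPz := hR.mapsTo hzU
    have h2 : G 0 (P z) = Real.cos θ • P z + Real.sin θ • ξ (P z) := hG.initial hPz
    rw [h2, normal_eq hF hb hξ hPz, hz, smul_smul]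
  have h2 := hR.hasFDerivAt (hR.subset hx)
  have h3 : HasFDerivAt (gradient F) (hess F x) (P x) := by
    rw [hR.eq_self x hx]; exact (hF.contDiffAt x hx0).hasFDerivAt_gradient
  have h4 := (h2.const_smul (Real.cos θ)).add
    ((h3.comp x h2).const_smul (Real.sin θ * (k / b c)))
  rw [(h4.congr_of_eventuallyEq h1).fderiv]
  simp

/-- Since V is tangent to the level set, the full trace of A = D_V Hess F is the derivative of a
constant. The projection subtracts only the entries of A at x and at ∇F, which vanish by
`third_self_self` and `third_gradient_gradient`. -/
theorem trace_third_eq_zero {a : ℝ}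
    (hlap : ∀ x ∈ sphereLevel F c, LinearMap.trace ℝ E (hess F x : E →ₗ[ℝ] E) = a)
    {x : E} (hx : x ∈ sphereLevel F c) :
    LinearMap.trace ℝ E (((fderiv ℝ (hess F) x (variationField G P x)).comp (fderiv ℝ P x) :
      E →L[ℝ] E) : E →ₗ[ℝ] E) = 0 := by
  have hR := hP.isNormalRetraction
  have hx0 := IsConicalTransnormal.ne_zero_of_norm_eq_one hx.1
  have hV := hP.variationField_mem_tangentSubspace hF hb hξ hcrit hG hδ hx
  have hV' := (hP.mem_tangentSubspace_iff hF hb hx).1 hV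
  have hPV := (hR.mem_tangentSubspace_iff hx).1 hV
  set V := variationField G P x
  set A := fderiv ℝ (hess F) x V with hA
  set e := stdOrthonormalBasis ℝ E with he
  have hAs : ∀ u v, ⟪A u, v⟫_ℝ = ⟪u, A v⟫_ℝ := fderiv_hess_symm (hF.eventually_contDiffAt hx0) V
  have htr : LinearMap.trace ℝ E (A : E →ₗ[ℝ] E) = 0 := by
    let τ : (E →L[ℝ] E) →L[ℝ] ℝ := LinearMap.toContinuousLinearMap
      ((LinearMap.trace ℝ E).comp (ContinuousLinearMap.coeLM ℝ))
    have hH : HasFDerivAt (hess F) (fderiv ℝ (hess F) x) (P x) := by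
      rw [hR.eq_self x hx]
      exact ((hF.contDiffAt x hx0).hess_infty.differentiableAt (by simp)).hasFDerivAt
    have h1 := τ.hasFDerivAt.comp x (hH.comp x (hR.hasFDerivAt (hR.subset hx)))
    have h2 : (fun z => τ (hess F (P z))) =ᶠ[𝓝 x] fun _ => a :=
      Filter.eventually_of_mem (hR.mem_nhds hx) fun z hz => hlap _ (hR.mapsTo hz)
    have h3 := h1.unique ((hasFDerivAt_const a x).congr_of_eventuallyEq h2)
    have h4 := congrArg (fun L : E →L[ℝ] ℝ => L V) h3
    simp only [ContinuousLinearMap.comp_apply, hPV, zero_apply] at h4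
    exact h4
  have h1 : ⟪A x, x⟫_ℝ = 0 := hF.third_self_self hx0 (by rw [real_inner_comm]; exact hV'.2)
  have h2 : ⟪A (gradient F x), gradient F x⟫_ℝ = 0 := hF.third_gradient_gradient hx.1
    (by rw [real_inner_comm]; exact hV'.1) (by rw [real_inner_comm]; exact hV'.2)
  rw [LinearMap.trace_eq_sum_inner _ e] at htr ⊢
  have h3 : ∀ j, ⟪e j, (A.comp (fderiv ℝ P x)) (e j)⟫_ℝ = ⟪e j, A (e j)⟫_ℝ -
      ⟪A x, e j⟫_ℝ * ⟪e j, x⟫_ℝ -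
      ⟪A (gradient F x), e j⟫_ℝ * ⟪e j, gradient F x⟫_ℝ / b c := fun j => by
    rw [ContinuousLinearMap.comp_apply, hP.fderiv_eq x hx, map_sub, map_sub, map_smul, map_smul,
      inner_sub_right, inner_sub_right, inner_smul_right, inner_smul_right,
      real_inner_comm (A x), real_inner_comm (A (gradient F x)), real_inner_comm x (e j),
      real_inner_comm (gradient F x) (e j)]
    ring
  refine (Finset.sum_congr rfl fun j _ => h3 j).trans ?_
  rw [Finset.sum_sub_distrib, Finset.sum_sub_distrib, ← Finset.sum_div, e.sum_inner_mul_inner,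
    e.sum_inner_mul_inner, h1, h2]
  rw [zero_div, sub_zero, sub_zero]
  exact htr

/-- The energy is stationary at the focal map. -/
theorem hasDerivAt_energy_zero [MeasurableSpace E] [BorelSpace E] {a : ℝ}
    (hlap : ∀ x ∈ sphereLevel F c, LinearMap.trace ℝ E (hess F x : E →ₗ[ℝ] E) = a)
    (hM : IsCompact (sphereLevel F c)) :
    HasDerivAt (fun t => energy n (sphereLevel F c) (G t)) 0 0 := by
  have hR := hP.isNormalRetraction
  set V := variationField G P with hV
  set κ : E → ℝ := fun z => Real.sin θ * (⟪gradient F (P z), ξ (P z)⟫_ℝ / b c) with hκ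
  -- On the level set W = dφ(V) for the focal map φ. It is tangent because V is and because the
  -- Hessian preserves tangent vectors.
  set W : E → E := fun z => Real.cos θ • V z + κ z • hess F z (V z) with hW
  have hO : IsOpen (U ∩ {z | z ≠ 0}) := hR.isOpen.inter isOpen_ne
  have hMO : sphereLevel F c ⊆ U ∩ {z | z ≠ 0} :=
    fun x hx => ⟨hR.subset hx, IsConicalTransnormal.ne_zero_of_norm_eq_one hx.1⟩
  have hVs : ContDiffOn ℝ ∞ V U := hR.contDiffOn_variationField hG hδ
  have hκs : ContDiffOn ℝ ∞ κ U := by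
    have h1 : ContDiffOn ℝ ∞ (fun z => gradient F (P z)) U := fun z hz =>
      ((hF.contDiffAt (P z) (IsConicalTransnormal.ne_zero_of_norm_eq_one
        (hR.mapsTo hz).1)).gradient_infty.comp z (hR.contDiffAt hz)).contDiffWithinAt
    have h2 : ContDiffOn ℝ ∞ (fun z => ξ (P z)) U := hξ.contDiffOn.comp hR.contDiffOn hR.mapsTo
    exact contDiffOn_const.mul ((h1.inner ℝ h2).div_const _)
  have hHs : ContDiffOn ℝ ∞ (hess F) (U ∩ {z | z ≠ 0}) :=
    fun z hz => (hF.contDiffAt z hz.2).hess_infty.contDiffWithinAt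
  have hWs : ContDiffOn ℝ ∞ W (U ∩ {z | z ≠ 0}) :=
    ((hVs.mono inter_subset_left).const_smul _).add
      ((hκs.mono inter_subset_left).smul (hHs.clm_apply (hVs.mono inter_subset_left)))
  have hVT := fun x hx => hP.variationField_mem_tangentSubspace hF hb hξ hcrit hG hδ (x := x) hx
  have hWT : ∀ x ∈ sphereLevel F c, W x ∈ tangentSubspace (sphereLevel F c) x := fun x hx =>
    add_mem (Submodule.smul_mem _ _ (hVT x hx))
      (Submodule.smul_mem _ _ (hP.hess_mem_tangentSubspace hF hb hx (hVT x hx)))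
  have hdiv := hR.integral_trace_eq_zero hM hO hMO hWs hWT
  refine (hR.hasDerivAt_energy hG hδ hM).congr_deriv (Eq.trans ?_ hdiv)
  refine setIntegral_congr_fun hM.isClosed.measurableSet fun x hx => ?_
  have hx0 := IsConicalTransnormal.ne_zero_of_norm_eq_one hx.1
  set e := stdOrthonormalBasis ℝ E with he
  set k := Real.sin θ * (⟪gradient F x, ξ x⟫_ℝ / b c) with hk
  set A := fderiv ℝ (hess F) x (V x) with hA
  set D := fderiv ℝ V x with hD
  set Q := fderiv ℝ P x with hQ
  let B : E →L[ℝ] E := Real.cos θ • D + k • (hess F x).comp D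
  have hBQ : (B.comp Q) = B := by
    ext v
    simp [B, hD, hQ, hV, hR.fderiv_variationField_fderiv hG hδ hx]
  -- The term with the third derivative of F is turned into A by exchanging the differentiation
  -- direction with V; κ is locally constant and contributes nothing.
  have hDW : fderiv ℝ W x = B + k • A := by
    have h1 : HasFDerivAt V D x :=
      ((hVs.contDiffAt (hR.mem_nhds hx)).differentiableAt (by simp)).hasFDerivAt
    have h2 : HasFDerivAt (hess F) (fderiv ℝ (hess F) x) x :=
      ((hF.contDiffAt x hx0).hess_infty.differentiableAt (by simp)).hasFDerivAt
    have h3 : W =ᶠ[𝓝 x] fun z => Real.cos θ • V z + k • hess F z (V z) := by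
      filter_upwards [hP.eventually_comp_inner_eq hF hb hξ hx] with z hz
      simp only [hW, hκ, hz, hk]
    have h4 := (h1.const_smul (Real.cos θ)).add ((h2.clm_apply h1).const_smul k)
    rw [(h4.congr_of_eventuallyEq h3).fderiv]
    ext v
    simp [B, hA, fderiv_hess_swap (hF.contDiffAt x hx0) v (V x)]
    module
  have htr := hP.trace_third_eq_zero hF hb hξ hcrit hG hδ hlap hx
  have h1 : LinearMap.trace ℝ E ((Q.comp ((fderiv ℝ W x).comp Q) : E →L[ℝ] E) : E →ₗ[ℝ] E) =
      LinearMap.trace ℝ E (B : E →ₗ[ℝ] E) := by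
    rw [trace_comp_comp_eq (hR.fderiv_fderiv hx), hDW, ContinuousLinearMap.add_comp,
      ContinuousLinearMap.smul_comp, hBQ, ContinuousLinearMap.toLinearMap_add, map_add,
      ContinuousLinearMap.toLinearMap_smul, map_smul, htr, smul_zero, add_zero]
  -- The divergence of W is the trace of B. By the symmetry of the Hessian, Q B = Q(cos θ + k H) dV
  -- has as trace the sum of the products ⟨dφ(e), dV(e)⟩.
  have h2 : LinearMap.trace ℝ E ((Q.comp B : E →L[ℝ] E) : E →ₗ[ℝ] E) =
      LinearMap.trace ℝ E (B : E →ₗ[ℝ] E) := by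
    conv_rhs => rw [← hBQ]
    exact LinearMap.trace_mul_comm ℝ (Q : E →ₗ[ℝ] E) B
  refine Eq.trans ?_ h1.symm
  rw [← h2, LinearMap.trace_eq_sum_inner _ e]
  refine Finset.sum_congr rfl fun j _ => ?_
  rw [hP.fderiv_initial hF hb hξ hG hx]
  change _ = ⟪e j, Q (B (e j))⟫_ℝ
  rw [← hR.symm x hx, inner_add_left, inner_smul_left, inner_smul_left,
    hess_symm (hF.contDiffAt x hx0)]
  simp [B, inner_add_right, inner_smul_right, hk]

end IsLevelRetraction

end Criticality

/-! ### Dimension and submanifold structure of the level set. -/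

section LevelSets

variable {E : Type*} [NormedAddCommGroup E] [InnerProductSpace ℝ E] [FiniteDimensional ℝ E]

omit [FiniteDimensional ℝ E] in
theorem finrank_span_orthogonal_pair {x g : E} (hx : x ≠ 0) (hg : g ≠ 0) (h : ⟪x, g⟫_ℝ = 0) :
    finrank ℝ (Submodule.span ℝ {x, g}) = 2 := by
  have hli : LinearIndependent ℝ ![x, g] := by
    refine LinearIndependent.pair_iff.2 fun s t hst => ?_
    have h1 := congrArg (fun u => ⟪x, u⟫_ℝ) hst
    have h2 := congrArg (fun u => ⟪g, u⟫_ℝ) hst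
    simp only [inner_add_right, inner_smul_right, h, real_inner_comm x g, mul_zero, add_zero,
      inner_zero_right, zero_add, mul_eq_zero, inner_self_eq_zero, hx, hg, or_false] at h1 h2
    exact ⟨h1, h2⟩
  have := finrank_span_eq_card hli
  rwa [Matrix.range_cons_cons_empty, Fintype.card_fin] at this

variable [CompleteSpace E] {F : E → ℝ} {b : ℝ → ℝ} {c : ℝ} {n : ℕ}

namespace IsConicalTransnormal

variable (hF : IsConicalTransnormal F b) (hb : 0 < b c)
include hF hb

omit [FiniteDimensional ℝ E] in
theorem gradient_ne_zero {x : E} (hx : x ∈ sphereLevel F c) : gradient F x ≠ 0 := by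
  intro h
  have h1 := hF.norm_gradient x hx.1
  rw [hx.2, h, norm_zero] at h1
  rw [← h1] at hb
  norm_num at hb

theorem exists_isLevelRetraction (hn : finrank ℝ E = n + 2) (hne : (sphereLevel F c).Nonempty) :
    ∃ U P, IsLevelRetraction F b c n U P := by
  obtain ⟨x₀, hx₀⟩ := hne
  obtain ⟨U, P, hU, hMU, hPs, hPM, hP⟩ := hF.exists_retraction hb hx₀.1 hx₀.2
  refine ⟨U, P, ⟨hU, hMU, hPs, hPM, fun x hx => (hP x hx.1 hx.2).1, ?_, ?_⟩,
    fun x hx => (hP x hx.1 hx.2).2⟩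
  · intro x hx u v
    rw [(hP x hx.1 hx.2).2, (hP x hx.1 hx.2).2]
    simp only [inner_sub_left, inner_sub_right, inner_smul_left, inner_smul_right, conj_trivial]
    rw [real_inner_comm x u, real_inner_comm (gradient F x) u]
    ring
  · intro x hx
    have hx0 := ne_zero_of_norm_eq_one hx.1
    have hg0 := hF.gradient_ne_zero hb hx
    have hxg : ⟪x, gradient F x⟫_ℝ = 0 := by rw [real_inner_comm, hF.inner_gradient_self hx0]
    have hgg : ⟪gradient F x, gradient F x⟫_ℝ = b c := by
      rw [real_inner_self_eq_norm_sq, hF.norm_gradient x hx.1, hx.2]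
    -- The differential is the orthogonal projection along x and ∇F, two independent directions,
    -- which leaves n of the n + 2 dimensions.
    have hrange : LinearMap.range (fderiv ℝ P x : E →ₗ[ℝ] E) =
        (Submodule.span ℝ {x, gradient F x})ᗮ := by
      ext v
      rw [Submodule.mem_orthogonal]
      constructor
      · rintro ⟨u, rfl⟩ w hw
        obtain ⟨s, t, rfl⟩ := Submodule.mem_span_pair.1 hw
        change ⟪_, fderiv ℝ P x u⟫_ℝ = 0
        rw [(hP x hx.1 hx.2).2]
        simp only [inner_sub_right, inner_smul_right, inner_add_left, inner_smul_left,
          real_inner_self_eq_norm_sq x, hx.1, hxg, real_inner_comm x (gradient F x), hgg,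
          conj_trivial]
        field_simp
        ring
      · intro h
        refine ⟨v, ?_⟩
        change fderiv ℝ P x v = v
        rw [(hP x hx.1 hx.2).2, h x (Submodule.subset_span (by simp)),
          h (gradient F x) (Submodule.subset_span (by simp))]
        simp
    have h2 := Submodule.finrank_add_finrank_orthogonal (Submodule.span ℝ {x, gradient F x})
    rw [finrank_span_orthogonal_pair hx0 hg0 hxg, hn] at h2
    rw [hrange]
    omega

theorem isSubmanifoldNear_sphereLevel (hn : finrank ℝ E = n + 2) {x : E}
    (hx : x ∈ sphereLevel F c) : IsSubmanifoldNear n (sphereLevel F c) x := by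
  have hx0 := ne_zero_of_norm_eq_one hx.1
  have hg0 := hF.gradient_ne_zero hb hx
  have hxg : ⟪x, gradient F x⟫_ℝ = 0 := by rw [real_inner_comm, hF.inner_gradient_self hx0]
  have hdF := ((hF.contDiffAt x hx0).differentiableAt (by simp)).hasFDerivAt
  set v := gradient F x with hv
  have hvv : ⟪v, v⟫_ℝ = b c := by
    rw [real_inner_self_eq_norm_sq, hF.norm_gradient x hx.1, hx.2]
  have hvx : ⟪v, x⟫_ℝ = 0 := by rw [real_inner_comm, hxg]
  have hxx : ⟪x, x⟫_ℝ = 1 := by rw [real_inner_self_eq_norm_sq, hx.1, one_pow]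
  -- The two defining equations are carried by the orthogonal vectors x and ∇F(x), so that `g`
  -- vanishes exactly where both hold.
  set g : E → E := fun z => (‖z‖ ^ 2 - 1) • x + (F z - c) • v with hg
  have hgd : ∀ u, fderiv ℝ g x u = (2 * ⟪x, u⟫_ℝ) • x + ⟪v, u⟫_ℝ • v := by
    intro u
    have h1 := ((hasStrictFDerivAt_norm_sq x).hasFDerivAt.sub_const 1).smul_const x
    have h2 := (hdF.sub_const c).smul_const v
    have h3 : HasFDerivAt g _ x := h1.add h2
    rw [h3.fderiv, hv, inner_gradient_left]
    simp
  have h := isSubmanifoldNear_of_submersion (N := sphereLevel F c) (y := x)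
    (Submodule.span ℝ {x, v}) (g := g) ?_ ?_ ?_ ?_
  · rwa [finrank_span_orthogonal_pair hx0 hg0 hxg, hn, Nat.add_sub_cancel] at h
  · filter_upwards [eventually_ne_zero hx0] with z hz
    exact (((contDiff_norm_sq ℝ).contDiffAt.sub contDiffAt_const).smul contDiffAt_const).add
      (((hF.contDiffAt z hz).sub contDiffAt_const).smul contDiffAt_const)
  · exact fun z => Submodule.mem_span_pair.2 ⟨_, _, rfl⟩
  · intro w hw
    obtain ⟨s, t, rfl⟩ := Submodule.mem_span_pair.1 hw
    refine ⟨(s / 2) • x + (t / b c) • v, ?_⟩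
    rw [hgd]
    simp only [inner_add_right, inner_smul_right, hxx, hxg, hvx, hvv]
    congr 2 <;> field_simp <;> ring
  · refine Filter.Eventually.of_forall fun z => ?_
    constructor
    · rintro ⟨h1, h2⟩
      simp [hg, h1, h2]
    · intro hz
      have h1 := congrArg (fun u => ⟪x, u⟫_ℝ) hz
      have h2 := congrArg (fun u => ⟪v, u⟫_ℝ) hz
      simp only [hg, inner_add_right, inner_smul_right, hxx, hxg, hvx, hvv, inner_zero_right,
        mul_zero, zero_add, add_zero, mul_one, mul_eq_zero, hb.ne', or_false] at h1 h2
      exact ⟨by rwa [sub_eq_zero, pow_eq_one_iff_of_nonneg (norm_nonneg _) two_ne_zero] at h1,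
        sub_eq_zero.1 h2⟩

theorem isHarmonicMap_focal [MeasurableSpace E] [BorelSpace E] (hn : finrank ℝ E = n + 2)
    {ξ : E → E} {θ a : ℝ} (hξ : IsGradientNormal F c ξ)
    (hcrit : ∀ x ∈ sphereLevel F c, gradient F (greatCircle x (ξ x) θ) = 0)
    (hlap : ∀ x ∈ sphereLevel F c, LinearMap.trace ℝ E (hess F x : E →ₗ[ℝ] E) = a)
    (hM : IsCompact (sphereLevel F c)) (hne : (sphereLevel F c).Nonempty) :
    IsHarmonicMap n (sphereLevel F c) (focalSet F c ξ θ) (fun x => greatCircle x (ξ x) θ) := by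
  obtain ⟨U, P, hP⟩ := hF.exists_isLevelRetraction (n := n) hb hn hne
  have hs : ContDiffOn ℝ ∞ (fun x => greatCircle x (ξ x) θ) (sphereLevel F c) :=
    (contDiffOn_id.const_smul _).add (hξ.contDiffOn.const_smul _)
  exact
    { isCompact_source := hM
      isSubmanifold_source := fun x hx => hF.isSubmanifoldNear_sphereLevel hb hn hx
      isCompact_target := hM.image_of_continuousOn hs.continuousOn
      isSubmanifold_target := fun y hy => hξ.exists_isSubmanifoldNear_focal hF hb hcrit hy
      smooth := hs
      mapsTo := mapsTo_image _ _
      critical := fun δ G hδ hG => hP.hasDerivAt_energy_zero hF hb hξ hcrit hG hδ hlap hM }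

end IsConicalTransnormal

end LevelSets

/-! ### From functions on the sphere to their radial extensions. -/

section Isoparametric

variable {n : ℕ} {f : sphere (0 : EuclideanSpace ℝ (Fin (n + 2))) 1 → ℝ}

theorem radialExtension_of_ne_zero {x : EuclideanSpace ℝ (Fin (n + 2))} (hx : x ≠ 0)
    (h : ‖x‖⁻¹ • x ∈ sphere (0 : EuclideanSpace ℝ (Fin (n + 2))) 1) :
    radialExtension f x = f ⟨‖x‖⁻¹ • x, h⟩ :=
  dif_neg hx

theorem radialExtension_coe (x : sphere (0 : EuclideanSpace ℝ (Fin (n + 2))) 1) :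
    radialExtension f x = f x := by
  have hx : ‖(x : EuclideanSpace ℝ (Fin (n + 2)))‖ = 1 := mem_sphere_zero_iff_norm.1 x.2
  have h : ‖(x : EuclideanSpace ℝ (Fin (n + 2)))‖⁻¹ • (x : EuclideanSpace ℝ (Fin (n + 2))) = x := by
    rw [hx, inv_one, one_smul]
  rw [radialExtension_of_ne_zero (norm_ne_zero_iff.1 (by simp [hx])) (by rw [h]; exact x.2)]
  congr 1
  exact Subtype.ext h

theorem radialExtension_smul {x : EuclideanSpace ℝ (Fin (n + 2))} (hx : x ≠ 0) {r : ℝ}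
    (hr : 0 < r) : radialExtension f (r • x) = radialExtension f x := by
  have h : ∀ z : EuclideanSpace ℝ (Fin (n + 2)), z ≠ 0 →
      ‖z‖⁻¹ • z ∈ sphere (0 : EuclideanSpace ℝ (Fin (n + 2))) 1 := fun z hz => by
    rw [mem_sphere_zero_iff_norm, norm_smul, norm_inv, norm_norm,
      inv_mul_cancel₀ (norm_ne_zero_iff.2 hz)]
  have hrx : r • x ≠ 0 := smul_ne_zero hr.ne' hx
  rw [radialExtension_of_ne_zero hx (h x hx), radialExtension_of_ne_zero hrx (h _ hrx)]
  congr 2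
  rw [norm_smul, Real.norm_eq_abs, abs_of_pos hr, smul_smul]
  congr 1
  field_simp

theorem contDiffAt_radialExtension (hf : ContMDiff (𝓡 (n + 1)) 𝓘(ℝ, ℝ) ∞ f)
    {x : EuclideanSpace ℝ (Fin (n + 2))} (hx : x ≠ 0) :
    ContDiffAt ℝ ∞ (radialExtension f) x := by
  let O : TopologicalSpace.Opens (EuclideanSpace ℝ (Fin (n + 2))) := ⟨{z | z ≠ 0}, isOpen_ne⟩
  have hmem : ∀ z : O, ‖(z : EuclideanSpace ℝ (Fin (n + 2)))‖⁻¹ • (z : EuclideanSpace ℝ (Fin (n + 2)))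
      ∈ sphere (0 : EuclideanSpace ℝ (Fin (n + 2))) 1 := fun z => by
    rw [mem_sphere_zero_iff_norm, norm_smul, norm_inv, norm_norm,
      inv_mul_cancel₀ (norm_ne_zero_iff.2 z.2)]
  have h1 : ContMDiff 𝓘(ℝ, EuclideanSpace ℝ (Fin (n + 2))) 𝓘(ℝ, EuclideanSpace ℝ (Fin (n + 2))) ∞
      (fun z : O => ‖(z : EuclideanSpace ℝ (Fin (n + 2)))‖⁻¹ •
        (z : EuclideanSpace ℝ (Fin (n + 2)))) := fun z => by
    have h2 : ContDiffAt ℝ ∞ (fun z : EuclideanSpace ℝ (Fin (n + 2)) => ‖z‖⁻¹ • z) z :=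
      ((contDiffAt_norm ℝ z.2).inv (norm_ne_zero_iff.2 z.2)).smul contDiffAt_id
    exact contMDiffAt_subtype_iff.2 h2.contMDiffAt
  have h3 : ContMDiff 𝓘(ℝ, EuclideanSpace ℝ (Fin (n + 2))) 𝓘(ℝ, ℝ) ∞
      (fun z : O => radialExtension f z) := by
    have : Fact (finrank ℝ (EuclideanSpace ℝ (Fin (n + 2))) = n + 1 + 1) := ⟨by simp⟩
    have h4 := hf.comp (h1.codRestrict_sphere hmem)
    refine h4.congr fun z => ?_
    exact radialExtension_of_ne_zero z.2 (hmem z)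
  exact (contMDiffAt_subtype_iff.1 (h3 ⟨x, hx⟩)).contDiffAt

theorem sphereLevel_radialExtension (c : ℝ) :
    sphereLevel (radialExtension f) c = Subtype.val '' (f ⁻¹' {c}) := by
  ext x
  constructor
  · rintro ⟨h1, h2⟩
    have hx : x ∈ sphere (0 : EuclideanSpace ℝ (Fin (n + 2))) 1 := mem_sphere_zero_iff_norm.2 h1
    exact ⟨⟨x, hx⟩, (radialExtension_coe ⟨x, hx⟩).symm.trans h2, rfl⟩
  · rintro ⟨y, hy, rfl⟩
    exact ⟨mem_sphere_zero_iff_norm.1 y.2, (radialExtension_coe y).trans hy⟩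

theorem isConicalTransnormal_radialExtension (hf : ContMDiff (𝓡 (n + 1)) 𝓘(ℝ, ℝ) ∞ f)
    {b : ℝ → ℝ} (hb : ContDiff ℝ ∞ b) (hfb : ∀ x, ‖sphereGradient f x‖ ^ 2 = b (f x)) :
    IsConicalTransnormal (radialExtension f) b where
  contDiffAt _ hx := contDiffAt_radialExtension hf hx
  map_smul _ hx _ hr := radialExtension_smul hx hr
  contDiff := hb
  norm_gradient x hx := by
    have hx' : x ∈ sphere (0 : EuclideanSpace ℝ (Fin (n + 2))) 1 := mem_sphere_zero_iff_norm.2 hx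
    have h1 := hfb ⟨x, hx'⟩
    rwa [← radialExtension_coe (f := f)] at h1

theorem trace_hess_eq_laplacian {E : Type*} [NormedAddCommGroup E] [InnerProductSpace ℝ E]
    [FiniteDimensional ℝ E] [CompleteSpace E] {F : E → ℝ} {x : E} (h : ContDiffAt ℝ ∞ F x) :
    LinearMap.trace ℝ E (hess F x : E →ₗ[ℝ] E) = Laplacian.laplacian F x := by
  rw [LinearMap.trace_eq_sum_inner _ (stdOrthonormalBasis ℝ E),
    InnerProductSpace.laplacian_eq_iteratedFDeriv_orthonormalBasis F (stdOrthonormalBasis ℝ E)]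
  refine Finset.sum_congr rfl fun j _ => ?_
  rw [iteratedFDeriv_two_apply, real_inner_comm]
  exact inner_hess_eq h _ _

/-- A unit vector orthogonal to the tangent space and to x has ⟨∇F, ξ⟩² = b(c) = |∇F|², read off
from the explicit projection; this is the case of equality in Cauchy–Schwarz. -/
theorem IsUnitNormalField.isGradientNormal {F : EuclideanSpace ℝ (Fin (n + 2)) → ℝ} {b : ℝ → ℝ}
    {c : ℝ} {U : Set (EuclideanSpace ℝ (Fin (n + 2)))}
    {P ξ : EuclideanSpace ℝ (Fin (n + 2)) → EuclideanSpace ℝ (Fin (n + 2))}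
    (hξ : IsUnitNormalField (sphereLevel F c) ξ) (hF : IsConicalTransnormal F b) (hb : 0 < b c)
    (hP : IsLevelRetraction F b c n U P) : IsGradientNormal F c ξ where
  contDiffOn := hξ.smooth
  norm_eq_one := hξ.norm_eq_one
  gradient_eq x hx := by
    have h1 := hξ.normal x hx _ (hP.isNormalRetraction.fderiv_mem_tangentSubspace hx (ξ x))
    have h2 : ‖gradient F x‖ ^ 2 = b c := by rw [hF.norm_gradient x hx.1, hx.2]
    have h3 := hξ.tangent_sphere x hx
    rw [hP.fderiv_eq x hx, inner_sub_right, inner_sub_right, inner_smul_right, inner_smul_right,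
      h3, real_inner_self_eq_norm_sq, hξ.norm_eq_one x hx,
      real_inner_comm (gradient F x) (ξ x)] at h1
    set k := ⟪gradient F x, ξ x⟫_ℝ with hk
    have h4 : k ^ 2 = b c := by
      field_simp at h1
      linarith
    rw [← sub_eq_zero, ← norm_eq_zero, ← sq_eq_zero_iff, norm_sub_sq_real, h2, inner_smul_right,
      ← hk, norm_smul, hξ.norm_eq_one x hx, mul_one, Real.norm_eq_abs, sq_abs, h4]
    linarith

end Isoparametric

end

theorem proposition1p5 (n : ℕ) (M : Set (EuclideanSpace ℝ (Fin (n + 2))))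
    (hM : IsIsoparametricHypersurface M)
    (ξ : EuclideanSpace ℝ (Fin (n + 2)) → EuclideanSpace ℝ (Fin (n + 2)))
    (hξ : IsUnitNormalField M ξ) (θ : ℝ) (hθ : IsFocalAngle M ξ θ) :
    IsHarmonicMap n M (focalSubmanifold M ξ θ) (focalMap ξ θ) := by
  obtain ⟨f, c, hf, ⟨x₀, hx₀⟩, hreg, rfl⟩ := hM
  obtain ⟨b, hb, hfb⟩ := hf.gradient_eq
  obtain ⟨a, ha⟩ := hf.laplacian_eq
  have hF := isConicalTransnormal_radialExtension hf.smooth hb hfb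
  have hcompact : IsCompact (sphereLevel (radialExtension f) c) := by
    rw [sphereLevel_radialExtension]
    exact ((isClosed_singleton.preimage hf.smooth.continuous).isCompact).image
      continuous_subtype_val
  -- Regularity of the level enters the argument only through this inequality.
  have hbc : 0 < b c := by
    rw [← hx₀, ← hfb]
    exact pow_pos (norm_pos_iff.2 (hreg x₀ hx₀)) 2
  have hlap : ∀ x ∈ sphereLevel (radialExtension f) c,
      LinearMap.trace ℝ _ (hess (radialExtension f) x).toLinearMap = a c := by
    intro x hx
    have hx0 := IsConicalTransnormal.ne_zero_of_norm_eq_one hx.1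
    rw [sphereLevel_radialExtension] at hx
    obtain ⟨y, hy, rfl⟩ := hx
    rw [trace_hess_eq_laplacian (hF.contDiffAt _ hx0)]
    exact (ha y).trans (congrArg a hy)
  have hne : (sphereLevel (radialExtension f) c).Nonempty := by
    rw [sphereLevel_radialExtension]
    exact ⟨x₀, x₀, hx₀, rfl⟩
  rw [← sphereLevel_radialExtension] at hξ hθ ⊢
  have hn : finrank ℝ (EuclideanSpace ℝ (Fin (n + 2))) = n + 2 := by simp
  obtain ⟨U, P, hP⟩ := hF.exists_isLevelRetraction hbc hn hne
  have hξ' := hξ.isGradientNormal hF hbc hP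
  refine hF.isHarmonicMap_focal hbc hn hξ' (fun x hx => ?_) hlap hcompact hne
  obtain ⟨X, hX, hX0, hXe⟩ := hθ.2 x hx
  exact hξ'.gradient_focal_eq_zero hF hbc hθ.1 hx hX hX0 hXe
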